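/- All graphs are finite, simple and undirected, and the order of a graph is its number of vertices. For a positive integer $k$, let $t(k)$ be the minimum order of a graph that contains every tree on $k$ vertices as an induced subgraph (up to isomorphism), and let $T(k)$ be the number of graphs of order $t(k)$, counted up to isomorphism, that contain every tree on $k$ vertices as an induced subgraph. Then \[ \begin{array}{c|ccccccc} k & 1 & 2 & 3 & 4 & 5 & 6 & 7\\ \hline t(k) & 1 & 2 & 3 & 5 & 7 & 9 & 11\\ T(k) & 1 & 1 & 1 & 2 & 18 & 66 & 687 \end{array} \] -/

import Mathlib

/-- `G` contains every tree on `k` vertices as an induced subgraph. Every tree on `k` vertices is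
isomorphic to one with vertex set `Fin k`, and `H.IsIndContained G` says that `H` is isomorphic to an induced
subgraph of `G`. -/
def IsInducedUniversalForTrees {V : Type*} (k : ℕ) (G : SimpleGraph V) : Prop :=
  ∀ H : SimpleGraph (Fin k), H.IsTree → H.IsIndContained G

/-- The orders of the finite graphs that contain every tree on `k` vertices as an induced
subgraph. -/
def treeUniversalOrders (k : ℕ) : Set ℕ :=
  {n | ∃ G : SimpleGraph (Fin n), IsInducedUniversalForTrees k G}

/-- `t(k)`: the minimum order of a graph containing all `k`-vertex trees as induced subgraphs. -/
noncomputable def treeUniversalOrder (k : ℕ) : ℕ := sInf (treeUniversalOrders k)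

/-- Some finite graph contains every tree on `k` vertices as an induced subgraph, so the minimum
in the definition of `t(k)` is over a nonempty set. -/
theorem treeUniversalOrders_nonempty (k : ℕ) : (treeUniversalOrders k).Nonempty := by
  classical
  let U : SimpleGraph (SimpleGraph (Fin k) × Fin k) :=
    { Adj := fun p q => p.1 = q.1 ∧ p.1.Adj p.2 q.2
      symm := ⟨fun p q h => ⟨h.1.symm, h.1 ▸ h.2.symm⟩⟩
      loopless := ⟨fun p h => p.1.loopless.irrefl _ h.2⟩ }
  refine ⟨_, U.overFin rfl, fun H _ => ?_⟩
  let f : H ↪g U :=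
    { toFun := fun a => (H, a)
      inj' := fun a b h => (Prod.mk.inj h).2
      map_rel_iff' := by
        intro a b
        exact ⟨fun h => h.2, fun h => ⟨rfl, h⟩⟩ }
  exact ⟨(U.overFinIso rfl).toEmbedding.comp f⟩

theorem treeUniversalOrder_isLeast (k : ℕ) :
    IsLeast (treeUniversalOrders k) (treeUniversalOrder k) :=
  ⟨Nat.sInf_mem (treeUniversalOrders_nonempty k), fun _ h => Nat.sInf_le h⟩

/-- Graph isomorphism, as an equivalence relation on the graphs with vertex set `Fin n` that
contain every tree on `k` vertices as an induced subgraph. -/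
def treeUniversalSetoid (k n : ℕ) :
    Setoid {G : SimpleGraph (Fin n) // IsInducedUniversalForTrees k G} where
  r G H := Nonempty (G.1 ≃g H.1)
  iseqv :=
    ⟨fun _ => ⟨SimpleGraph.Iso.refl⟩, fun ⟨e⟩ => ⟨e.symm⟩, fun ⟨e⟩ ⟨f⟩ => ⟨e.trans f⟩⟩

/-- `T(k)`: the number of isomorphism classes of graphs of order `t(k)` that contain all
`k`-vertex trees as induced subgraphs. -/
noncomputable def treeUniversalCount (k : ℕ) : ℕ :=
  Nat.card (Quotient (treeUniversalSetoid k (treeUniversalOrder k)))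

/-! ### Bit-level search procedures

These functions are evaluated by the kernel. They are written with recursors and with the natural number operations
that the kernel implements natively. A graph on `{0, …, n - 1}` is coded by a number whose bit
`n * a + b` is set for the edges `a < b`. -/

namespace TreeUniversal

noncomputable section

/-! A graph universal for the trees on `k` vertices contains an induced star and an induced path on
`k` vertices. How the two overlap is recorded by a word that says of each path vertex whether it is
the centre, a leaf of the star, or outside the star. Star vertices on the path are adjacent exactly
if they are consecutive there, so the path contains either the centre with at most two leaves, or an
independent set of leaves. This leaves few words up to reversal (`consistent_types`,
`wordsComplete`). For `k = 4, 5, 6` at most three vertices are shared, hence at least `2 * k - 3`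
vertices are needed, and these lower bounds take no search.

For each word the vertices can be numbered in a fixed way (`exists_normalForm`): the centre is `0`,
the leaves are `1, …, k - 1`, the others follow, within each class the path vertices come first, and
the leaves off the path are sorted by their neighbourhoods outside the star. All pairs inside the
star or inside the path are then known. The other pairs are decided one by one by a binary search.
For each remaining tree its conceivable placements are listed beforehand as sets of required edges
and nonedges, and a branch is cut when some tree has lost all its placements. Soundness
(`search_sound`) follows the universal graph itself down the search tree: decisions that agree with
the graph never remove the placements that the graph really has, so its code arrives at a leaf.
There the check says that the graph is isomorphic to an entry of an explicit table
(`exists_of_leaf`).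

To list fewer placements, vertices of a tree that are exchanged by automorphisms may be required to
have increasing images. A lexicographically least embedding meets all these requirements
simultaneously (`exists_extends_of_isIndContained`). That the lists of trees are complete follows by
induction, attaching leaves (`Classifies.succ`).

Conversely, each table entry comes with a placement of every tree (`universal_of_certified`), and
the entries are pairwise nonisomorphic because a colour refinement invariant separates them. So the
tables are systems of representatives (`card_quotient_eq`). Since isolated vertices may be added,
excluding one order excludes all smaller ones (`lower_bound`).

All finite checks are Boolean functions evaluated by the kernel. Where only one direction of
correctness matters, only that one is proved: a weak guard or a poor relabelling can make a check
slow or make it fail, but cannot make a false conclusion pass. -/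

def bit (c v : ℕ) : Bool :=
  Nat.rec false (fun _ _ => true) (Nat.land (Nat.shiftRight c v) 1)

def band (a b : Bool) : Bool := Bool.rec false b a

def bor (a b : Bool) : Bool := Bool.rec b true a

def scanStep {α : Type} (ih : ℕ → α → α) (f : ℕ → α → α) (c : ℕ) (acc : α) : α :=
  Nat.rec acc
    (fun _ _ => f (Nat.log2 c) (ih (Nat.xor c (Nat.pow 2 (Nat.log2 c))) acc)) c

/-- Folds `f` over the positions of the binary digits `1` of a number. -/
def scan {α : Type} (fuel : ℕ) (f : ℕ → α → α) : ℕ → α → α :=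
  Nat.rec (fun _ acc => acc) (fun _ ih => scanStep ih f) fuel

/-- The elements of the bit set `c` that may be the image of a new vertex, where the image `m` of an earlier
vertex is given: `kind` is `1` for adjacent vertices, `0` for nonadjacent ones, and `2` for nonadjacent
ones whose images have to be in increasing order. The numbers `P` and `Q` code the possible
edges and the possible nonedges. -/
def restrict (n P Q kind m c : ℕ) : ℕ :=
  Nat.rec (Nat.land c (Nat.shiftRight Q (Nat.mul n m)))
    (fun k _ => Nat.rec (Nat.land c (Nat.shiftRight P (Nat.mul n m)))
      (fun _ _ => Nat.land (Nat.shiftLeft (Nat.shiftRight c (Nat.succ m)) (Nat.succ m))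
        (Nat.shiftRight Q (Nat.mul n m))) k) kind

def cand (n P Q : ℕ) (ks : List ℕ) : List ℕ → ℕ → ℕ :=
  List.rec (fun _ c => c)
    (fun k _ ih ms c => List.rec c (fun m ms' _ => ih ms' (restrict n P Q k m c)) ms) ks

/-- Literals live in two blocks of `n * n` positions: edges first, then nonedges. Kind `2` is a
nonedge as well; its order condition matters for the choice of candidates only. -/
def litOffset (n kind : ℕ) : ℕ :=
  Nat.rec (Nat.mul n n) (fun k _ => Nat.rec 0 (fun _ _ => Nat.mul n n) k) kind

/-- The new vertex `v` does not enter here: the literals are those of row `0`, and `placeStep`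
shifts them by `n * v` into row `v`. They are thus computed once for all candidates. -/
def lits (n : ℕ) (ks : List ℕ) : List ℕ → ℕ → ℕ :=
  List.rec (fun _ c => c)
    (fun k _ ih ms c => List.rec c (fun m ms' _ =>
      ih ms' (Nat.lor c (Nat.pow 2 (Nat.add m (litOffset n k))))) ms) ks

def placeStep (n : ℕ) (ih : List ℕ → ℕ → List ℕ → List ℕ)
    (ms : List ℕ) (R c l : ℕ) (acc : List ℕ) : List ℕ :=
  scan n (fun v acc => ih (v :: ms) (Nat.lor R (Nat.shiftLeft l (Nat.mul n v))) acc) c acc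

/-- The sets of literals (edges and nonedges) that the placements of a tree require. -/
def place (n P Q : ℕ) (kss : List (List ℕ)) : List ℕ → ℕ → List ℕ → List ℕ :=
  List.rec (fun _ R acc => R :: acc)
    (fun ks _ ih ms R acc =>
      placeStep n ih ms R (cand n P Q ks ms (Nat.pred (Nat.pow 2 n))) (lits n ks ms 0) acc) kss

/-- Both cases of the `Bool.rec` agree. The comparison with `0` only forces the accumulator to be
evaluated, so that no growing expression is passed on. -/
def maskStep (b : ℕ) (ih : ℕ → ℕ) (acc : ℕ) : ℕ :=
  (fun a => Bool.rec (ih a) (ih a) (Nat.beq a 0)) (Nat.add (Nat.mul 2 acc) b)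

/-- The bit set of the positions in `Rs` of the sets of literals that are disjoint from `lit`. -/
def mask (lit : ℕ) (Rs : List ℕ) : ℕ → ℕ :=
  List.rec (fun acc => acc) (fun R _ ih => maskStep (Nat.sub 1 (Nat.land R lit)) ih) Rs

/-- `true` if a block of the bit set `T` is empty, and `k` otherwise. The blocks are the blocks of digits `1`
of `M`, and `G` has the digits above each of them. -/
def guarded (M G T : ℕ) (k : Bool) : Bool :=
  Bool.rec true k (Nat.beq (Nat.land (Nat.add T M) G) G)

def branch (M G : ℕ) (ih : ℕ → ℕ → Bool) (T g : ℕ) : Bool := guarded M G T (ih T g)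

def dfsStep (M G : ℕ) (ih : ℕ → ℕ → Bool) (d : ℕ × ℕ × ℕ) (S g : ℕ) : Bool :=
  Prod.rec (fun w m => Prod.rec (fun m₁ m₀ =>
    band (branch M G ih (Nat.land S m₁) (Nat.lor g w)) (branch M G ih (Nat.land S m₀) g)) m) d

/-- Checks `leaf` for all graphs obtained by decisions on the undetermined pairs, except where some tree has
no placement left. -/
def dfs (M G : ℕ) (leaf : ℕ → Bool) (ds : List (ℕ × ℕ × ℕ)) : ℕ → ℕ → Bool :=
  List.rec (fun _ g => leaf g) (fun d _ ih => dfsStep M G ih d) ds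

def pairs (n : ℕ) : List (ℕ × ℕ) :=
  (List.range n).reverse.flatMap fun b => (List.range b).reverse.map fun a => (a, b)

def ofPairs (n : ℕ) (l : List (ℕ × ℕ)) : ℕ :=
  l.foldr (fun p c => Nat.lor c (2 ^ (n * p.1 + p.2))) 0

def symPairs (l : List (ℕ × ℕ)) : List (ℕ × ℕ) := l ++ l.map Prod.swap

/-- What a star on `{0, …, k - 1}` with centre `0` and a path with vertices `ps` say about a pair. -/
def known (k : ℕ) (ps : List ℕ) (p : ℕ × ℕ) : Option Bool :=
  if p.1 < k ∧ p.2 < k then some (p.1 == 0 || p.2 == 0)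
  else if p.1 ∈ ps ∧ p.2 ∈ ps then
    some (ps.idxOf p.1 + 1 == ps.idxOf p.2 || ps.idxOf p.2 + 1 == ps.idxOf p.1)
  else none

/-- The vertices of a path whose vertices are of the given types (`0` for the centre of the star,
`1` for its leaves, `2` for the other vertices), where vertices of the same type are numbered in the order
of the path. -/
def labels : List ℕ → ℕ → ℕ → List ℕ
  | [], _, _ => []
  | 0 :: w, l, o => 0 :: labels w l o
  | 1 :: w, l, o => l :: labels w (l + 1) o
  | _ :: w, l, o => o :: labels w l (o + 1)

/-- The relations of each vertex of a tree to the earlier ones, from the latest to the first. The tree is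
given by the list of the parents; `con` lists pairs of vertices whose images have to be in increasing order. -/
def spec (p : List ℕ) (con : List (ℕ × ℕ)) : List (List ℕ) :=
  (List.range p.length).map fun i => (List.range i).reverse.map fun j =>
    if p.getD i 0 = j then 1 else if (j, i) ∈ con then 2 else 0

/-- Both orientations occur, since a placement records a pair as (new vertex, earlier vertex), in
whatever order the numbers are. -/
def edgeLit (n a b : ℕ) : ℕ := 2 ^ (n * a + b) ||| 2 ^ (n * b + a)

def nonEdgeLit (n a b : ℕ) : ℕ := 2 ^ (n * n + (n * a + b)) ||| 2 ^ (n * n + (n * b + a))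

/-- Choosing the edge keeps the placements that do not need the nonedge, and vice versa; hence the
apparently swapped masks. -/
def decision (n : ℕ) (Rs : List ℕ) (p : ℕ × ℕ) : ℕ × ℕ × ℕ :=
  (2 ^ (n * p.1 + p.2), mask (nonEdgeLit n p.1 p.2) Rs 0, mask (edgeLit n p.1 p.2) Rs 0)

/-- Placements use the bits below `2 * (n * n)` only, so bit `2 * (n * n)` distinguishes separators
from placements. -/
def sep (n : ℕ) : ℕ := 2 ^ (2 * (n * n) + 1) - 1

def blocks (n P Q : ℕ) (kss : List (List (List ℕ))) : List ℕ :=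
  kss.foldr (fun ks acc => sep n :: place n P Q ks [] 0 acc) []

/-- An undetermined pair counts as possible for both values of `x`. -/
def possible (n k : ℕ) (ps : List ℕ) (x : Bool) : ℕ :=
  ofPairs n (symPairs ((pairs n).filter fun p => known k ps p != some !x))

/-- `M` has digit `1` at the placements and `0` at the separators, and `mask 0 Rs 0` has digit `1`
throughout, so their `xor` marks the separators. `M` is also the initial set of surviving
placements. -/
def searchAux (n k : ℕ) (ps : List ℕ) (leaf : ℕ → Bool) (Rs : List ℕ) : Bool :=
  (fun M => dfs M (Nat.xor (mask 0 Rs 0) M) leaf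
    (((pairs n).filter fun p => known k ps p == none).map (decision n Rs)) M)
    (mask (2 ^ (2 * (n * n))) Rs 0)
    (ofPairs n ((pairs n).filter fun p => known k ps p == some true))

/-- Checks `leaf` for all graphs on `n` vertices that contain a star on `{0, …, k - 1}`, a path whose vertices have
the types `w`, and all trees with specifications `kss`. -/
def search (n k : ℕ) (kss : List (List (List ℕ))) (leaf : ℕ → Bool) (w : List ℕ) : Bool :=
  (fun ps => searchAux n k ps leaf (blocks n (possible n k ps true) (possible n k ps false) kss))
    (labels w 1 k)

/-- A graph code stores pairs `a < b` only, so for such a code the row shows the neighbours above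
`v`. -/
def row (n g v : ℕ) : ℕ := Nat.land (Nat.shiftRight g (Nat.mul n v)) (Nat.pred (Nat.pow 2 n))

def sorted (n g : ℕ) (ls : List ℕ) : Bool :=
  List.rec true (fun l _ ih => band (Nat.ble (row n g l) (row n g (Nat.succ l))) ih) ls

/-- The leaves `l` of the star such that `l` and `l + 1` are not on the path. -/
def freeLeaves (k : ℕ) (w : List ℕ) : List ℕ :=
  (List.range (k - 1)).filter fun l => w.count 1 < l

def adj (n g a b : ℕ) : Bool :=
  bor (bit g (Nat.add (Nat.mul n a) b)) (bit g (Nat.add (Nat.mul n b) a))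

/-! The order of the vertices in which a graph is relabelled is found by colour refinement. Vectors of numbers below
`2 ^ 48` are packed into one number. -/

/-- The adjacency matrix with reversed columns, its rows starting `2 * n` slots apart. In the
product with the packed squares, slot `2 * n * a + (n - 1)` then holds the sum of squares over the
neighbours of `a`: a matrix times a vector by one multiplication. -/
def packedRows (n g : ℕ) : ℕ :=
  scan (Nat.mul n n) (fun x acc => (fun a b => Nat.add acc (Nat.add
    (Nat.pow 2 (Nat.mul 48 (Nat.add (Nat.mul (Nat.mul 2 n) a) (Nat.sub (Nat.pred n) b))))
    (Nat.pow 2 (Nat.mul 48 (Nat.add (Nat.mul (Nat.mul 2 n) b) (Nat.sub (Nat.pred n) a))))))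
    (Nat.div x n) (Nat.mod x n)) g 0

def packedSquares (hs : List ℕ) : ℕ :=
  List.rec 0 (fun h _ ih => Nat.add (Nat.mul h h) (Nat.mul ih 281474976710656)) hs

/-- Successive results are `2 * n` slots, that is `96 * n` bits, apart. Reduction modulo `1000003`
keeps the colours small enough for sums of their squares to fit into a slot at the orders
considered. -/
def refineAux (n : ℕ) (hs : List ℕ) : ℕ → List ℕ :=
  List.rec (fun _ => []) (fun h _ ih X =>
    Nat.mod (Nat.add (Nat.mul 7 h) (Nat.land X 281474976710655)) 1000003 ::
      ih (Nat.shiftRight X (Nat.mul 96 n))) hs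

def refine (n R : ℕ) (hs : List ℕ) : List ℕ :=
  refineAux n hs (Nat.shiftRight (Nat.mul (packedSquares hs) R) (Nat.mul 48 (Nat.pred n)))

def insertNat (x : ℕ) (l : List ℕ) : List ℕ :=
  List.rec [x] (fun y ys ih => Bool.rec (y :: ih) (x :: y :: ys) (Nat.ble x y)) l

def sortNat (l : List ℕ) : List ℕ := List.rec [] (fun x _ ih => insertNat x ih) l

/-- The index sits in the lowest four bits, so sorting is by colour with ties broken by index, and
the index can be read off afterwards. This is where order at most `16` is needed. -/
def tag (l : List ℕ) : ℕ → List ℕ :=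
  List.rec (fun _ => []) (fun h _ ih i => Nat.add (Nat.mul 16 h) i :: ih (Nat.succ i)) l

def colourOrder (n R : ℕ) (hs : List ℕ) : List ℕ :=
  (sortNat (tag (refine n R (refine n R (refine n R hs))) 0)).map fun x => Nat.land x 15

def relRow (n g x : ℕ) (ys : List ℕ) : ℕ → ℕ → ℕ :=
  List.rec (fun _ acc => acc) (fun y _ ih e acc =>
    ih (Nat.succ e) (Bool.rec acc (Nat.lor acc (Nat.pow 2 e)) (adj n g x y))) ys

def relAux (n g : ℕ) (xs : List ℕ) : ℕ → ℕ → ℕ :=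
  List.rec (fun _ acc => acc) (fun x xs ih e acc =>
    ih (Nat.add e (Nat.succ n)) (relRow n g x xs e acc)) xs

/-- The code of the graph in which the vertices are renumbered in the order `o`. -/
def relabel (n g : ℕ) (o : List ℕ) : ℕ := relAux n g o 1 0

def memNat (x : ℕ) (l : List ℕ) : Bool := List.rec false (fun y _ ih => bor (Nat.beq x y) ih) l

def inTable (tbl : List (List ℕ)) (g : ℕ) : Bool := memNat g (tbl.getD (Nat.mod g 31) [])

/-- Whether `g` becomes an entry of the table when it is relabelled by colour refinement, possibly after one vertex
got a colour of its own. -/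
def recognize (n : ℕ) (tbl : List (List ℕ)) (g : ℕ) : Bool :=
  (fun R => (fun hs => List.rec false (fun v _ ih =>
      bor (inTable tbl (relabel n g (colourOrder n R (hs.modify v (· + 100))))) ih)
      -- Index `n` is out of range, so `modify` changes nothing there: this is the unmodified
      -- colouring, and it is tried first.
      (List.range (n + 1)).reverse)
    (refine n R (List.replicate n 1)))
  (packedRows n g)

/-! Embeddings -/

def embStep (n : ℕ) (ih : List ℕ → Bool) (ms : List ℕ) (c : ℕ) : Bool :=
  scan n (fun v acc => bor (ih (v :: ms)) acc) c false

/-- Whether a partial placement of a tree extends to a placement, where `P` and `Q` code the edges and the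
nonedges. -/
def emb (n P Q : ℕ) (kss : List (List ℕ)) : List ℕ → Bool :=
  List.rec (fun _ => true) (fun ks _ ih ms =>
    embStep n ih ms (cand n P Q ks ms (Nat.pred (Nat.pow 2 n)))) kss

/-- Whether a partial placement of a tree in the graph with code `g` extends to a placement. -/
def embedsFrom (n g : ℕ) (kss : List (List ℕ)) (ms : List ℕ) : Bool :=
  emb n (ofPairs n (symPairs ((pairs n).filter fun p => adj n g p.1 p.2)))
    (ofPairs n (symPairs ((pairs n).filter fun p => !adj n g p.1 p.2))) kss ms

/-- The condition checked for the graphs found by `search`. -/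
def leaf (n : ℕ) (ls : List ℕ) (tbl : List (List ℕ)) (ex : List (List (List ℕ))) (g : ℕ) : Bool :=
  Bool.rec true (bor (recognize n tbl g)
    (List.rec false (fun ks _ ih => bor (Bool.rec true false (embedsFrom n g ks [])) ih) ex))
    (sorted n g ls)

/-- Checks that the vertex `v` has the relations `ks` to the vertices `ms`. -/
def fits (n g v : ℕ) (ks : List ℕ) : List ℕ → Bool :=
  List.rec (fun _ => true) (fun k _ ih ms => List.rec true (fun m ms' _ =>
    band (Bool.rec true false (Nat.beq v m))
      (band (Nat.rec (Bool.rec true false (adj n g v m)) (fun _ _ => adj n g v m) k) (ih ms'))) ms) ks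

/-- Checks the placement of a tree whose vertices are the hexadecimal digits of `c`. -/
def fitsAll (n g : ℕ) (kss : List (List ℕ)) : List ℕ → ℕ → Bool :=
  List.rec (fun _ _ => true) (fun ks _ ih ms c => (fun v =>
    band (Nat.ble (Nat.succ v) n) (band (fits n g v ks ms) (ih (v :: ms) (Nat.shiftRight c 4))))
    (Nat.land c 15)) kss

def fitsTrees (n k g : ℕ) (ts : List (List (List ℕ))) : ℕ → Bool :=
  List.rec (fun _ => true) (fun kss _ ih c =>
    band (fitsAll n g kss [] c) (ih (Nat.shiftRight c (Nat.mul 4 k)))) ts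

def certified (n k : ℕ) (ts : List (List (List ℕ))) (l : List ℕ) : List ℕ → Bool :=
  List.rec (fun _ => true) (fun g _ ih cs => List.rec false (fun c cs' _ =>
    band (fitsTrees n k g ts c) (ih cs')) cs) l

/-! An isomorphism invariant -/

def nbrSum (n g v : ℕ) (hs : List ℕ) : ℕ → ℕ :=
  List.rec (fun _ => 0) (fun h _ ih u =>
    Bool.rec (ih (Nat.succ u)) (Nat.add (Nat.mul h h) (ih (Nat.succ u))) (adj n g v u)) hs

def hashAux (n g : ℕ) (hs0 : List ℕ) (hs : List ℕ) : ℕ → List ℕ :=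
  List.rec (fun _ => []) (fun h _ ih v =>
    Nat.add h (nbrSum n g v hs0 0) :: ih (Nat.succ v)) hs

def hashStep (n g : ℕ) (hs : List ℕ) : List ℕ := hashAux n g hs hs 0

def sqSum (hs : List ℕ) : ℕ := List.rec 0 (fun h _ ih => Nat.add (Nat.mul h h) ih) hs

def invariant (n g : ℕ) : ℕ :=
  sqSum (hashStep n g (hashStep n g (hashStep n g (List.replicate n 1))))

def distinct (l : List ℕ) : Bool :=
  List.rec true (fun x xs ih => band (Bool.rec true false (memNat x xs)) ih) l

end

end TreeUniversal

/-! ### Correctness of the bit operations and of the coding of literals -/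

namespace TreeUniversal

theorem bit_eq (c v : ℕ) : bit c v = c.testBit v := by
  unfold bit
  rw [Nat.testBit_eq_decide_div_mod_eq]
  have h : Nat.land (Nat.shiftRight c v) 1 = c / 2 ^ v % 2 := by
    change (c >>> v) &&& 1 = _
    rw [Nat.and_one_is_mod, Nat.shiftRight_eq_div_pow]
  rw [h]
  rcases Nat.mod_two_eq_zero_or_one (c / 2 ^ v) with h | h <;> rw [h] <;> simp

@[simp] theorem band_eq (a b : Bool) : band a b = (a && b) := by cases a <;> rfl

@[simp] theorem bor_eq (a b : Bool) : bor a b = (a || b) := by cases a <;> rfl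

theorem scan_succ {α : Type} (fuel : ℕ) (f : ℕ → α → α) (c : ℕ) (hc : c ≠ 0) (acc : α) :
    scan (fuel + 1) f c acc = f c.log2 (scan fuel f (c ^^^ 2 ^ c.log2) acc) := by
  obtain ⟨c, rfl⟩ := Nat.exists_eq_succ_of_ne_zero hc
  rfl

/-- Each step removes the leading digit, so the number drops below the next smaller power of two and
the fuel suffices. The list is chosen before `f`, so that one list serves for all folds over `c`. -/
theorem scan_eq_foldr (fuel c : ℕ) (hc : c < 2 ^ fuel) :
    ∃ l : List ℕ, (∀ v, v ∈ l ↔ c.testBit v) ∧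
      ∀ {α : Type} (f : ℕ → α → α) (acc : α), scan fuel f c acc = l.foldr f acc := by
  induction fuel generalizing c with
  | zero =>
    obtain rfl : c = 0 := by simpa using hc
    exact ⟨[], by simp, fun f acc => rfl⟩
  | succ fuel ih =>
    rcases eq_or_ne c 0 with rfl | h0
    · exact ⟨[], by simp, fun f acc => rfl⟩
    · have hx : ∀ v, (c ^^^ 2 ^ c.log2).testBit v = true ↔ v ≠ c.log2 ∧ c.testBit v = true := by
        intro v
        rw [Nat.testBit_xor, Nat.testBit_two_pow]
        have := Nat.testBit_log2 h0
        by_cases hv : c.log2 = v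
        · subst hv; simp [this]
        · simp [hv, Ne.symm hv]
      have hlt : c ^^^ 2 ^ c.log2 < 2 ^ fuel := by
        apply Nat.lt_pow_two_of_testBit
        intro v hv
        rw [← Bool.not_eq_true, hx]
        rintro ⟨h1, h2⟩
        have h3 : v ≤ c.log2 := (Nat.le_log2 h0).2 (Nat.ge_two_pow_of_testBit h2)
        have h4 : c.log2 < fuel + 1 := (Nat.log2_lt h0).2 hc
        omega
      obtain ⟨l, hl, hs⟩ := ih _ hlt
      refine ⟨c.log2 :: l, fun v => ?_, fun f acc => ?_⟩
      · rw [List.mem_cons, hl, hx]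
        by_cases hv : v = c.log2
        · subst hv; simp [Nat.testBit_log2 h0]
        · simp [hv]
      · rw [scan_succ _ _ _ h0, hs]; rfl

/-- The condition on the image `v` of a vertex that `restrict` expresses. -/
def Allowed (n P Q v kind m : ℕ) : Prop :=
  (kind = 0 ∧ Q.testBit (n * m + v)) ∨ (kind = 1 ∧ P.testBit (n * m + v)) ∨
    (2 ≤ kind ∧ Q.testBit (n * m + v) ∧ m < v)

theorem testBit_restrict (n P Q kind m c v : ℕ) :
    (restrict n P Q kind m c).testBit v = true ↔ c.testBit v = true ∧ Allowed n P Q v kind m := by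
  match kind with
  | 0 =>
    change (c &&& (Q >>> (n * m))).testBit v = true ↔ _
    simp [Allowed, Nat.testBit_and, Nat.testBit_shiftRight]
  | 1 =>
    change (c &&& (P >>> (n * m))).testBit v = true ↔ _
    simp [Allowed, Nat.testBit_and, Nat.testBit_shiftRight]
  | k + 2 =>
    change (((c >>> (m + 1)) <<< (m + 1)) &&& (Q >>> (n * m))).testBit v = true ↔ _
    simp only [Allowed, Nat.testBit_and, Nat.testBit_shiftRight, Nat.testBit_shiftLeft]
    by_cases h : m < v
    · have : m + 1 + (v - (m + 1)) = v := by omega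
      simp [h, this]
    · simp [h]

@[simp] theorem cand_cons (n P Q k m : ℕ) (ks ms : List ℕ) (c : ℕ) :
    cand n P Q (k :: ks) (m :: ms) c = cand n P Q ks ms (restrict n P Q k m c) := rfl

theorem testBit_cand (n P Q : ℕ) (ks ms : List ℕ) (h : ks.length = ms.length) (c v : ℕ) :
    (cand n P Q ks ms c).testBit v = true ↔
      c.testBit v = true ∧ List.Forall₂ (Allowed n P Q v) ks ms := by
  induction ks generalizing ms c with
  | nil =>
    obtain rfl : ms = [] := List.length_eq_zero_iff.1 h.symm
    exact (and_iff_left .nil).symm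
  | cons k ks ih =>
    cases ms with
    | nil => simp at h
    | cons m ms =>
      rw [cand_cons, ih ms (by simpa using h), testBit_restrict, List.forall₂_cons, and_assoc]

@[simp] theorem lits_cons (n k m : ℕ) (ks ms : List ℕ) (c : ℕ) :
    lits n (k :: ks) (m :: ms) c = lits n ks ms (c ||| 2 ^ (m + litOffset n k)) := rfl

theorem litOffset_eq (n k : ℕ) : litOffset n k = if k = 1 then 0 else n * n := by
  match k with
  | 0 => rfl
  | 1 => rfl
  | k + 2 => rfl

/-- A literal (an edge or a nonedge) of a graph. -/
def Holds (A : ℕ → ℕ → Prop) (n x : ℕ) : Prop :=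
  ∃ a b, a < n ∧ b < n ∧ ((x = n * a + b ∧ A a b) ∨ (x = n * n + (n * a + b) ∧ ¬A a b))

/-- The predicate on positions is arbitrary, so that the shift by `n * v` applied later can be
absorbed into it. -/
theorem testBit_lits (n : ℕ) (X : ℕ → Prop) (ks ms : List ℕ)
    (h : List.Forall₂ (fun k m => X (m + if k = 1 then 0 else n * n)) ks ms) (c : ℕ)
    (hc : ∀ x, c.testBit x = true → X x) (x : ℕ) (hx : (lits n ks ms c).testBit x = true) : X x := by
  induction h generalizing c with
  | nil => exact hc x hx
  | cons h1 _ ih =>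
    rw [lits_cons] at hx
    refine ih _ (fun y hy => ?_) hx
    rw [Nat.testBit_or, Bool.or_eq_true] at hy
    rcases hy with hy | hy
    · exact hc y hy
    · rw [Nat.testBit_two_pow, decide_eq_true_eq, litOffset_eq] at hy
      exact hy ▸ h1

theorem code_inj {n a b c d : ℕ} (hb : b < n) (hd : d < n) (h : n * a + b = n * c + d) :
    a = c ∧ b = d := by
  have hn : 0 < n := by omega
  have h1 := congrArg (· / n) h
  have h2 := congrArg (· % n) h
  simp only [Nat.mul_add_div hn, Nat.mul_add_mod, Nat.div_eq_of_lt hb, Nat.div_eq_of_lt hd,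
    Nat.mod_eq_of_lt hb, Nat.mod_eq_of_lt hd] at h1 h2
  exact ⟨by omega, h2⟩

theorem code_lt {n a b : ℕ} (ha : a < n) (hb : b < n) : n * a + b < n * n := by
  calc n * a + b < n * a + n := by omega
    _ = n * (a + 1) := by ring
    _ ≤ n * n := Nat.mul_le_mul_left _ ha

theorem holds_edge {A : ℕ → ℕ → Prop} {n a b : ℕ} (ha : a < n) (hb : b < n)
    (h : Holds A n (n * a + b)) : A a b := by
  obtain ⟨c, d, hc, hd, ⟨h1, h2⟩ | ⟨h1, _⟩⟩ := h
  · obtain ⟨rfl, rfl⟩ := code_inj hb hd h1; exact h2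
  · have := code_lt ha hb; omega

theorem holds_nonedge {A : ℕ → ℕ → Prop} {n a b : ℕ} (hb : b < n)
    (h : Holds A n (n * n + (n * a + b))) : ¬A a b := by
  obtain ⟨c, d, hc, hd, ⟨h1, _⟩ | ⟨h1, h2⟩⟩ := h
  · have := code_lt hc hd; omega
  · obtain ⟨rfl, rfl⟩ := code_inj hb hd (by omega : n * a + b = n * c + d); exact h2

end TreeUniversal

namespace TreeUniversal

/-! ### Placements -/

/-- The vertices `ms` (the latest first) are extended by the vertices `vs`, in such a way that each new vertex
has the relations `r` to the earlier ones that the specification prescribes. -/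
def Extends (n : ℕ) (r : ℕ → ℕ → ℕ → Prop) : List (List ℕ) → List ℕ → List ℕ → Prop
  | [], _, [] => True
  | ks :: kss, ms, v :: vs => v < n ∧ List.Forall₂ (r v) ks ms ∧ Extends n r kss (v :: ms) vs
  | _, _, _ => False

theorem Extends.mono {n : ℕ} {r s : ℕ → ℕ → ℕ → Prop} (h : ∀ v k m, v < n → m < n → r v k m → s v k m)
    {kss : List (List ℕ)} {ms vs : List ℕ} (hms : ∀ m ∈ ms, m < n) (hr : Extends n r kss ms vs) :
    Extends n s kss ms vs := by
  induction kss generalizing ms vs with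
  | nil => cases vs <;> exact hr
  | cons ks kss ih =>
    cases vs with
    | nil => exact hr
    | cons v vs =>
      obtain ⟨h1, h2, h3⟩ := hr
      refine ⟨h1, ?_, ih (by simpa [h1] using hms) h3⟩
      clear h3 ih
      induction h2 with
      | nil => exact .nil
      | cons h4 _ ih =>
        exact .cons (h _ _ _ h1 (hms _ (by simp)) h4) (ih fun m hm => hms m (by simp [hm]))

/-- The relation of a new vertex `v` to an earlier vertex `m` in a graph. -/
def Relation (A : ℕ → ℕ → Prop) (v k m : ℕ) : Prop :=
  v ≠ m ∧ (if k = 1 then A v m else ¬A v m) ∧ (2 ≤ k → m < v)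

/-- All literals in `R` hold. -/
def Good (A : ℕ → ℕ → Prop) (n R : ℕ) : Prop := ∀ x, R.testBit x = true → Holds A n x

theorem placeStep_eq (n : ℕ) (ih : List ℕ → ℕ → List ℕ → List ℕ) (ms : List ℕ) (R c l : ℕ)
    (acc : List ℕ) : placeStep n ih ms R c l acc =
      scan n (fun v acc => ih (v :: ms) (R ||| l <<< (n * v)) acc) c acc := rfl

theorem place_cons (n P Q : ℕ) (ks : List ℕ) (kss : List (List ℕ)) (ms : List ℕ) (R : ℕ)
    (acc : List ℕ) : place n P Q (ks :: kss) ms R acc =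
      placeStep n (place n P Q kss) ms R (cand n P Q ks ms (2 ^ n - 1)) (lits n ks ms 0) acc := rfl

theorem lits_lt (n : ℕ) (ks ms : List ℕ) (hms : ∀ m ∈ ms, m < n) (c : ℕ)
    (hc : c < 2 ^ (n * n + n)) : lits n ks ms c < 2 ^ (n * n + n) := by
  induction ks generalizing ms c with
  | nil => exact hc
  | cons k ks ih =>
    cases ms with
    | nil => exact hc
    | cons m ms =>
      rw [lits_cons]
      refine ih _ (fun x hx => hms x (by simp [hx])) _ (Nat.or_lt_two_pow hc ?_)
      apply Nat.pow_lt_pow_right one_lt_two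
      have := hms m (by simp)
      rw [litOffset_eq]
      split_ifs <;> omega

theorem restrict_le (n P Q kind m c : ℕ) : restrict n P Q kind m c ≤ c := by
  apply Nat.le_of_testBit
  intro i
  rw [testBit_restrict]
  exact And.left

theorem cand_le (n P Q : ℕ) (ks ms : List ℕ) (c : ℕ) : cand n P Q ks ms c ≤ c := by
  induction ks generalizing ms c with
  | nil => exact le_rfl
  | cons k ks ih =>
    cases ms with
    | nil => exact le_rfl
    | cons m ms => exact (ih _ _).trans (restrict_le ..)

/-- The enumeration passes through every placement that the graph really has: `Allowed` puts each
image among the candidates, and `Relation` makes the literals added for it true. The size bound says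
that no placement carries the separator bit, and the form `L ++ acc` lets the blocks of several
trees be concatenated. -/
theorem place_eq_append (A : ℕ → ℕ → Prop) (n P Q : ℕ) (kss : List (List ℕ)) (ms : List ℕ)
    (R : ℕ) (hms : ∀ m ∈ ms, m < n) (hR : R < 2 ^ (2 * (n * n))) :
    ∃ L : List ℕ, (∀ acc, place n P Q kss ms R acc = L ++ acc) ∧
      (∀ R' ∈ L, R' < 2 ^ (2 * (n * n))) ∧
      (Good A n R → (∃ vs, Extends n
        (fun v k m => Relation A v k m ∧ Allowed n P Q v k m) kss ms vs) →
        ∃ R' ∈ L, Good A n R') := by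
  induction kss generalizing ms R with
  | nil => exact ⟨[R], fun _ => rfl, by simpa using hR, fun h _ => ⟨R, by simp, h⟩⟩
  | cons ks kss ih =>
    have hpos : 0 < 2 ^ n := by positivity
    obtain ⟨l, hl, hs⟩ := scan_eq_foldr n (cand n P Q ks ms (2 ^ n - 1))
      (lt_of_le_of_lt (cand_le ..) (by omega))
    have hln : ∀ v ∈ l, v < n := by
      intro v hv
      have h1 := (Nat.ge_two_pow_of_testBit ((hl v).1 hv)).trans (cand_le ..)
      exact (Nat.pow_lt_pow_iff_right one_lt_two).1 (lt_of_le_of_lt h1 (by omega))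
    set R' : ℕ → ℕ := fun v => R ||| (lits n ks ms 0) <<< (n * v) with hR'
    have hlt : ∀ v, v < n → R' v < 2 ^ (2 * (n * n)) := by
      intro v hv
      refine Nat.or_lt_two_pow hR ?_
      rw [Nat.shiftLeft_eq]
      calc lits n ks ms 0 * 2 ^ (n * v) < 2 ^ (n * n + n) * 2 ^ (n * v) :=
            Nat.mul_lt_mul_of_pos_right (lits_lt n ks ms hms 0 (by positivity)) (by positivity)
        _ = 2 ^ (n * n + n * (v + 1)) := by rw [← pow_add]; ring_nf
        _ ≤ 2 ^ (2 * (n * n)) := by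
            apply Nat.pow_le_pow_right two_pos
            have := Nat.mul_le_mul_left n (Nat.succ_le_of_lt hv)
            simp only [Nat.succ_eq_add_one] at this
            omega
    have key : ∀ v, v < n → _ := fun v hv =>
      ih (v :: ms) (R' v) (by simpa [hv] using hms) (hlt v hv)
    choose! L h1 h2 h3 using key
    refine ⟨l.flatMap L, fun acc => ?_, ?_, ?_⟩
    · rw [place_cons, placeStep_eq, hs]
      clear hs hl
      induction l with
      | nil => rfl
      | cons v l ihl =>
        rw [List.foldr_cons, ihl fun u hu => hln u (by simp [hu]), h1 v (hln v (by simp)),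
          List.flatMap_cons, List.append_assoc]
    · intro x hx
      obtain ⟨v, hv, hx⟩ := List.mem_flatMap.1 hx
      exact h2 v (hln v hv) x hx
    · rintro hg ⟨_ | ⟨v, vs⟩, hvs⟩
      · exact hvs.elim
      · obtain ⟨hv, hf, hvs⟩ := hvs
        have hmem : v ∈ l := by
          rw [hl, testBit_cand _ _ _ _ _ hf.length_eq, Nat.testBit_two_pow_sub_one]
          exact ⟨by simpa using hv, hf.imp fun _ _ h => h.2⟩
        have hlit : Good A n (R' v) := by
          intro x hx
          rw [hR', Nat.testBit_or, Bool.or_eq_true, Nat.testBit_shiftLeft, Bool.and_eq_true,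
            decide_eq_true_eq] at hx
          rcases hx with hx | ⟨hx1, hx2⟩
          · exact hg x hx
          · have hX := testBit_lits n (fun y => Holds A n (n * v + y)) ks ms ?_ 0 (by simp) _ hx2
            · simpa [Nat.add_sub_cancel' hx1] using hX
            · clear hx2 hmem h3 h2 h1 hlt hR' hs hl hvs
              induction hf with
              | nil => exact .nil
              | @cons k m ks ms h4 _ ih4 =>
                refine .cons ⟨v, m, hv, hms m (by simp), ?_⟩
                  (ih4 fun m hm => hms m (by simp [hm]))
                have := h4.1.2.1
                split_ifs at this ⊢ with hk
                · exact Or.inl ⟨by ring, this⟩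
                · exact Or.inr ⟨by ring, this⟩
        obtain ⟨x, hx, hx'⟩ := h3 v hv hlit ⟨vs, hvs⟩
        exact ⟨x, List.mem_flatMap.2 ⟨v, hmem, hx⟩, hx'⟩

/-! ### Bit sets of placements -/

theorem mask_nil (lit acc : ℕ) : mask lit [] acc = acc := rfl

theorem maskStep_eq (b : ℕ) (ih : ℕ → ℕ) (acc : ℕ) : maskStep b ih acc = ih (2 * acc + b) := by
  unfold maskStep
  dsimp only
  cases Nat.beq (Nat.add (Nat.mul 2 acc) b) 0 <;> rfl

theorem mask_cons (lit R : ℕ) (Rs : List ℕ) (acc : ℕ) :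
    mask lit (R :: Rs) acc = mask lit Rs (2 * acc + (1 - (R &&& lit))) :=
  maskStep_eq ..

theorem testBit_mask_add (lit : ℕ) (Rs : List ℕ) (acc j : ℕ) :
    (mask lit Rs acc).testBit (Rs.length + j) = acc.testBit j := by
  induction Rs generalizing acc j with
  | nil => rw [mask_nil]; simp
  | cons R Rs ih =>
    have h1 : (2 * acc + (1 - (R &&& lit))) / 2 = acc := by omega
    rw [mask_cons, show (R :: Rs).length + j = Rs.length + (j + 1) by simp; omega, ih,
      Nat.testBit_add_one, h1]

/-- The list is read into a binary number with its head as the top digit, so an entry's position is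
the number of entries after it. Truncation makes `1 - (R &&& lit)` the indicator of disjointness. -/
theorem testBit_mask (lit R : ℕ) (X Y : List ℕ) (acc : ℕ) :
    (mask lit (X ++ R :: Y) acc).testBit Y.length = decide (R &&& lit = 0) := by
  induction X generalizing acc with
  | nil =>
    rw [List.nil_append, mask_cons, ← add_zero Y.length, testBit_mask_add, Nat.testBit_zero]
    rcases Nat.eq_zero_or_pos (R &&& lit) with h | h
    · simp [h]
    · have : 1 - (R &&& lit) = 0 := by omega
      simp [this, h.ne']
  | cons x X ih => rw [List.cons_append, mask_cons, ih]

/-- Below position `g`, `T` contributes at least `2 ^ t` and `M`, with ones from `t` to `g - 1`, at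
least `2 ^ g - 2 ^ t`. The sum of the lower parts thus reaches `2 ^ g`, and the carry lands on a
position where both digits are `0`. -/
theorem testBit_add_of_carry {T M g t : ℕ} (hT : T.testBit g = false) (hM : M.testBit g = false)
    (htg : t < g) (ht : T.testBit t = true) (h : ∀ i, t ≤ i → i < g → M.testBit i = true) :
    (T + M).testBit g = true := by
  have hp : 0 < 2 ^ g := by positivity
  have e1 : T % 2 ^ g + 2 ^ g * (T / 2 ^ g) = T := Nat.mod_add_div ..
  have e2 : M % 2 ^ g + 2 ^ g * (M / 2 ^ g) = M := Nat.mod_add_div ..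
  have l1 := Nat.mod_lt T hp
  have l2 := Nat.mod_lt M hp
  have g1 : 2 ^ t ≤ T % 2 ^ g := Nat.ge_two_pow_of_testBit (by simp [Nat.testBit_mod_two_pow, htg, ht])
  have g2 : 2 ^ g - 2 ^ t ≤ M % 2 ^ g := by
    apply Nat.le_of_testBit
    intro i hi
    have : 2 ^ g - 2 ^ t = (2 ^ (g - t) - 1) <<< t := by
      rw [Nat.shiftLeft_eq, Nat.sub_mul, ← pow_add, Nat.sub_add_cancel htg.le, one_mul]
    rw [this, Nat.testBit_shiftLeft, Nat.testBit_two_pow_sub_one] at hi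
    simp only [Bool.and_eq_true, decide_eq_true_eq] at hi
    have hig : i < g := by omega
    simp [Nat.testBit_mod_two_pow, hig, h i hi.1 hig]
  have hle : 2 ^ t ≤ 2 ^ g := Nat.pow_le_pow_right two_pos htg.le
  have e3 : T + M = (T % 2 ^ g + M % 2 ^ g - 2 ^ g) + 2 ^ g * (T / 2 ^ g + M / 2 ^ g + 1) := by
    rw [mul_add, mul_add]; omega
  have e4 : (T + M) / 2 ^ g = T / 2 ^ g + M / 2 ^ g + 1 := by
    rw [e3, Nat.add_mul_div_left _ _ hp, Nat.div_eq_of_lt (by omega)]; omega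
  rw [Nat.testBit_eq_decide_div_mod_eq, decide_eq_false_iff_not] at hT hM
  rw [Nat.testBit_eq_decide_div_mod_eq, decide_eq_true_eq, e4]
  omega

/-- Each separator is followed by a good element, with no separator in between. -/
def Alive (good sp : ℕ → Prop) : List ℕ → Prop
  | [] => True
  | s :: Y => (sp s → ∃ U R V, Y = U ++ R :: V ∧ good R ∧ ¬sp R ∧ ∀ x ∈ U, ¬sp x) ∧ Alive good sp Y

theorem Alive.of_append {good sp : ℕ → Prop} {X Y : List ℕ} (h : Alive good sp (X ++ Y)) :
    Alive good sp Y := by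
  induction X with
  | nil => exact h
  | cons x X ih => exact ih h.2

theorem Alive.append {good sp : ℕ → Prop} {X Y : List ℕ} (hX : ∀ x ∈ X, ¬sp x)
    (h : Alive good sp Y) : Alive good sp (X ++ Y) := by
  induction X with
  | nil => exact h
  | cons x X ih =>
    exact ⟨fun hx => absurd hx (hX x (by simp)), ih fun y hy => hX y (by simp [hy])⟩

theorem exists_eq_append_of_lt {Rs : List ℕ} {t : ℕ} (ht : t < Rs.length) :
    ∃ X R Y, Rs = X ++ R :: Y ∧ Y.length = t := by
  refine ⟨Rs.take (Rs.length - 1 - t), Rs[Rs.length - 1 - t], Rs.drop (Rs.length - 1 - t + 1),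
    ?_, ?_⟩
  · simp
  · rw [List.length_drop]; omega

/-- One addition tests all trees at once: a surviving placement in a block of ones causes a carry
into the separator above that block. A good placement always survives, so every separator receives
its carry. The converse, that an empty block is noticed, affects the amount of pruning only and is
not needed. -/
theorem guard_passes {good : ℕ → Prop} {z : ℕ} {Rs : List ℕ}
    (hA : Alive good (fun R => R &&& z ≠ 0) Rs) {T : ℕ}
    (hT : ∀ t, T.testBit t = true → (mask z Rs 0).testBit t = true)
    (hgood : ∀ X R Y, Rs = X ++ R :: Y → good R → T.testBit Y.length = true) :
    (T + mask z Rs 0) &&& (mask 0 Rs 0 ^^^ mask z Rs 0) = mask 0 Rs 0 ^^^ mask z Rs 0 := by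
  apply Nat.eq_of_testBit_eq
  intro g
  rw [Nat.testBit_and]
  cases hg : (mask 0 Rs 0 ^^^ mask z Rs 0).testBit g with
  | false => simp
  | true =>
    rw [Bool.and_true]
    -- Beyond the length of the list both masks have digits `0`, so a separator position lies inside
    -- it.
    have hlt : g < Rs.length := by
      by_contra! hle
      obtain ⟨j, rfl⟩ := Nat.exists_eq_add_of_le hle
      simp [Nat.testBit_xor, testBit_mask_add] at hg
    obtain ⟨X, s, Y, rfl, rfl⟩ := exists_eq_append_of_lt hlt
    have hM : (mask z (X ++ s :: Y) 0).testBit Y.length = false := by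
      rw [Nat.testBit_xor, testBit_mask] at hg
      simpa using hg
    have hs : s &&& z ≠ 0 := by simpa [testBit_mask] using hM
    obtain ⟨U, R, V, rfl, hR, hR', hU⟩ := hA.of_append.1 hs
    refine testBit_add_of_carry (t := V.length) ?_ hM (by simp; omega)
      (hgood (X ++ s :: U) R V (by simp) hR) ?_
    · rw [← Bool.not_eq_true]; intro h; rw [hT _ h] at hM; exact absurd hM (by simp)
    · intro i hi1 hi2
      rcases hi1.eq_or_lt with rfl | hi1
      · rw [show X ++ s :: (U ++ R :: V) = (X ++ s :: U) ++ R :: V by simp, testBit_mask]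
        simpa using hR'
      · have : i - (V.length + 1) < U.length := by simp at hi2; omega
        obtain ⟨U1, u, U2, rfl, hU2⟩ := exists_eq_append_of_lt this
        have hu := hU u (by simp)
        have hi : i = (U2 ++ R :: V).length := by simp; omega
        rw [hi, show X ++ s :: (U1 ++ u :: U2 ++ R :: V) = (X ++ s :: U1) ++ u :: (U2 ++ R :: V) by
          simp, testBit_mask]
        simpa using hu

end TreeUniversal

namespace TreeUniversal

/-! ### Codes of sets of pairs -/

theorem mem_pairs {n : ℕ} {p : ℕ × ℕ} : p ∈ pairs n ↔ p.1 < p.2 ∧ p.2 < n := by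
  obtain ⟨a, b⟩ := p
  simp only [pairs, List.mem_flatMap, List.mem_reverse, List.mem_range, List.mem_map, Prod.mk.injEq]
  constructor
  · rintro ⟨b', hb, a', ha, rfl, rfl⟩; exact ⟨ha, hb⟩
  · rintro ⟨h1, h2⟩; exact ⟨b, h2, a, h1, rfl, rfl⟩

theorem testBit_ofPairs (n : ℕ) (l : List (ℕ × ℕ)) (x : ℕ) :
    (ofPairs n l).testBit x = true ↔ ∃ p ∈ l, x = n * p.1 + p.2 := by
  induction l with
  | nil => simp [ofPairs]
  | cons p l ih =>
    change (ofPairs n l ||| 2 ^ (n * p.1 + p.2)).testBit x = true ↔ _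
    rw [Nat.testBit_or, Bool.or_eq_true, ih, Nat.testBit_two_pow, decide_eq_true_eq]
    simp only [List.mem_cons, exists_eq_or_imp]
    rw [or_comm, eq_comm]

theorem testBit_ofPairs_code {n : ℕ} {l : List (ℕ × ℕ)} (hl : ∀ p ∈ l, p.2 < n) {a b : ℕ} (hb : b < n) :
    (ofPairs n l).testBit (n * a + b) = true ↔ (a, b) ∈ l := by
  rw [testBit_ofPairs]
  constructor
  · rintro ⟨⟨c, d⟩, hp, h⟩
    obtain ⟨rfl, rfl⟩ := code_inj hb (hl _ hp) h
    exact hp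
  · exact fun h => ⟨_, h, rfl⟩

theorem mem_symPairs {l : List (ℕ × ℕ)} {a b : ℕ} :
    (a, b) ∈ symPairs l ↔ (a, b) ∈ l ∨ (b, a) ∈ l := by
  simp [symPairs]

theorem testBit_symPairs {n : ℕ} (q : ℕ × ℕ → Bool) {a b : ℕ} (ha : a < n) (hb : b < n) :
    (ofPairs n (symPairs ((pairs n).filter q))).testBit (n * a + b) = true ↔
      (a < b ∧ q (a, b) = true) ∨ (b < a ∧ q (b, a) = true) := by
  rw [testBit_ofPairs_code _ hb, mem_symPairs, List.mem_filter, List.mem_filter, mem_pairs, mem_pairs]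
  · simp [ha, hb]
  · rintro ⟨c, d⟩ h
    rw [mem_symPairs, List.mem_filter, List.mem_filter, mem_pairs, mem_pairs] at h
    simp only at h ⊢
    omega

open Classical in
/-- The code of a graph. -/
noncomputable def codeOf (n : ℕ) (A : ℕ → ℕ → Prop) : ℕ :=
  ofPairs n ((pairs n).filter fun p => A p.1 p.2)

open Classical in
theorem testBit_codeOf {n : ℕ} (A : ℕ → ℕ → Prop) {a b : ℕ} (hb : b < n) :
    (codeOf n A).testBit (n * a + b) = true ↔ a < b ∧ A a b := by
  rw [codeOf, testBit_ofPairs_code _ hb, List.mem_filter, mem_pairs]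
  · simp [hb]
  · rintro p h
    rw [List.mem_filter, mem_pairs] at h
    exact h.1.2

/-! ### The search -/

theorem dfs_cons (M G : ℕ) (leaf : ℕ → Bool) (w m₁ m₀ : ℕ) (ds : List (ℕ × ℕ × ℕ)) (S g : ℕ) :
    dfs M G leaf ((w, m₁, m₀) :: ds) S g =
      band (branch M G (dfs M G leaf ds) (S &&& m₁) (g ||| w))
        (branch M G (dfs M G leaf ds) (S &&& m₀) g) := rfl

theorem branch_eq (M G : ℕ) (ih : ℕ → ℕ → Bool) (T g : ℕ) (h : (T + M) &&& G = G) :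
    branch M G ih T g = ih T g := by
  have : Nat.beq (Nat.land (Nat.add T M) G) G = true := by
    change Nat.beq ((T + M) &&& G) G = true
    rw [h, Nat.beq_refl]
  unfold branch guarded
  rw [this]

/-- A placement all of whose literals are true cannot require an edge that is absent. Together with
`land_nonEdgeLit`, this keeps good placements alive under every decision that agrees with the graph.
-/
theorem land_edgeLit {A : ℕ → ℕ → Prop} (hA : ∀ a b, A a b → A b a) {n R a b : ℕ} (ha : a < n)
    (hb : b < n) (hR : Good A n R) (h : ¬A a b) : R &&& edgeLit n a b = 0 := by
  apply Nat.eq_of_testBit_eq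
  intro i
  rw [Nat.zero_testBit, ← Bool.not_eq_true, Nat.testBit_and, Bool.and_eq_true, edgeLit, Nat.testBit_or,
    Nat.testBit_two_pow, Nat.testBit_two_pow, Bool.or_eq_true, decide_eq_true_eq, decide_eq_true_eq]
  rintro ⟨h1, rfl | rfl⟩
  · exact h (holds_edge ha hb (hR _ h1))
  · exact h (hA _ _ (holds_edge hb ha (hR _ h1)))

theorem land_nonEdgeLit {A : ℕ → ℕ → Prop} (hA : ∀ a b, A a b → A b a) {n R a b : ℕ} (ha : a < n)
    (hb : b < n) (hR : Good A n R) (h : A a b) : R &&& nonEdgeLit n a b = 0 := by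
  apply Nat.eq_of_testBit_eq
  intro i
  rw [Nat.zero_testBit, ← Bool.not_eq_true, Nat.testBit_and, Bool.and_eq_true, nonEdgeLit, Nat.testBit_or,
    Nat.testBit_two_pow, Nat.testBit_two_pow, Bool.or_eq_true, decide_eq_true_eq, decide_eq_true_eq]
  rintro ⟨h1, rfl | rfl⟩
  · exact holds_nonedge hb (hR _ h1) h
  · exact holds_nonedge ha (hR _ h1) (hA _ _ h)

theorem Good.land_two_pow {A : ℕ → ℕ → Prop} {n R : ℕ} (hR : Good A n R) :
    R &&& 2 ^ (2 * (n * n)) = 0 := by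
  apply Nat.eq_of_testBit_eq
  intro i
  rw [Nat.zero_testBit, ← Bool.not_eq_true, Nat.testBit_and, Bool.and_eq_true,
    Nat.testBit_two_pow, decide_eq_true_eq]
  rintro ⟨h1, rfl⟩
  obtain ⟨a, b, ha, hb, ⟨h, _⟩ | ⟨h, _⟩⟩ := hR _ h1 <;> have := code_lt ha hb <;> omega

theorem land_two_pow_of_lt {N R : ℕ} (hR : R < 2 ^ N) : R &&& 2 ^ N = 0 := by
  rw [Nat.and_two_pow, Nat.testBit_lt_two_pow hR]; simp

/-- Follow the branch that decides each pair as `A` does. The surviving set `S` stays inside the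
placements and keeps all good ones, so no guard on this branch stops the search; as both branches
are conjoined, success of the whole search gives success at this leaf. -/
theorem dfs_sound {A : ℕ → ℕ → Prop} (hA : ∀ a b, A a b → A b a) {n : ℕ} {Rs : List ℕ}
    (hRs : Alive (Good A n) (fun R => R &&& 2 ^ (2 * (n * n)) ≠ 0) Rs) (leaf : ℕ → Bool)
    (fr : List (ℕ × ℕ)) (hfr : ∀ p ∈ fr, p.1 < n ∧ p.2 < n) (S g : ℕ)
    (hS : ∀ t, S.testBit t = true → (mask (2 ^ (2 * (n * n))) Rs 0).testBit t = true)
    (hgood : ∀ X R Y, Rs = X ++ R :: Y → Good A n R → S.testBit Y.length = true)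
    (h : dfs (mask (2 ^ (2 * (n * n))) Rs 0) (mask 0 Rs 0 ^^^ mask (2 ^ (2 * (n * n))) Rs 0) leaf
      (fr.map (decision n Rs)) S g = true) :
    ∃ g', leaf g' = true ∧ ∀ x, g'.testBit x = true ↔
      g.testBit x = true ∨ ∃ p ∈ fr, A p.1 p.2 ∧ x = n * p.1 + p.2 := by
  induction fr generalizing S g with
  | nil => exact ⟨g, h, by simp⟩
  | cons p fr ih =>
    have hp := hfr p (by simp)
    have step : ∀ lit, (∀ R, Good A n R → R &&& lit = 0) →
        (∀ t, (S &&& mask lit Rs 0).testBit t = true →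
          (mask (2 ^ (2 * (n * n))) Rs 0).testBit t = true) ∧
        ∀ X R Y, Rs = X ++ R :: Y → Good A n R →
          (S &&& mask lit Rs 0).testBit Y.length = true := by
      intro lit hlit
      refine ⟨fun t ht => hS t ?_, fun X R Y hX hR => ?_⟩
      · rw [Nat.testBit_and, Bool.and_eq_true] at ht; exact ht.1
      · rw [Nat.testBit_and, hgood X R Y hX hR, hX, testBit_mask]
        simp [hlit R hR]
    rw [List.map_cons, decision, dfs_cons, band_eq, Bool.and_eq_true] at h
    by_cases hAp : A p.1 p.2
    · obtain ⟨h1, h2⟩ := step (nonEdgeLit n p.1 p.2)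
        fun R hR => land_nonEdgeLit hA hp.1 hp.2 hR hAp
      rw [branch_eq _ _ _ _ _ (guard_passes hRs h1 h2)] at h
      obtain ⟨g', hg', hx⟩ := ih (fun q hq => hfr q (by simp [hq])) _ _ h1 h2 h.1
      refine ⟨g', hg', fun x => ?_⟩
      rw [hx, Nat.testBit_or, Bool.or_eq_true, Nat.testBit_two_pow, decide_eq_true_eq, or_assoc,
        eq_comm (a := n * p.1 + p.2)]
      simp only [List.mem_cons, exists_eq_or_imp, hAp, true_and]
    · obtain ⟨h1, h2⟩ := step (edgeLit n p.1 p.2)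
        fun R hR => land_edgeLit hA hp.1 hp.2 hR hAp
      rw [branch_eq _ _ _ _ _ (guard_passes hRs h1 h2)] at h
      obtain ⟨g', hg', hx⟩ := ih (fun q hq => hfr q (by simp [hq])) _ _ h1 h2 h.2
      refine ⟨g', hg', fun x => ?_⟩
      rw [hx]
      simp only [List.mem_cons, exists_eq_or_imp, hAp, false_and, false_or]

/-- Each block contains the placement read off from the graph. The value of `sep n` plays no role:
the condition after the head of a block is established whether or not the head counts as a
separator. -/
theorem alive_blocks {A : ℕ → ℕ → Prop} {n P Q : ℕ} (kss : List (List (List ℕ)))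
    (h : ∀ ks ∈ kss, ∃ vs, Extends n
      (fun v k m => Relation A v k m ∧ Allowed n P Q v k m) ks [] vs) :
    Alive (Good A n) (fun R => R &&& 2 ^ (2 * (n * n)) ≠ 0) (blocks n P Q kss) := by
  induction kss with
  | nil => trivial
  | cons ks kss ih =>
    obtain ⟨L, h1, h2, h3⟩ := place_eq_append A n P Q ks [] 0 (by simp) (by positivity)
    change Alive _ _ (sep n :: place n P Q ks [] 0 (blocks n P Q kss))
    rw [h1]
    have hL : ∀ x ∈ L, ¬(x &&& 2 ^ (2 * (n * n)) ≠ 0) := by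
      intro x hx
      rw [not_not]
      exact land_two_pow_of_lt (h2 x hx)
    refine ⟨fun _ => ?_, Alive.append hL (ih fun ks hks => h ks (by simp [hks]))⟩
    obtain ⟨R, hR, hg⟩ := h3 (fun x hx => by simp at hx) (h ks (by simp))
    obtain ⟨U, V, rfl⟩ := List.append_of_mem hR
    exact ⟨U, R, V ++ blocks n P Q kss, by simp, hg, hL R (by simp), fun x hx => hL x (by simp [hx])⟩

theorem known_swap (k : ℕ) (ps : List ℕ) (a b : ℕ) : known k ps (b, a) = known k ps (a, b) := by
  unfold known
  simp only [and_comm (a := b < k), and_comm (a := b ∈ ps), Bool.or_comm (b == 0),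
    Bool.or_comm (ps.idxOf b + 1 == ps.idxOf a)]

/-- A graph satisfies what is known about it. -/
structure Compatible (n k : ℕ) (ps : List ℕ) (A : ℕ → ℕ → Prop) : Prop where
  symm : ∀ a b, A a b → A b a
  known : ∀ a b x, a < n → b < n → a ≠ b → known k ps (a, b) = some x → (A a b ↔ x = true)

/-- Filtering candidates by what is known about the pairs discards no placement that occurs in a
compatible graph. -/
theorem allowed_of_relation {n k : ℕ} {ps : List ℕ} {A : ℕ → ℕ → Prop} (hA : Compatible n k ps A)
    {v i m : ℕ} (hv : v < n) (hm : m < n) (h : Relation A v i m) :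
    Allowed n (possible n k ps true) (possible n k ps false) v i m := by
  obtain ⟨h1, h2, h3⟩ := h
  have hmv : known k ps (m, v) = known k ps (v, m) := known_swap ..
  have key : ∀ x : Bool, (A v m ↔ x = true) →
      (possible n k ps x).testBit (n * m + v) = true := by
    intro x hx
    have : known k ps (v, m) ≠ some !x := fun h => by
      have := (hA.known v m _ hv hm h1 h).symm.trans hx
      cases x <;> simp at this
    rw [possible, testBit_symPairs _ hm hv]
    simp only [bne_iff_ne, ne_eq, hmv]
    exact h1.lt_or_gt.elim (fun h => .inr ⟨h, this⟩) fun h => .inl ⟨h, this⟩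
  unfold Allowed
  split_ifs at h2 with hi
  · exact .inr (.inl ⟨hi, key true (by simpa using h2)⟩)
  · rcases Nat.eq_zero_or_pos i with rfl | hi0
    · exact .inl ⟨rfl, key false (by simpa using h2)⟩
    · exact .inr (.inr ⟨by omega, key false (by simpa using h2), h3 (by omega)⟩)

/-- The code reached at the end of the branch of `A` consists of the known edges and the edges
chosen among the undetermined pairs. These two sets make up exactly the edges of `A`. -/
theorem search_sound {n k : ℕ} {kss : List (List (List ℕ))} {leaf : ℕ → Bool} {w : List ℕ}
    (h : search n k kss leaf w = true) {A : ℕ → ℕ → Prop} (hA : Compatible n k (labels w 1 k) A)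
    (hk : ∀ ks ∈ kss, ∃ vs, Extends n (Relation A) ks [] vs) : leaf (codeOf n A) = true := by
  set ps := labels w 1 k with hps
  have hal := alive_blocks (A := A) (n := n) (P := possible n k ps true)
    (Q := possible n k ps false) kss fun ks hks =>
      (hk ks hks).imp fun vs hvs => hvs.mono
        (fun v i m hv hm hr => ⟨hr, allowed_of_relation hA hv hm hr⟩) (by simp)
  have hfr : ∀ p ∈ (pairs n).filter fun p => known k ps p == none, p.1 < n ∧ p.2 < n := by
    intro p hp
    have := mem_pairs.1 (List.mem_filter.1 hp).1
    omega
  obtain ⟨g, hg, hx⟩ := dfs_sound hA.symm hal leaf _ hfr _ _ (fun _ ht => ht)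
    (fun X R Y hX hR => by rw [hX, testBit_mask]; simp [hR.land_two_pow]) h
  convert hg
  apply Nat.eq_of_testBit_eq
  intro x
  rw [Bool.eq_iff_iff, hx, codeOf, testBit_ofPairs, testBit_ofPairs]
  simp only [List.mem_filter, mem_pairs, decide_eq_true_eq, beq_iff_eq]
  constructor
  · rintro ⟨p, ⟨hp, hAp⟩, rfl⟩
    cases hkn : known k ps p with
    | none => exact .inr ⟨p, ⟨hp, hkn⟩, hAp, rfl⟩
    | some y =>
      have := (hA.known p.1 p.2 y (by omega) (by omega) hp.1.ne hkn).1 hAp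
      exact .inl ⟨p, ⟨hp, this ▸ hkn⟩, rfl⟩
  · rintro (⟨p, ⟨hp, hkn⟩, rfl⟩ | ⟨p, ⟨hp, _⟩, hAp, rfl⟩)
    · exact ⟨p, ⟨hp, (hA.known p.1 p.2 _ (by omega) (by omega) hp.1.ne hkn).2 rfl⟩, rfl⟩
    · exact ⟨p, ⟨hp, hAp⟩, rfl⟩

end TreeUniversal

namespace TreeUniversal

/-! ### Graphs given by codes -/

theorem adj_eq (n g a b : ℕ) :
    adj n g a b = (g.testBit (n * a + b) || g.testBit (n * b + a)) := by
  unfold adj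
  rw [bor_eq, bit_eq, bit_eq]
  rfl

theorem adj_comm (n g a b : ℕ) : adj n g a b = adj n g b a := by
  rw [adj_eq, adj_eq, Bool.or_comm]

def CodeAdj (n g a b : ℕ) : Prop := a ≠ b ∧ adj n g a b = true

theorem CodeAdj.symm {n g a b : ℕ} (h : CodeAdj n g a b) : CodeAdj n g b a :=
  ⟨h.1.symm, adj_comm n g a b ▸ h.2⟩

def graphOfCode (n g : ℕ) : SimpleGraph (Fin n) where
  Adj a b := CodeAdj n g a b
  symm := ⟨fun _ _ h => h.symm⟩
  loopless := ⟨fun _ h => h.1 rfl⟩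

theorem graphOfCode_adj {n g : ℕ} {a b : Fin n} :
    (graphOfCode n g).Adj a b ↔ CodeAdj n g a b := Iff.rfl

theorem codeAdj_codeOf {n : ℕ} {A : ℕ → ℕ → Prop} (hs : ∀ a b, A a b → A b a) (hi : ∀ a, ¬A a a)
    {a b : ℕ} (ha : a < n) (hb : b < n) : CodeAdj n (codeOf n A) a b ↔ A a b := by
  rw [CodeAdj, adj_eq, Bool.or_eq_true, testBit_codeOf A hb, testBit_codeOf A ha]
  constructor
  · rintro ⟨_, h | h⟩
    exacts [h.2, hs _ _ h.2]
  · intro h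
    have hab : a ≠ b := fun hab => hi b (hab ▸ h)
    exact ⟨hab, hab.lt_or_gt.imp (fun h' => ⟨h', h⟩) fun h' => ⟨h', hs _ _ h⟩⟩

theorem testBit_ite_or (b : Bool) (acc e t : ℕ) :
    (Bool.rec acc (Nat.lor acc (Nat.pow 2 e)) b : ℕ).testBit t = true ↔
      acc.testBit t = true ∨ (b = true ∧ t = e) := by
  cases b with
  | false => exact (or_iff_left fun h => absurd h.1 Bool.false_ne_true).symm
  | true =>
    change (acc ||| 2 ^ e).testBit t = true ↔ _
    rw [Nat.testBit_or, Bool.or_eq_true, Nat.testBit_two_pow, decide_eq_true_eq]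
    exact or_congr_right ⟨fun h => ⟨rfl, h.symm⟩, fun h => h.2.symm⟩

theorem testBit_relRow (n g x : ℕ) (ys : List ℕ) (e acc t : ℕ) :
    (relRow n g x ys e acc).testBit t = true ↔ acc.testBit t = true ∨
      ∃ j y, ys[j]? = some y ∧ t = e + j ∧ adj n g x y = true := by
  induction ys generalizing e acc with
  | nil => change acc.testBit t = true ↔ _; simp
  | cons y ys ih =>
    change (relRow n g x ys (e + 1) (Bool.rec acc (Nat.lor acc (Nat.pow 2 e)) (adj n g x y))).testBit
      t = true ↔ _
    rw [ih, testBit_ite_or, or_assoc]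
    refine or_congr_right ⟨?_, ?_⟩
    · rintro (⟨h, rfl⟩ | ⟨j, z, h1, rfl, h2⟩)
      · exact ⟨0, y, rfl, rfl, h⟩
      · exact ⟨j + 1, z, by simpa using h1, by ring, h2⟩
    · rintro ⟨_ | j, z, h1, rfl, h2⟩
      · obtain rfl : y = z := by simpa using h1
        exact .inl ⟨h2, rfl⟩
      · exact .inr ⟨j, z, by simpa using h1, by ring, h2⟩

/-- Row `i` starts at `e + (n + 1) * i` with the pair `(i, i + 1)`. With `e = 1`, as in `relabel`,
this is position `n * i + (i + 1)`. Stating the equation for `t + 1` avoids a subtraction. -/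
theorem testBit_relAux (n g : ℕ) (xs : List ℕ) (e acc t : ℕ) :
    (relAux n g xs e acc).testBit t = true ↔ acc.testBit t = true ∨
      ∃ i j x y, i < j ∧ xs[i]? = some x ∧ xs[j]? = some y ∧ t + 1 = e + n * i + j ∧
        adj n g x y = true := by
  induction xs generalizing e acc with
  | nil => change acc.testBit t = true ↔ _; simp
  | cons x xs ih =>
    change (relAux n g xs (e + (n + 1)) (relRow n g x xs e acc)).testBit t = true ↔ _
    rw [ih, testBit_relRow, or_assoc]
    refine or_congr_right ⟨?_, ?_⟩
    · rintro (⟨j, y, h1, rfl, h2⟩ | ⟨i, j, y, z, hij, h1, h2, h3, h4⟩)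
      · exact ⟨0, j + 1, x, y, by omega, rfl, by simpa using h1, by omega, h2⟩
      · exact ⟨i + 1, j + 1, y, z, by omega, by simpa using h1, by simpa using h2,
          by rw [h3]; ring, h4⟩
    · rintro ⟨_ | i, _ | j, y, z, hij, h1, h2, h3, h4⟩
      · omega
      · obtain rfl : x = y := by simpa using h1
        exact .inl ⟨j, z, by simpa using h2, by omega, h4⟩
      · omega
      · refine .inr ⟨i, j, y, z, by omega, by simpa using h1, by simpa using h2, ?_, h4⟩
        rw [h3]; ring

theorem graphOfCode_relabel {n : ℕ} (g : ℕ) {o : List ℕ} (ho : o.Perm (List.range n)) :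
    Nonempty (graphOfCode n (relabel n g o) ≃g graphOfCode n g) := by
  have hlen : o.length = n := by simpa using ho.length_eq
  have hnd : o.Nodup := ho.nodup_iff.2 List.nodup_range
  have hlt : ∀ i (hi : i < o.length), o[i] < n := fun i hi => by
    simpa using ho.mem_iff.1 (List.getElem_mem hi)
  let σ : Fin n → Fin n := fun i => ⟨o[i.1]'(by omega), hlt _ _⟩
  have hσ : Function.Injective σ := by
    intro i j h
    have : o[i.1]'(by omega) = o[j.1]'(by omega) := congrArg Fin.val h
    exact Fin.ext ((hnd.getElem_inj_iff).1 this)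
  refine ⟨⟨Equiv.ofBijective σ ⟨hσ, Finite.surjective_of_injective hσ⟩, ?_⟩⟩
  intro a b
  rw [graphOfCode_adj, graphOfCode_adj]
  change (_ ≠ _ ∧ adj n g (o[a.1]'(by omega)) (o[b.1]'(by omega)) = true) ↔ _ ≠ _ ∧ _
  have key : ∀ a b : Fin n, (relabel n g o).testBit (n * a + b) = true ↔
      a < b ∧ adj n g (o[a.1]'(by omega)) (o[b.1]'(by omega)) = true := by
    intro a b
    rw [relabel, testBit_relAux, Nat.zero_testBit]
    constructor
    · rintro (h | ⟨i, j, x, y, hij, h1, h2, h3, h4⟩)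
      · simp at h
      · obtain ⟨hj, rfl⟩ := List.getElem?_eq_some_iff.1 h2
        obtain ⟨hi, rfl⟩ := List.getElem?_eq_some_iff.1 h1
        obtain ⟨rfl, rfl⟩ := code_inj b.2 (hlen ▸ hj : j < n)
          (by omega : n * a.1 + b.1 = n * i + j)
        exact ⟨hij, h4⟩
    · rintro ⟨hab, h⟩
      exact .inr ⟨a, b, _, _, hab, List.getElem?_eq_getElem (by omega),
        List.getElem?_eq_getElem (by omega), by omega, h⟩
  rw [adj_eq n (relabel n g o), Bool.or_eq_true, key, key, adj_comm n g (o[b.1]'(by omega))]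
  have h1 : (σ a : ℕ) ≠ σ b ↔ (a : ℕ) ≠ b := by
    rw [Ne, Ne, ← Fin.ext_iff, ← Fin.ext_iff, hσ.eq_iff]
  change (((σ a : ℕ) ≠ σ b) ∧ _) ↔ _
  rw [h1]
  refine and_congr_right fun hab => ?_
  have : a < b ∨ b < a := lt_or_gt_of_ne fun h => hab (congrArg _ h)
  tauto

theorem perm_insertNat (x : ℕ) (l : List ℕ) : (insertNat x l).Perm (x :: l) := by
  induction l with
  | nil => exact .refl _
  | cons y l ih =>
    change (Bool.rec (y :: insertNat x l) (x :: y :: l) (Nat.ble x y) : List ℕ).Perm _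
    cases Nat.ble x y with
    | true => exact .refl _
    | false => exact (ih.cons y).trans (.swap ..)

theorem perm_sortNat (l : List ℕ) : (sortNat l).Perm l := by
  induction l with
  | nil => exact .refl _
  | cons x l ih => exact (perm_insertNat x _).trans (ih.cons x)

theorem map_tag (l : List ℕ) (i : ℕ) (h : i + l.length ≤ 16) :
    (tag l i).map (fun x => Nat.land x 15) = List.range' i l.length := by
  induction l generalizing i with
  | nil => rfl
  | cons x l ih =>
    change Nat.land (16 * x + i) 15 :: (tag l (i + 1)).map _ = _
    have h1 : Nat.land (16 * x + i) 15 = i := by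
      change (16 * x + i) &&& (2 ^ 4 - 1) = i
      rw [Nat.and_two_pow_sub_one_eq_mod]
      simp only [List.length_cons] at h
      omega
    rw [ih _ (by simp at h; omega), h1, List.length_cons, List.range'_succ]

theorem length_refineAux (n : ℕ) (hs : List ℕ) (X : ℕ) : (refineAux n hs X).length = hs.length := by
  induction hs generalizing X with
  | nil => rfl
  | cons h hs ih => exact congrArg (· + 1) (ih _)

/-- This is all that has to be known about the packed colour refinement: any permutation yields an
isomorphic graph, and a badly chosen one could only make the recognition fail. -/
theorem perm_colourOrder {n R : ℕ} {hs : List ℕ} (h : hs.length = n) (hn : n ≤ 16) :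
    (colourOrder n R hs).Perm (List.range n) := by
  unfold colourOrder
  refine ((perm_sortNat _).map _).trans ?_
  have hl : (refine n R (refine n R (refine n R hs))).length = n := by
    simp only [refine, length_refineAux, h]
  rw [map_tag _ _ (by omega), hl, List.range_eq_range']

theorem memNat_iff {x : ℕ} {l : List ℕ} : memNat x l = true ↔ x ∈ l := by
  induction l with
  | nil => exact ⟨nofun, nofun⟩
  | cons y l ih =>
    change bor (Nat.beq x y) (memNat x l) = true ↔ _
    rw [bor_eq, Bool.or_eq_true, ih, List.mem_cons, Nat.beq_eq]

theorem mem_flatten_of_inTable {tbl : List (List ℕ)} {g : ℕ} (h : inTable tbl g = true) :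
    g ∈ tbl.flatten := by
  have h := memNat_iff.1 h
  rw [List.getD_eq_getElem?_getD] at h
  cases hx : tbl[Nat.mod g 31]? with
  | none => rw [hx] at h; simp at h
  | some l =>
    rw [hx] at h
    exact List.mem_flatten.2 ⟨l, List.mem_of_getElem? hx, h⟩

theorem exists_of_recognize {n : ℕ} (hn : n ≤ 16) {tbl : List (List ℕ)} {g : ℕ}
    (h : recognize n tbl g = true) :
    ∃ g' ∈ tbl.flatten, Nonempty (graphOfCode n g' ≃g graphOfCode n g) := by
  unfold recognize at h
  set R := packedRows n g
  set hs := refine n R (List.replicate n 1) with hhs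
  have hl : hs.length = n := by rw [hhs, refine, length_refineAux, List.length_replicate]
  change (List.rec false (fun v _ ih => bor (inTable tbl
    (relabel n g (colourOrder n R (hs.modify v (· + 100))))) ih) (List.range (n + 1)).reverse : Bool)
    = true at h
  generalize (List.range (n + 1)).reverse = l at h
  induction l with
  | nil => exact absurd h (by simp)
  | cons v l ih =>
    dsimp only at h
    rw [bor_eq, Bool.or_eq_true] at h
    rcases h with h | h
    · exact ⟨_, mem_flatten_of_inTable h, graphOfCode_relabel g
        (perm_colourOrder (by rw [List.length_modify, hl]) hn)⟩
    · exact ih h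

/-! ### Deciding the existence of embeddings -/

theorem emb_cons (n P Q : ℕ) (ks : List ℕ) (kss : List (List ℕ)) (ms : List ℕ) :
    emb n P Q (ks :: kss) ms = scan n (fun v acc => bor (emb n P Q kss (v :: ms)) acc)
      (cand n P Q ks ms (2 ^ n - 1)) false := rfl

/-- The condition on lengths ensures that `cand` takes every prescribed relation into account. -/
theorem emb_iff {n P Q : ℕ} {kss : List (List ℕ)} {ms : List ℕ}
    (hl : ∀ i (ks : List ℕ), kss[i]? = some ks → ks.length = ms.length + i) :
    emb n P Q kss ms = true ↔ ∃ vs, Extends n (Allowed n P Q) kss ms vs := by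
  induction kss generalizing ms with
  | nil => exact ⟨fun _ => ⟨[], trivial⟩, fun _ => rfl⟩
  | cons ks kss ih =>
    have hpos : 0 < 2 ^ n := by positivity
    obtain ⟨l, hm, hs⟩ := scan_eq_foldr n (cand n P Q ks ms (2 ^ n - 1))
      (lt_of_le_of_lt (cand_le ..) (by omega))
    have hany : emb n P Q (ks :: kss) ms = l.any fun v => emb n P Q kss (v :: ms) := by
      rw [emb_cons, hs]
      clear hs hm
      induction l with
      | nil => rfl
      | cons v l ih => rw [List.foldr_cons, ih, bor_eq, List.any_cons]
    have ih' : ∀ v, emb n P Q kss (v :: ms) = true ↔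
        ∃ vs, Extends n (Allowed n P Q) kss (v :: ms) vs := fun v => ih fun i ks' h => by
      rw [hl (i + 1) ks' (by simpa using h), List.length_cons]; omega
    rw [hany, List.any_eq_true]
    simp only [ih', hm, testBit_cand _ _ _ _ _ (hl 0 ks rfl), Nat.testBit_two_pow_sub_one,
      decide_eq_true_eq]
    constructor
    · rintro ⟨v, ⟨h1, h2⟩, vs, h3⟩
      exact ⟨v :: vs, h1, h2, h3⟩
    · rintro ⟨_ | ⟨v, vs⟩, h⟩
      · exact h.elim
      · exact ⟨v, ⟨h.1, h.2.1⟩, vs, h.2.2⟩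

theorem allowed_code_iff {n g v k m : ℕ} (hv : v < n) (hm : m < n) :
    Allowed n (ofPairs n (symPairs ((pairs n).filter fun p => adj n g p.1 p.2)))
      (ofPairs n (symPairs ((pairs n).filter fun p => !adj n g p.1 p.2))) v k m ↔
      Relation (CodeAdj n g) v k m := by
  rw [Allowed, Relation, testBit_symPairs _ hm hv, testBit_symPairs _ hm hv, CodeAdj]
  simp only [adj_comm n g m v, Bool.not_eq_true']
  cases adj n g v m <;> split_ifs <;> simp <;> omega

theorem extends_congr {n : ℕ} {r s : ℕ → ℕ → ℕ → Prop}
    (h : ∀ v k m, v < n → m < n → (r v k m ↔ s v k m)) {kss : List (List ℕ)} {ms vs : List ℕ}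
    (hms : ∀ m ∈ ms, m < n) : Extends n r kss ms vs ↔ Extends n s kss ms vs :=
  ⟨.mono (fun v k m hv hm => (h v k m hv hm).1) hms, .mono (fun v k m hv hm => (h v k m hv hm).2) hms⟩

theorem embedsFrom_iff {n g : ℕ} {kss : List (List ℕ)} {ms : List ℕ} (hms : ∀ m ∈ ms, m < n)
    (hl : ∀ i (ks : List ℕ), kss[i]? = some ks → ks.length = ms.length + i) :
    embedsFrom n g kss ms = true ↔ ∃ vs, Extends n (Relation (CodeAdj n g)) kss ms vs := by
  rw [embedsFrom, emb_iff hl]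
  exact exists_congr fun vs => extends_congr (fun v k m hv hm => allowed_code_iff hv hm) hms

/-- A leaf check can also succeed because the rows are unsorted or because a tree of `ex` does not
embed. Both are excluded for a universal graph in normal form, so only recognition remains. -/
theorem exists_of_leaf {n : ℕ} (hn : n ≤ 16) {ls : List ℕ} {tbl : List (List ℕ)}
    {ex : List (List (List ℕ))} {g : ℕ} (h : leaf n ls tbl ex g = true) (hs : sorted n g ls = true)
    (hex : ∀ ks ∈ ex, embedsFrom n g ks [] = true) :
    ∃ g' ∈ tbl.flatten, Nonempty (graphOfCode n g' ≃g graphOfCode n g) := by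
  unfold leaf at h
  rw [hs] at h
  dsimp only at h
  rw [bor_eq, Bool.or_eq_true] at h
  rcases h with h | h
  · exact exists_of_recognize hn h
  · exfalso
    induction ex with
    | nil => exact absurd h (by simp)
    | cons ks ex ih =>
      dsimp only at h
      rw [hex ks (by simp)] at h
      rw [bor_eq, Bool.or_eq_true] at h
      rcases h with h | h
      · exact absurd h (by simp)
      · exact ih (fun k hk => hex k (by simp [hk])) h

/-! ### Checking given placements -/

/-- The relation of a new vertex to an earlier one, without constraints on the order. -/
def Relation₀ (A : ℕ → ℕ → Prop) (v k m : ℕ) : Prop := v ≠ m ∧ if k = 0 then ¬A v m else A v m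

theorem forall₂_of_fits {n g v : ℕ} {ks ms : List ℕ} (hl : ks.length = ms.length)
    (h : fits n g v ks ms = true) : List.Forall₂ (Relation₀ (CodeAdj n g) v) ks ms := by
  induction ks generalizing ms with
  | nil =>
    obtain rfl : ms = [] := List.length_eq_zero_iff.1 hl.symm
    exact .nil
  | cons k ks ih =>
    cases ms with
    | nil => simp at hl
    | cons m ms =>
      change band (Bool.rec true false (Nat.beq v m)) (band (Nat.rec (Bool.rec true false (adj n g v m))
        (fun _ _ => adj n g v m) k) (fits n g v ks ms)) = true at h
      rw [band_eq, band_eq, Bool.and_eq_true, Bool.and_eq_true] at h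
      obtain ⟨h1, h2, h3⟩ := h
      have hvm : v ≠ m := by
        rintro rfl
        rw [Nat.beq_refl] at h1
        exact absurd h1 (by simp)
      refine .cons ⟨hvm, ?_⟩ (ih (by simpa using hl) h3)
      cases k with
      | zero =>
        rw [if_pos rfl]
        rintro ⟨_, h⟩
        rw [h] at h2
        exact absurd h2 (by simp)
      | succ k => rw [if_neg (by simp)]; exact ⟨hvm, h2⟩

theorem extends_of_fitsAll {n g : ℕ} {kss : List (List ℕ)} {ms : List ℕ} {c : ℕ}
    (hl : ∀ i (ks : List ℕ), kss[i]? = some ks → ks.length = ms.length + i)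
    (h : fitsAll n g kss ms c = true) : ∃ vs, Extends n (Relation₀ (CodeAdj n g)) kss ms vs := by
  induction kss generalizing ms c with
  | nil => exact ⟨[], trivial⟩
  | cons ks kss ih =>
    change band (Nat.ble (Nat.succ (Nat.land c 15)) n) (band (fits n g (Nat.land c 15) ks ms)
      (fitsAll n g kss (Nat.land c 15 :: ms) (Nat.shiftRight c 4))) = true at h
    rw [band_eq, band_eq, Bool.and_eq_true, Bool.and_eq_true] at h
    obtain ⟨h1, h2, h3⟩ := h
    obtain ⟨vs, hvs⟩ := ih (fun i ks' h => by
      rw [hl (i + 1) ks' (by simpa using h), List.length_cons]; omega) h3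
    exact ⟨_ :: vs, Nat.le_of_ble_eq_true h1, forall₂_of_fits (hl 0 ks rfl) h2, hvs⟩

theorem extends_of_fitsTrees {n k g : ℕ} {ts : List (List (List ℕ))} {c : ℕ}
    (h : fitsTrees n k g ts c = true) {kss : List (List ℕ)} (hk : kss ∈ ts)
    (hl : ∀ i (ks : List ℕ), kss[i]? = some ks → ks.length = i) :
    ∃ vs, Extends n (Relation₀ (CodeAdj n g)) kss [] vs := by
  induction ts generalizing c with
  | nil => simp at hk
  | cons t ts ih =>
    change band (fitsAll n g t [] c) (fitsTrees n k g ts (Nat.shiftRight c (Nat.mul 4 k))) = true at h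
    rw [band_eq, Bool.and_eq_true] at h
    rcases List.mem_cons.1 hk with rfl | hk
    · exact extends_of_fitsAll (by simpa using hl) h.1
    · exact ih h.2 hk

theorem extends_of_certified {n k : ℕ} {ts : List (List (List ℕ))} {l cs : List ℕ}
    (h : certified n k ts l cs = true) {g : ℕ} (hg : g ∈ l) {kss : List (List ℕ)} (hk : kss ∈ ts)
    (hl : ∀ i (ks : List ℕ), kss[i]? = some ks → ks.length = i) :
    ∃ vs, Extends n (Relation₀ (CodeAdj n g)) kss [] vs := by
  induction l generalizing cs with
  | nil => simp at hg
  | cons g' l ih =>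
    cases cs with
    | nil => exact absurd h (by simp [certified])
    | cons c cs =>
      change band (fitsTrees n k g' ts c) (certified n k ts l cs) = true at h
      rw [band_eq, Bool.and_eq_true] at h
      rcases List.mem_cons.1 hg with rfl | hg
      · exact extends_of_fitsTrees h.1 hk hl
      · exact ih h.2 hg

end TreeUniversal

namespace TreeUniversal

/-! ### Trees given by lists of parents -/

/-- The tree with vertices `0, …, k - 1` in which each vertex `i > 0` is joined to `p i`. -/
def treeGraph (k : ℕ) (p : List ℕ) : SimpleGraph (Fin k) where
  Adj a b := (b < a ∧ p.getD a 0 = b) ∨ (a < b ∧ p.getD b 0 = a)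
  symm := ⟨fun _ _ h => h.symm⟩
  loopless := ⟨fun _ h => by simp at h⟩

theorem treeGraph_adj_of_lt {k : ℕ} {p : List ℕ} {a b : Fin k} (h : b < a) :
    (treeGraph k p).Adj a b ↔ p.getD a 0 = b := by
  simp [treeGraph, h, h.not_gt]

def IsParentList (k : ℕ) (p : List ℕ) : Prop := p.length = k ∧ ∀ i < k, 0 < i → p.getD i 0 < i

instance (k : ℕ) (p : List ℕ) : Decidable (IsParentList k p) := by
  unfold IsParentList; infer_instance

/-- Parents have smaller numbers, so every vertex is joined to `0`. The edges are indexed by the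
vertices other than `0`, hence there are at most `k - 1` of them, and a connected graph with so few
edges is a tree. -/
theorem IsParentList.isTree {k : ℕ} {p : List ℕ} (hp : IsParentList k p) (hk : 0 < k) :
    (treeGraph k p).IsTree := by
  have : NeZero k := ⟨hk.ne'⟩
  have hpar : ∀ i : Fin k, 0 < i.1 → p.getD i 0 < i := fun i hi => hp.2 i i.2 hi
  have hconn : (treeGraph k p).Connected := by
    have h0 : ∀ m (hm : m < k), (treeGraph k p).Reachable ⟨m, hm⟩ ⟨0, hk⟩ := by
      intro m
      induction m using Nat.strong_induction_on with
      | _ m ih =>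
        intro hm
        rcases Nat.eq_zero_or_pos m with rfl | hpos
        · rfl
        · have hlt := hpar ⟨m, hm⟩ hpos
          refine SimpleGraph.Reachable.trans (SimpleGraph.Adj.reachable ?_) (ih _ hlt (by omega))
          rw [treeGraph_adj_of_lt (by exact hlt)]
    exact (SimpleGraph.connected_iff _).2 ⟨fun a b => (h0 a a.2).trans (h0 b b.2).symm, ⟨⟨0, hk⟩⟩⟩
  refine SimpleGraph.isTree_iff_connected_and_card.2
    ⟨hconn, le_antisymm ?_ hconn.card_vert_le_card_edgeSet_add_one⟩
  let e : ℕ → Sym2 (Fin k) := fun i =>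
    if h : i + 1 < k then s(⟨i + 1, h⟩, ⟨p.getD (i + 1) 0, (hpar ⟨i + 1, h⟩ i.succ_pos).trans h⟩)
    else s(⟨0, hk⟩, ⟨0, hk⟩)
  have hsub : (treeGraph k p).edgeSet ⊆ ((Finset.range (k - 1)).image e : Finset _) := by
    have key : ∀ a b : Fin k, b < a → p.getD a 0 = b →
        s(a, b) ∈ ((Finset.range (k - 1)).image e : Finset _) := by
      intro a b hlt h
      have hba : b.1 < a.1 := hlt
      have ha := a.2
      refine Finset.mem_image.2 ⟨a.1 - 1, Finset.mem_range.2 (by omega), ?_⟩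
      have h1 : a.1 - 1 + 1 = a.1 := by omega
      simp only [e, h1, ha, dif_pos, h]
    intro x
    induction x using Sym2.ind with
    | _ a b =>
      rintro (⟨h1, h2⟩ | ⟨h1, h2⟩)
      · exact key a b h1 h2
      · rw [Sym2.eq_swap]; exact key b a h1 h2
  rw [Nat.card_eq_fintype_card (α := Fin k), Fintype.card_fin]
  have h1 := Set.ncard_le_ncard hsub (Finset.finite_toSet _)
  rw [Set.ncard_coe_finset] at h1
  have h2 := h1.trans (Finset.card_image_le.trans (Finset.card_range _).le)
  change Nat.card (treeGraph k p).edgeSet ≤ k - 1 at h2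
  omega

/-- Delete a leaf of `T`. Given a parent list for the rest, the leaf returns as the last vertex, its
parent `a` being the number of its only neighbour. -/
theorem exists_iso_treeGraph_append {k : ℕ} (hk : 0 < k) {V : Type} [Fintype V] (T : SimpleGraph V)
    (hT : T.IsTree) (hc : Fintype.card V = k + 1) :
    ∃ (s : Set V) (_ : Fintype s), Fintype.card s = k ∧ (T.induce s).IsTree ∧
      ∀ p : List ℕ, p.length = k → Nonempty (treeGraph k p ≃g T.induce s) →
        ∃ a < k, Nonempty (treeGraph (k + 1) (p ++ [a]) ≃g T) := by
  classical
  have : Nontrivial V := Fintype.one_lt_card_iff_nontrivial.1 (by omega)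
  obtain ⟨v, hv⟩ := hT.exists_vert_degree_one_of_nontrivial
  have hT' : (T.induce {v}ᶜ).IsTree :=
    ⟨hT.connected.induce_compl_singleton_of_degree_eq_one hv, hT.isAcyclic.induce _⟩
  obtain ⟨u, huv, hu⟩ := SimpleGraph.degree_eq_one_iff_existsUnique_adj.1 hv
  have hc' : Fintype.card ({v}ᶜ : Set V) = k := by
    rw [Fintype.card_compl_set, hc]; simp
  refine ⟨_, _, hc', hT', ?_⟩
  rintro p hlen ⟨e⟩
  have huv' : u ∈ ({v}ᶜ : Set V) := fun h => huv.ne h.symm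
  let a := e.symm ⟨u, huv'⟩
  have ha : e a = ⟨u, huv'⟩ := e.apply_symm_apply _
  refine ⟨a, a.2, ?_⟩
  let φ : Fin (k + 1) → V := Fin.lastCases v fun i => (e i).1
  have h1 : φ (Fin.last k) = v := Fin.lastCases_last
  have h2 : ∀ i : Fin k, φ i.castSucc = (e i).1 := fun i => Fin.lastCases_castSucc ..
  have h3 : ∀ i : Fin k, (e i).1 ≠ v := fun i => (e i).2
  have hinj : Function.Injective φ := by
    intro i j hij
    induction i using Fin.lastCases <;> induction j using Fin.lastCases
    · rfl
    · rw [h1, h2] at hij; exact absurd hij.symm (h3 _)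
    · rw [h1, h2] at hij; exact absurd hij (h3 _)
    · rw [h2, h2] at hij; rw [e.injective (Subtype.ext hij)]
  have hbij : Function.Bijective φ :=
    (Fintype.bijective_iff_injective_and_card φ).2 ⟨hinj, by simp [hc]⟩
  have hlast : ∀ i : Fin k, T.Adj v (e i).1 ↔
      (treeGraph (k + 1) (p ++ [a.1])).Adj (Fin.last k) i.castSucc := by
    intro i
    rw [treeGraph_adj_of_lt (Fin.castSucc_lt_last i)]
    have : (p ++ [a.1]).getD (Fin.last k) 0 = a.1 := by simp [← hlen]
    rw [this]
    constructor
    · intro h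
      have : e i = e a := by rw [ha]; exact Subtype.ext (hu _ h)
      rw [e.injective this]; rfl
    · intro h
      have : a = i := Fin.ext h
      rw [← this, ha]; exact huv
  refine ⟨⟨Equiv.ofBijective φ hbij, ?_⟩⟩
  intro i j
  change T.Adj (φ i) (φ j) ↔ _
  induction i using Fin.lastCases <;> induction j using Fin.lastCases
  · simp
  · rw [h1, h2, hlast]
  · rw [h1, h2, SimpleGraph.adj_comm, hlast, SimpleGraph.adj_comm]
  · rename_i i j
    rw [h2, h2, ← SimpleGraph.comap_adj (f := Subtype.val) (G := T)]
    refine e.map_rel_iff.trans ?_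
    have h4 : ∀ i : Fin k, (p ++ [a.1]).getD i 0 = p.getD i 0 := fun i => by
      have := i.2
      simp [List.getD_eq_getElem?_getD, hlen]
    simp only [treeGraph, Fin.castSucc_lt_castSucc_iff, Fin.val_castSucc, h4]

/-! ### Specifications of trees -/

/-- The relations `K i j` of the vertices `s, …, s + d - 1` to the earlier ones. -/
def specFrom (K : ℕ → ℕ → ℕ) (s d : ℕ) : List (List ℕ) :=
  (List.range' s d).map fun i => (List.range i).reverse.map (K i)

def kind (p : List ℕ) (con : List (ℕ × ℕ)) (i j : ℕ) : ℕ :=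
  if p.getD i 0 = j then 1 else if (j, i) ∈ con then 2 else 0

theorem spec_eq (p : List ℕ) (con : List (ℕ × ℕ)) : spec p con = specFrom (kind p con) 0 p.length := by
  rw [spec, specFrom, List.range_eq_range']
  rfl

theorem length_of_getElem?_specFrom {K : ℕ → ℕ → ℕ} {s d i : ℕ} {ks : List ℕ}
    (h : (specFrom K s d)[i]? = some ks) : ks.length = s + i := by
  rw [specFrom, List.getElem?_map, Option.map_eq_some_iff] at h
  obtain ⟨j, hj, rfl⟩ := h
  obtain ⟨hi, rfl⟩ := List.getElem?_eq_some_iff.1 hj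
  simp

theorem reverse_map_range_succ (f : ℕ → ℕ) (s : ℕ) :
    (List.range (s + 1)).reverse.map f = f s :: (List.range s).reverse.map f := by
  rw [List.range_succ, List.reverse_append]; rfl

theorem forall₂_range_iff (R : ℕ → ℕ → Prop) (f g : ℕ → ℕ) (i : ℕ) :
    List.Forall₂ R ((List.range i).reverse.map f) ((List.range i).reverse.map g) ↔
      ∀ j < i, R (f j) (g j) := by
  rw [List.forall₂_map_left_iff, List.forall₂_map_right_iff, List.forall₂_same]
  simp

/-- Turns lists of images into functions. The start `s` is general because the test for
interchangeable vertices completes a map that is already prescribed on an initial segment. -/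
theorem exists_of_extends {n : ℕ} {r : ℕ → ℕ → ℕ → Prop} {K : ℕ → ℕ → ℕ} {d s : ℕ} {f : ℕ → ℕ}
    {vs : List ℕ} (h : Extends n r (specFrom K s d) ((List.range s).reverse.map f) vs) :
    ∃ f' : ℕ → ℕ, (∀ i < s, f' i = f i) ∧
      ∀ i, s ≤ i → i < s + d → f' i < n ∧ ∀ j < i, r (f' i) (K i j) (f' j) := by
  induction d generalizing s f vs with
  | zero => exact ⟨f, fun _ _ => rfl, fun i h1 h2 => by omega⟩
  | succ d ih =>
    cases vs with
    | nil => exact h.elim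
    | cons v vs =>
      obtain ⟨h1, h2, h3⟩ := h
      let f₁ : ℕ → ℕ := Function.update f s v
      have hf₁ : ∀ i < s, f₁ i = f i := fun i hi => Function.update_of_ne hi.ne ..
      have hs : f₁ s = v := Function.update_self ..
      have e1 : (List.range s).reverse.map f = (List.range s).reverse.map f₁ :=
        List.map_congr_left fun i hi => (hf₁ i (by simpa using hi)).symm
      rw [e1, ← hs] at h2
      rw [e1, ← hs, ← reverse_map_range_succ] at h3
      obtain ⟨f', h4, h5⟩ := ih h3
      refine ⟨f', fun i hi => (h4 i (by omega)).trans (hf₁ i hi), fun i hi1 hi2 => ?_⟩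
      rcases hi1.eq_or_lt with rfl | hi1
      · rw [h4 _ (by omega), hs]
        refine ⟨h1, fun j hj => ?_⟩
        have := (forall₂_range_iff _ _ _ _).1 h2 j hj
        rwa [h4 j (by omega), ← hs]
      · exact h5 i hi1 (by omega)

theorem extends_specFrom {n : ℕ} {r : ℕ → ℕ → ℕ → Prop} {K : ℕ → ℕ → ℕ} {d s : ℕ} {f : ℕ → ℕ}
    (h : ∀ i, s ≤ i → i < s + d → f i < n ∧ ∀ j < i, r (f i) (K i j) (f j)) :
    ∃ vs, Extends n r (specFrom K s d) ((List.range s).reverse.map f) vs := by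
  induction d generalizing s with
  | zero => exact ⟨[], trivial⟩
  | succ d ih =>
    obtain ⟨vs, hvs⟩ := ih (s := s + 1) fun i h1 h2 => h i (by omega) (by omega)
    have h1 := h s le_rfl (by omega)
    rw [reverse_map_range_succ] at hvs
    exact ⟨f s :: vs, h1.1, (forall₂_range_iff _ _ _ _).2 h1.2, hvs⟩

theorem extends_spec_iff {n : ℕ} {r : ℕ → ℕ → ℕ → Prop} {p : List ℕ} {con : List (ℕ × ℕ)} :
    (∃ vs, Extends n r (spec p con) [] vs) ↔
      ∃ f : ℕ → ℕ, ∀ i < p.length, f i < n ∧ ∀ j < i, r (f i) (kind p con i j) (f j) := by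
  rw [spec_eq]
  constructor
  · rintro ⟨vs, h⟩
    obtain ⟨f', -, h⟩ := exists_of_extends (f := id) (s := 0) h
    exact ⟨f', fun i hi => h i (by omega) (by omega)⟩
  · rintro ⟨f, h⟩
    exact extends_specFrom (s := 0) fun i _ hi => h i (by omega)

theorem length_of_getElem?_spec {p : List ℕ} {con : List (ℕ × ℕ)} (i : ℕ) (ks : List ℕ)
    (h : (spec p con)[i]? = some ks) : ks.length = i := by
  rw [spec_eq] at h
  simpa using length_of_getElem?_specFrom h

/-- The relation `A` is the adjacency of a graph on `{0, …, n - 1}`. -/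
def Represents {n : ℕ} (A : ℕ → ℕ → Prop) (G : SimpleGraph (Fin n)) : Prop :=
  ∀ a b : Fin n, A a b ↔ G.Adj a b

theorem represents_graphOfCode (n g : ℕ) : Represents (CodeAdj n g) (graphOfCode n g) :=
  fun _ _ => Iff.rfl

theorem kind_nil (p : List ℕ) (i j : ℕ) : kind p [] i j = if p.getD i 0 = j then 1 else 0 := by
  simp [kind]

theorem exists_embedding {n k : ℕ} {A : ℕ → ℕ → Prop} {G : SimpleGraph (Fin n)} (hA : Represents A G)
    {p : List ℕ} {f : ℕ → ℕ}
    (hf : ∀ i < k, f i < n ∧ ∀ j < i, f i ≠ f j ∧ (A (f i) (f j) ↔ p.getD i 0 = j)) :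
    ∃ e : treeGraph k p ↪g G, ∀ i, (e i : ℕ) = f i := by
  let φ : Fin k → Fin n := fun i => ⟨f i, (hf i i.2).1⟩
  have key : ∀ a b : Fin k, b < a → φ a ≠ φ b ∧ (G.Adj (φ a) (φ b) ↔ (treeGraph k p).Adj a b) := by
    intro a b hba
    have h2 := (hf a a.2).2 b hba
    rw [treeGraph_adj_of_lt hba, ← hA]
    exact ⟨fun h => h2.1 (congrArg Fin.val h), h2.2⟩
  refine ⟨⟨⟨φ, fun a b hab => ?_⟩, fun {a b} => ?_⟩, fun _ => rfl⟩
  · by_contra hne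
    rcases lt_or_gt_of_ne hne with h | h
    · exact (key b a h).1 hab.symm
    · exact (key a b h).1 hab
  · change G.Adj (φ a) (φ b) ↔ _
    rcases lt_trichotomy a b with h | rfl | h
    · rw [SimpleGraph.adj_comm, (key b a h).2, SimpleGraph.adj_comm]
    · simp
    · exact (key a b h).2

theorem Relation.of_kind_nil {A : ℕ → ℕ → Prop} {p : List ℕ} {i j v m : ℕ}
    (h : Relation A v (kind p [] i j) m) : v ≠ m ∧ (A v m ↔ p.getD i 0 = j) := by
  rw [kind_nil, Relation] at h
  refine ⟨h.1, ?_⟩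
  split_ifs at h with h1 h2
  · exact iff_of_true h.2.1 h1
  · contradiction
  · contradiction
  · exact iff_of_false h.2.1 h1

theorem Relation₀.of_kind_nil {A : ℕ → ℕ → Prop} {p : List ℕ} {i j v m : ℕ}
    (h : Relation₀ A v (kind p [] i j) m) : v ≠ m ∧ (A v m ↔ p.getD i 0 = j) := by
  rw [kind_nil, Relation₀] at h
  refine ⟨h.1, ?_⟩
  split_ifs at h with h1 h2
  · contradiction
  · exact iff_of_true h.2 h1
  · exact iff_of_false h.2 h1
  · contradiction

theorem isIndContained_of_extends₀ {n k : ℕ} {A : ℕ → ℕ → Prop} {G : SimpleGraph (Fin n)}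
    (hA : Represents A G) {p : List ℕ} (hp : p.length = k)
    (h : ∃ vs, Extends n (Relation₀ A) (spec p []) [] vs) : (treeGraph k p).IsIndContained G := by
  obtain ⟨f, hf⟩ := extends_spec_iff.1 h
  obtain ⟨e, -⟩ := exists_embedding (k := k) hA fun i hi =>
    ⟨(hf i (hp ▸ hi)).1, fun j hj => ((hf i (hp ▸ hi)).2 j hj).of_kind_nil⟩
  exact ⟨e⟩

theorem isIndContained_of_extends {n k : ℕ} {A : ℕ → ℕ → Prop} {G : SimpleGraph (Fin n)}
    (hA : Represents A G) {p : List ℕ} (hp : p.length = k)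
    (h : ∃ vs, Extends n (Relation A) (spec p []) [] vs) : (treeGraph k p).IsIndContained G := by
  obtain ⟨f, hf⟩ := extends_spec_iff.1 h
  obtain ⟨e, -⟩ := exists_embedding (k := k) hA fun i hi =>
    ⟨(hf i (hp ▸ hi)).1, fun j hj => ((hf i (hp ▸ hi)).2 j hj).of_kind_nil⟩
  exact ⟨e⟩

/-- The code of `treeGraph k p`. -/
def treeCode (k : ℕ) (p : List ℕ) : ℕ :=
  ofPairs k ((pairs k).filter fun q => p.getD q.2 0 == q.1)

theorem represents_treeCode (k : ℕ) (p : List ℕ) :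
    Represents (CodeAdj k (treeCode k p)) (treeGraph k p) := by
  have key : ∀ a b : Fin k, (treeCode k p).testBit (k * a + b) = true ↔ a < b ∧ p.getD b 0 = a := by
    intro a b
    rw [treeCode, testBit_ofPairs_code (fun q hq => (mem_pairs.1 (List.mem_filter.1 hq).1).2) b.2,
      List.mem_filter, mem_pairs, beq_iff_eq]
    simp
  intro a b
  rw [CodeAdj, adj_eq, Bool.or_eq_true, key, key]
  constructor
  · rintro ⟨-, h | h⟩
    exacts [.inr h, .inl h]
  · intro h
    exact ⟨fun hab => h.ne (Fin.ext hab), h.symm⟩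

/-- All trees on `k` vertices are among the trees with parent lists `ts`. -/
def Classifies (k : ℕ) (ts : List (List ℕ)) : Prop :=
  (∀ t ∈ ts, IsParentList k t) ∧ ∀ (V : Type) [Fintype V] (T : SimpleGraph V), T.IsTree →
    Fintype.card V = k → ∃ t ∈ ts, Nonempty (treeGraph k t ≃g T)

theorem classifies_one : Classifies 1 [[0]] := by
  refine ⟨by decide, fun V _ T _ hc => ⟨[0], by simp, ⟨⟨(Fintype.equivFinOfCardEq hc).symm, ?_⟩⟩⟩⟩
  intro a b
  obtain rfl := Subsingleton.elim a b
  simp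

/-- Checks that each tree that arises from one of the trees `ts` by adding a leaf is among the trees `ts'`. -/
def extendsTo (k : ℕ) (ts ts' : List (List ℕ)) : Bool :=
  ts'.all (fun t => decide (IsParentList (k + 1) t)) &&
    ts.all fun t => (List.range k).all fun a => ts'.any fun t' =>
      embedsFrom (k + 1) (treeCode (k + 1) t') (spec (t ++ [a]) []) []

/-- A tree with `k + 1` vertices is a tree of `ts` with a leaf attached. The check embeds it into a
tree of `ts'` of the same order, and an induced embedding between graphs of equal finite order is an
isomorphism. -/
theorem Classifies.succ {k : ℕ} {ts ts' : List (List ℕ)} (hk : 0 < k) (hts : Classifies k ts)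
    (h : extendsTo k ts ts' = true) : Classifies (k + 1) ts' := by
  rw [extendsTo, Bool.and_eq_true, List.all_eq_true, List.all_eq_true] at h
  refine ⟨fun t ht => of_decide_eq_true (h.1 t ht), fun V _ T hT hc => ?_⟩
  obtain ⟨s, _, hs, hTs, hs'⟩ := exists_iso_treeGraph_append hk T hT hc
  obtain ⟨t, ht, hiso⟩ := hts.2 _ _ hTs hs
  obtain ⟨a, ha, ⟨e⟩⟩ := hs' t (hts.1 t ht).1 hiso
  obtain ⟨t', ht', h'⟩ := List.any_eq_true.1
    (List.all_eq_true.1 (h.2 t ht) a (List.mem_range.2 ha))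
  rw [embedsFrom_iff (by simp) (by simpa using length_of_getElem?_spec)] at h'
  obtain ⟨f⟩ := isIndContained_of_extends (k := k + 1) (represents_treeCode (k + 1) t')
    (by simp [(hts.1 t ht).1]) h'
  have hf : Function.Bijective f :=
    (Fintype.bijective_iff_injective_and_card f).2 ⟨f.injective, rfl⟩
  let f' : treeGraph (k + 1) (t ++ [a]) ≃g treeGraph (k + 1) t' :=
    ⟨Equiv.ofBijective f hf, f.map_rel_iff⟩
  exact ⟨t', ht', ⟨f'.symm.trans e⟩⟩

theorem Classifies.universal_iff {k : ℕ} (hk : 0 < k) {ts : List (List ℕ)} (h : Classifies k ts)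
    {V : Type*} (G : SimpleGraph V) :
    IsInducedUniversalForTrees k G ↔ ∀ t ∈ ts, (treeGraph k t).IsIndContained G := by
  constructor
  · exact fun hG t ht => hG _ ((h.1 t ht).isTree hk)
  · intro hG H hH
    obtain ⟨t, ht, ⟨e⟩⟩ := h.2 _ H hH (Fintype.card_fin k)
    exact SimpleGraph.IsIndContained.trans ⟨e.symm.toEmbedding⟩ (hG t ht)

/-- Checks that the tree `p` has an automorphism that fixes the vertices below `c.1` and maps `c.1`
to `c.2`. -/
def interchangeable (k : ℕ) (p : List ℕ) (c : ℕ × ℕ) : Bool :=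
  decide (c.1 < k ∧ c.2 < k) && (fits k (treeCode k p) c.2 ((List.range c.1).reverse.map (kind p [] c.1))
    (List.range c.1).reverse &&
    embedsFrom k (treeCode k p) (specFrom (kind p []) (c.1 + 1) (k - (c.1 + 1)))
      (c.2 :: (List.range c.1).reverse))

/-- The map is prescribed as the identity below `c.1` and as `c.2` at `c.1`. `fits` verifies this
initial segment and `embedsFrom` completes it. Only an embedding is stated, as it will only be
composed with another embedding. -/
theorem exists_of_interchangeable {k : ℕ} {p : List ℕ} {c : ℕ × ℕ} (h : interchangeable k p c = true) :
    ∃ e : treeGraph k p ↪g treeGraph k p, (∀ i, i.1 < c.1 → e i = i) ∧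
      ∀ i, i.1 = c.1 → (e i : ℕ) = c.2 := by
  obtain ⟨i, j⟩ := c
  rw [interchangeable, Bool.and_eq_true, Bool.and_eq_true, decide_eq_true_eq] at h
  obtain ⟨⟨hi, hj⟩, h1, h2⟩ := h
  dsimp only at hi hj h1 h2
  let f : ℕ → ℕ := Function.update id i j
  have hfi : f i = j := Function.update_self ..
  have hfa : ∀ a < i, f a = a := fun a ha => Function.update_of_ne ha.ne ..
  have hmap : j :: (List.range i).reverse = (List.range (i + 1)).reverse.map f := by
    rw [reverse_map_range_succ, hfi]
    congr 1
    conv_lhs => rw [← List.map_id (List.range i).reverse]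
    exact List.map_congr_left fun a ha => (hfa a (by simpa using ha)).symm
  have h1 := forall₂_of_fits (by simp) h1
  rw [embedsFrom_iff] at h2
  · obtain ⟨vs, h2⟩ := h2
    rw [hmap] at h2
    obtain ⟨f', h3, h4⟩ := exists_of_extends h2
    have hf'a : ∀ a < i, f' a = a := fun a ha => (h3 a (by omega)).trans (hfa a ha)
    have hf'i : f' i = j := (h3 i (by omega)).trans hfi
    obtain ⟨e, he⟩ := exists_embedding (k := k) (p := p) (f := f') (represents_treeCode k p) <| by
      intro a ha
      rcases lt_trichotomy a i with hai | rfl | hai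
      · rw [hf'a a hai]
        refine ⟨ha, fun b hb => ?_⟩
        rw [hf'a b (by omega)]
        exact ⟨by omega, (represents_treeCode k p ⟨a, ha⟩ ⟨b, by omega⟩).trans
          (treeGraph_adj_of_lt (by exact hb))⟩
      · rw [hf'i]
        refine ⟨hj, fun b hb => ?_⟩
        rw [hf'a b hb]
        conv at h1 => rhs; rw [← List.map_id (List.range a).reverse]
        exact ((forall₂_range_iff _ _ _ _).1 h1 b hb).of_kind_nil
      · obtain ⟨h5, h6⟩ := h4 a (by omega) (by omega)
        exact ⟨h5, fun b hb => (h6 b hb).of_kind_nil⟩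
    refine ⟨e, fun a ha => Fin.ext ((he a).trans (hf'a a ha)), fun a ha => ?_⟩
    rw [he, ha, hf'i]
  · intro m hm
    simp only [List.mem_cons, List.mem_reverse, List.mem_range] at hm
    omega
  · intro a ks h
    rw [length_of_getElem?_specFrom h]
    simp

/-- An embedding of a tree may be chosen such that interchangeable vertices have images in increasing
order. -/
theorem exists_extends_of_isIndContained {n k : ℕ} {A : ℕ → ℕ → Prop} {G : SimpleGraph (Fin n)}
    (hA : Represents A G) {p : List ℕ} (hp : p.length = k) {con : List (ℕ × ℕ)}
    (hc : ∀ c ∈ con, interchangeable k p c = true) (h : (treeGraph k p).IsIndContained G) :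
    ∃ vs, Extends n (Relation A) (spec p con) [] vs := by
  have : Nonempty (treeGraph k p ↪g G) := h
  have : Finite (treeGraph k p ↪g G) := DFunLike.finite _
  -- Take a lexicographically least embedding. If `e j < e i` for a constrained pair `(i, j)`,
  -- composing with the symmetry that fixes everything below `i` and sends `i` to `j` gives a
  -- smaller one. So all constraints hold at once, with no compatibility between the symmetries
  -- required.
  obtain ⟨e, he⟩ := Finite.exists_min fun e : treeGraph k p ↪g G => toLex (e : Fin k → Fin n)
  have hlt : ∀ i j : Fin k, (i.1, j.1) ∈ con → i < j → e i < e j := by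
    intro i j hij hlt
    obtain ⟨σ, h1, h2⟩ := exists_of_interchangeable (hc _ hij)
    have h3 : σ i = j := Fin.ext (h2 i rfl)
    refine lt_of_le_of_ne ?_ fun h => hlt.ne (e.injective h)
    by_contra! h4
    refine (he (e.comp σ)).not_gt ⟨i, fun a ha => ?_, ?_⟩
    · change e (σ a) = e a
      rw [h1 a ha]
    · change e (σ i) < e i
      rwa [h3]
  refine extends_spec_iff.2 ⟨fun i => if hi : i < k then e ⟨i, hi⟩ else 0, fun i hi => ?_⟩
  rw [hp] at hi
  dsimp only
  rw [dif_pos hi]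
  refine ⟨(e ⟨i, hi⟩).2, fun j hj => ?_⟩
  rw [dif_pos (hj.trans hi), kind]
  have hne : e ⟨i, hi⟩ ≠ e ⟨j, hj.trans hi⟩ := fun h => hj.ne' (congrArg Fin.val (e.injective h))
  have hadj : A (e ⟨i, hi⟩) (e ⟨j, hj.trans hi⟩) ↔ p.getD i 0 = j := by
    rw [hA, e.map_adj_iff, treeGraph_adj_of_lt (by exact hj)]
  refine ⟨fun h => hne (Fin.ext h), ?_⟩
  by_cases h1 : p.getD i 0 = j
  · rw [if_pos h1, if_pos rfl]
    exact ⟨hadj.2 h1, by omega⟩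
  · by_cases h2 : (j, i) ∈ con
    · rw [if_neg h1, if_pos h2, if_neg (by omega)]
      exact ⟨fun h => h1 (hadj.1 h), fun _ => hlt ⟨j, hj.trans hi⟩ ⟨i, hi⟩ h2 hj⟩
    · rw [if_neg h1, if_neg h2, if_neg (by omega)]
      exact ⟨fun h => h1 (hadj.1 h), by omega⟩

end TreeUniversal

namespace TreeUniversal

/-! ### Numbering the vertices of a universal graph -/

section Order

variable {V : Type*}

/-- The star with centre `c` and leaves `sl` is an induced subgraph. -/
def IsStarIn (G : SimpleGraph V) (c : V) (sl : List V) : Prop :=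
  (c :: sl).Nodup ∧ (∀ v ∈ sl, G.Adj c v) ∧ ∀ u ∈ sl, ∀ v ∈ sl, ¬G.Adj u v

/-- The path with vertices `t` is an induced subgraph. -/
def IsPathIn (G : SimpleGraph V) (t : List V) : Prop :=
  t.Nodup ∧ ∀ i j u v, t[i]? = some u → t[j]? = some v → (G.Adj u v ↔ i + 1 = j ∨ j + 1 = i)

theorem IsPathIn.reverse {G : SimpleGraph V} {t : List V} (h : IsPathIn G t) : IsPathIn G t.reverse := by
  refine ⟨List.nodup_reverse.2 h.1, fun i j u v hi hj => ?_⟩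
  have hi' := (List.getElem?_eq_some_iff.1 hi).1
  have hj' := (List.getElem?_eq_some_iff.1 hj).1
  rw [List.length_reverse] at hi' hj'
  rw [List.getElem?_reverse hi'] at hi
  rw [List.getElem?_reverse hj'] at hj
  rw [h.2 _ _ _ _ hi hj]
  omega

theorem exists_isStarIn {k : ℕ} (hk : 0 < k) {G : SimpleGraph V}
    (h : (treeGraph k (List.replicate k 0)).IsIndContained G) :
    ∃ c sl, IsStarIn G c sl ∧ sl.length + 1 = k := by
  obtain ⟨m, rfl⟩ : ∃ m, k = m + 1 := ⟨k - 1, by omega⟩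
  obtain ⟨e⟩ := h
  have h0 : ∀ i : Fin (m + 1), (List.replicate (m + 1) 0).getD i 0 = 0 := fun i => by
    simp [List.getD_eq_getElem?_getD]
  refine ⟨e 0, List.ofFn fun i : Fin m => e i.succ, ⟨?_, ?_, ?_⟩, by simp⟩
  · rw [← List.ofFn_succ, List.nodup_ofFn]
    exact e.injective
  · intro v hv
    obtain ⟨i, rfl⟩ := List.mem_ofFn.1 hv
    rw [e.map_adj_iff, SimpleGraph.adj_comm, treeGraph_adj_of_lt (Fin.succ_pos i), h0]
    rfl
  · intro u hu v hv
    obtain ⟨i, rfl⟩ := List.mem_ofFn.1 hu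
    obtain ⟨j, rfl⟩ := List.mem_ofFn.1 hv
    rw [e.map_adj_iff]
    rintro (⟨-, h⟩ | ⟨-, h⟩) <;> rw [h0] at h <;> simp at h

theorem exists_isPathIn {k : ℕ} {G : SimpleGraph V}
    (h : (treeGraph k (0 :: List.range (k - 1))).IsIndContained G) :
    ∃ t, IsPathIn G t ∧ t.length = k := by
  obtain ⟨e⟩ := h
  refine ⟨List.ofFn e, ⟨List.nodup_ofFn.2 e.injective, fun i j u v hi hj => ?_⟩, by simp⟩
  simp only [List.getElem?_ofFn, Option.dite_none_right_eq_some, Option.some.injEq] at hi hj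
  obtain ⟨hi, rfl⟩ := hi
  obtain ⟨hj, rfl⟩ := hj
  have h0 : ∀ i, 0 < i → i < k → (0 :: List.range (k - 1)).getD i 0 = i - 1 := by
    intro i h1 h2
    obtain ⟨i, rfl⟩ : ∃ m, i = m + 1 := ⟨i - 1, by omega⟩
    have : i < k - 1 := by omega
    simp [List.getD_eq_getElem?_getD, this]
  have key : ∀ i j (hi : i < k) (hj : j < k), j < i → ((treeGraph k (0 :: List.range (k - 1))).Adj
      ⟨i, hi⟩ ⟨j, hj⟩ ↔ j + 1 = i) := by
    intro i j hi hj hji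
    rw [treeGraph_adj_of_lt (by exact hji), h0 i (by omega) hi]
    dsimp only
    omega
  rw [e.map_adj_iff]
  rcases lt_trichotomy i j with hij | rfl | hij
  · rw [SimpleGraph.adj_comm, key j i hj hi hij]; omega
  · simp
  · rw [key i j hi hj hij]; omega

open Classical in
/-- The type of a vertex with respect to a star. -/
noncomputable def vertexType (c : V) (sl : List V) (v : V) : ℕ :=
  if v = c then 0 else if v ∈ sl then 1 else 2

theorem vertexType_eq_zero {c : V} {sl : List V} {v : V} : vertexType c sl v = 0 ↔ v = c := by
  unfold vertexType; split_ifs <;> simp_all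

theorem vertexType_eq_one {c : V} {sl : List V} (h : c ∉ sl) {v : V} :
    vertexType c sl v = 1 ↔ v ∈ sl := by
  unfold vertexType; split_ifs <;> simp_all

theorem vertexType_lt (c : V) (sl : List V) (v : V) : vertexType c sl v < 3 := by
  unfold vertexType; split_ifs <;> simp

theorem exists_perm_of_prefix (l t : List V) (hl : l.Nodup) (ht : t.Nodup) (hs : ∀ v ∈ t, v ∈ l)
    (key : V → ℕ) :
    ∃ R, (t ++ R).Perm l ∧ R.Pairwise fun u v => key u ≤ key v := by
  classical
  have htot : Std.Total fun u v : V => key u ≤ key v := ⟨fun u v => le_total _ _⟩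
  have htr : IsTrans V fun u v => key u ≤ key v := ⟨fun _ _ _ => le_trans⟩
  refine ⟨(l.filter (· ∉ t)).insertionSort fun u v => key u ≤ key v, ?_,
    List.pairwise_insertionSort _ _⟩
  refine ((List.perm_insertionSort _ _).append_left t).trans ?_
  refine (List.perm_ext_iff_of_nodup (ht.append (hl.filter _) ?_) hl).2 fun v => ?_
  · intro v h1 h2
    simp [h1] at h2
  · simp only [List.mem_append, List.mem_filter, decide_eq_true_eq]
    constructor
    · rintro (h | h)
      exacts [hs v h, h.1]
    · intro h
      by_cases hv : v ∈ t
      exacts [.inl hv, .inr ⟨h, hv⟩]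

/-- The counters `l` and `o` run through the parts of `ℓ` where the leaves on the path and the outer
vertices on the path are stored in path order. Reading a path vertex advances the counter of its
class by one. -/
theorem map_labels {ℓ t : List V} {ty : V → ℕ} {c : V} (hc : ∀ v ∈ t, ty v = 0 → v = c)
    (h0 : ℓ[0]? = some c) {l o : ℕ} (h1 : t.filter (ty · = 1) <+: ℓ.drop l)
    (h2 : t.filter (fun v => ty v ≠ 0 ∧ ty v ≠ 1) <+: ℓ.drop o) :
    (labels (t.map ty) l o).map (ℓ[·]?) = t.map some := by
  have aux : ∀ {v s l}, v :: s <+: ℓ.drop l → ℓ[l]? = some v ∧ s <+: ℓ.drop (l + 1) := by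
    rintro v s l ⟨r, hr⟩
    refine ⟨?_, r, ?_⟩
    · rw [← List.head?_drop, ← hr]; rfl
    · rw [← List.tail_drop, ← hr]; rfl
  induction t generalizing l o with
  | nil => rfl
  | cons v t ih =>
    have hc' : ∀ v ∈ t, ty v = 0 → v = c := fun u hu => hc u (by simp [hu])
    rw [List.map_cons]
    rcases hv : ty v with _ | _ | x
    · rw [List.filter_cons_of_neg (by simp [hv])] at h1 h2
      rw [labels, List.map_cons, ih hc' h1 h2, h0, hc v (by simp) hv, List.map_cons]
    · rw [List.filter_cons_of_pos (by simp [hv])] at h1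
      rw [List.filter_cons_of_neg (by simp [hv])] at h2
      rw [labels, List.map_cons, ih hc' (aux h1).2 h2, (aux h1).1, List.map_cons]
    · rw [List.filter_cons_of_neg (by simp [hv])] at h1
      rw [List.filter_cons_of_pos (by simp [hv])] at h2
      rw [labels, List.map_cons, ih hc' h1 (aux h2).2, (aux h2).1, List.map_cons]
      all_goals omega

/-- The adjacency of the vertices with given positions in a list. -/
def ListAdj (G : SimpleGraph V) (ℓ : List V) (a b : ℕ) : Prop :=
  ∃ u v, ℓ[a]? = some u ∧ ℓ[b]? = some v ∧ G.Adj u v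

theorem ListAdj.symm {G : SimpleGraph V} {ℓ : List V} {a b : ℕ} :
    ListAdj G ℓ a b → ListAdj G ℓ b a := fun ⟨u, v, h1, h2, h3⟩ => ⟨v, u, h2, h1, h3.symm⟩

theorem listAdj_iff {G : SimpleGraph V} {ℓ : List V} {a b : ℕ} {u v : V} (hu : ℓ[a]? = some u)
    (hv : ℓ[b]? = some v) : ListAdj G ℓ a b ↔ G.Adj u v := by
  constructor
  · rintro ⟨u', v', h1, h2, h3⟩
    rw [hu] at h1; rw [hv] at h2
    cases h1; cases h2; exact h3
  · exact fun h => ⟨u, v, hu, hv, h⟩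

theorem graphOfCode_codeOf_iso {n : ℕ} (G : SimpleGraph V) {ℓ : List V} (hl : ℓ.length = n) (hn : ℓ.Nodup)
    (ha : ∀ v, v ∈ ℓ) : Nonempty (graphOfCode n (codeOf n (ListAdj G ℓ)) ≃g G) := by
  subst hl
  let φ : Fin ℓ.length → V := fun i => ℓ[i]
  have hφ : Function.Bijective φ :=
    ⟨fun i j h => Fin.ext (hn.getElem_inj_iff.1 h), fun v => by
      obtain ⟨i, hi, rfl⟩ := List.mem_iff_getElem.1 (ha v)
      exact ⟨⟨i, hi⟩, rfl⟩⟩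
  refine ⟨⟨Equiv.ofBijective φ hφ, ?_⟩⟩
  intro a b
  rw [graphOfCode_adj, codeAdj_codeOf (fun _ _ => ListAdj.symm) _ a.2 b.2]
  · exact (listAdj_iff (List.getElem?_eq_getElem a.2) (List.getElem?_eq_getElem b.2)).symm
  · rintro a ⟨u, v, h1, h2, h3⟩
    rw [h1] at h2
    cases h2
    exact h3.ne rfl

/-- Pairs of positions below `k` are governed by the star, pairs in `ps` by the path. Both describe
the same graph, so the priority that `known` gives to the star is harmless. -/
theorem compatible_listAdj {n k : ℕ} {G : SimpleGraph V} {c : V} {L B t : List V} {ps : List ℕ}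
    (hL : IsStarIn G c L) (hk : L.length + 1 = k)
    (hps : ps.map ((c :: (L ++ B))[·]?) = t.map some) (ht : IsPathIn G t) :
    Compatible n k ps (ListAdj G (c :: (L ++ B))) := by
  refine ⟨fun _ _ => ListAdj.symm, fun a b x _ _ hab hx => ?_⟩
  unfold known at hx
  dsimp only at hx
  split_ifs at hx with h1 h2
  · cases hx
    have key : ∀ a, a + 1 < k → ∃ u ∈ L, (c :: (L ++ B))[a + 1]? = some u := by
      intro a ha
      have : a < L.length := by omega
      exact ⟨L[a], List.getElem_mem this, by simp [List.getElem?_append_left this]⟩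
    have h0 : (c :: (L ++ B))[0]? = some c := rfl
    rcases a with _ | a <;> rcases b with _ | b
    · exact absurd rfl hab
    · obtain ⟨u, hu, hu'⟩ := key b h1.2
      rw [listAdj_iff h0 hu']
      simp [hL.2.1 u hu]
    · obtain ⟨u, hu, hu'⟩ := key a h1.1
      rw [listAdj_iff hu' h0]
      simp [(hL.2.1 u hu).symm]
    · obtain ⟨u, hu, hu'⟩ := key a h1.1
      obtain ⟨v, hv, hv'⟩ := key b h1.2
      rw [listAdj_iff hu' hv']
      simp [hL.2.2 u hu v hv]
  · cases hx
    have key : ∀ a ∈ ps, ∃ u, (c :: (L ++ B))[a]? = some u ∧ t[ps.idxOf a]? = some u := by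
      intro a ha
      have hi := List.idxOf_lt_length_of_mem ha
      have hlen : ps.length = t.length := by simpa using congrArg List.length hps
      have h3 := congrArg (fun l => l[ps.idxOf a]?) hps
      simp only [List.getElem?_map, List.getElem?_eq_getElem hi,
        List.getElem?_eq_getElem (hlen ▸ hi), Option.map_some, List.getElem_idxOf] at h3
      refine ⟨_, Option.some.inj h3, List.getElem?_eq_getElem _⟩
    obtain ⟨u, hu, hu'⟩ := key a h2.1
    obtain ⟨v, hv, hv'⟩ := key b h2.2
    rw [listAdj_iff hu hv, ht.2 _ _ _ _ hu' hv']
    simp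

/-- The neighbours of a vertex in a list, which starts at position `k`. -/
noncomputable def neighbourCode (G : SimpleGraph V) (k : ℕ) (B : List V) (v : V) : ℕ :=
  open Classical in
  -- With row length `0` the pair `(0, x)` is coded by bit `x`, so this is just the code of a set of
  -- positions.
  ofPairs 0 (((List.range B.length).filter fun i => ∃ u, B[i]? = some u ∧ G.Adj v u).map
    fun i => (0, k + i))

theorem testBit_neighbourCode {G : SimpleGraph V} {k : ℕ} {B : List V} {v : V} {x : ℕ} :
    (neighbourCode G k B v).testBit x = true ↔ ∃ i u, B[i]? = some u ∧ x = k + i ∧ G.Adj v u := by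
  rw [neighbourCode, testBit_ofPairs]
  simp only [List.mem_map, List.mem_filter, List.mem_range, decide_eq_true_eq]
  constructor
  · rintro ⟨_, ⟨i, ⟨_, u, hu, h⟩, rfl⟩, rfl⟩
    exact ⟨i, u, hu, by simp, h⟩
  · rintro ⟨i, u, hu, rfl, h⟩
    exact ⟨_, ⟨i, ⟨(List.getElem?_eq_some_iff.1 hu).1, u, hu, h⟩, rfl⟩, by simp⟩

/-- A leaf has no neighbours among the leaves, and its edge to the centre is stored in row `0`. What
remains of its row is its neighbourhood in `B`, which does not depend on the order of the leaves;
this is why the leaves can be sorted by their rows. -/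
theorem row_codeOf {n k : ℕ} {G : SimpleGraph V} {c : V} {L B : List V} (hL : IsStarIn G c L)
    (hk : L.length + 1 = k) (hn : (c :: (L ++ B)).length = n) {l : ℕ} {v : V} (hl : L[l]? = some v) :
    row n (codeOf n (ListAdj G (c :: (L ++ B)))) (l + 1) = neighbourCode G k B v := by
  have hll := (List.getElem?_eq_some_iff.1 hl).1
  have hv : (c :: (L ++ B))[l + 1]? = some v := by
    rw [List.getElem?_cons_succ, List.getElem?_append_left hll, hl]
  apply Nat.eq_of_testBit_eq
  intro x
  rw [Bool.eq_iff_iff, testBit_neighbourCode]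
  change ((codeOf n (ListAdj G (c :: (L ++ B)))) >>> (n * (l + 1)) &&& (2 ^ n - 1)).testBit x = true ↔ _
  rw [Nat.testBit_and, Bool.and_eq_true, Nat.testBit_shiftRight, Nat.testBit_two_pow_sub_one,
    decide_eq_true_eq]
  simp only [List.length_cons, List.length_append] at hn
  constructor
  · rintro ⟨h1, h2⟩
    rw [testBit_codeOf _ h2] at h1
    obtain ⟨h3, u, u', h4, h5, h6⟩ := h1
    obtain rfl : v = u := Option.some.inj (hv.symm.trans h4)
    obtain ⟨x, rfl⟩ : ∃ y, x = y + 1 := ⟨x - 1, by omega⟩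
    rw [List.getElem?_cons_succ] at h5
    by_cases hx : x < L.length
    · rw [List.getElem?_append_left hx] at h5
      exact absurd h6 (hL.2.2 _ (List.mem_of_getElem? hl) _ (List.mem_of_getElem? h5))
    · rw [List.getElem?_append_right (by omega)] at h5
      exact ⟨_, u', h5, by omega, h6⟩
  · rintro ⟨i, u, hi, rfl, h⟩
    have hi' := (List.getElem?_eq_some_iff.1 hi).1
    have hx : k + i < n := by omega
    refine ⟨?_, hx⟩
    rw [testBit_codeOf _ hx]
    refine ⟨by omega, v, u, hv, ?_, h⟩
    rw [← hk, show L.length + 1 + i = L.length + i + 1 by omega, List.getElem?_cons_succ,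
      List.getElem?_append_right (by omega), Nat.add_sub_cancel_left, hi]

theorem sorted_iff {n g : ℕ} {ls : List ℕ} :
    sorted n g ls = true ↔ ∀ l ∈ ls, row n g l ≤ row n g (l + 1) := by
  induction ls with
  | nil => exact ⟨nofun, fun _ => rfl⟩
  | cons l ls ih =>
    change band (Nat.ble (row n g l) (row n g (l + 1))) (sorted n g ls) = true ↔ _
    rw [band_eq, Bool.and_eq_true, ih, Nat.ble_eq, List.forall_mem_cons]

theorem mem_freeLeaves {k : ℕ} {w : List ℕ} {l : ℕ} :
    l ∈ freeLeaves k w ↔ l < k - 1 ∧ w.count 1 < l := by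
  simp [freeLeaves]

/-- The vertices of a graph that contains a star and a path may be numbered in the way that the search
expects. -/
theorem exists_normalForm [Fintype V] {n k : ℕ} (hn : Fintype.card V = n) {G : SimpleGraph V} {c : V}
    {sl t : List V} (hs : IsStarIn G c sl) (hk : sl.length + 1 = k) (ht : IsPathIn G t) :
    ∃ A : ℕ → ℕ → Prop, Compatible n k (labels (t.map (vertexType c sl)) 1 k) A ∧
      sorted n (codeOf n A) (freeLeaves k (t.map (vertexType c sl))) = true ∧ (∀ a, ¬A a a) ∧
      Nonempty (graphOfCode n (codeOf n A) ≃g G) := by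
  classical
  set ty := vertexType c sl with hty
  have hcsl : c ∉ sl := (List.nodup_cons.1 hs.1).1
  have hone : ∀ {v}, ty v = 1 ↔ v ∈ sl := vertexType_eq_one hcsl
  -- The outer vertices are arranged before the leaves, because the sorting key of a leaf refers to
  -- their positions. Their own order off the path is arbitrary, hence the constant key.
  obtain ⟨RO, hB, -⟩ := exists_perm_of_prefix
    (Finset.univ.toList.filter fun v => ty v ≠ 0 ∧ ty v ≠ 1)
    (t.filter fun v => ty v ≠ 0 ∧ ty v ≠ 1) ((Finset.nodup_toList _).filter _) (ht.1.filter _)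
    (by simp) fun _ => 0
  set B := (t.filter fun v => ty v ≠ 0 ∧ ty v ≠ 1) ++ RO with hBdef
  -- The leaves on the path have their places fixed by the path; only the others are free to be
  -- sorted.
  obtain ⟨RL, hL, hsort⟩ := exists_perm_of_prefix sl (t.filter (ty · = 1)) (List.nodup_cons.1 hs.1).2
    (ht.1.filter _) (by simp [hone]) (neighbourCode G k B)
  set L := t.filter (ty · = 1) ++ RL with hLdef
  have hstar : IsStarIn G c L := by
    refine ⟨(hL.cons c).nodup_iff.2 hs.1, fun v hv => hs.2.1 v (hL.mem_iff.1 hv), fun u hu v hv =>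
      hs.2.2 u (hL.mem_iff.1 hu) v (hL.mem_iff.1 hv)⟩
  have hlenL : L.length + 1 = k := by rw [hL.length_eq, hk]
  have hmem : ∀ v, v ∈ c :: (L ++ B) := by
    intro v
    rw [List.mem_cons, List.mem_append, hL.mem_iff, hB.mem_iff, ← hone]
    by_cases h0 : ty v = 0
    · exact .inl (vertexType_eq_zero.1 h0)
    · by_cases h1 : ty v = 1 <;> simp [h0, h1]
  have hnd : (c :: (L ++ B)).Nodup := by
    have h1 : (L ++ B).Nodup := by
      refine (List.nodup_cons.1 hstar.1).2.append
        (hB.nodup_iff.2 ((Finset.nodup_toList _).filter _)) fun v h1 h2 => ?_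
      rw [hL.mem_iff, ← hone] at h1
      rw [hB.mem_iff] at h2
      simp [h1] at h2
    refine List.nodup_cons.2 ⟨fun h => ?_, h1⟩
    rcases List.mem_append.1 h with h | h
    · exact (List.nodup_cons.1 hstar.1).1 h
    · rw [hB.mem_iff] at h
      have : ty c = 0 := vertexType_eq_zero.2 rfl
      simp [this] at h
  have hlen : (c :: (L ++ B)).length = n := by
    have h1 : (c :: (L ++ B)).toFinset = Finset.univ := by ext v; simpa using hmem v
    rw [← List.toFinset_card_of_nodup hnd, h1, Finset.card_univ, hn]
  refine ⟨ListAdj G (c :: (L ++ B)), compatible_listAdj hstar hlenL (map_labels (c := c) ?_ rfl ?_ ?_) ht,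
    ?_, ?_, graphOfCode_codeOf_iso G hlen hnd hmem⟩
  · exact fun v _ hv => vertexType_eq_zero.1 hv
  · simp [hLdef]
  · have : (c :: (L ++ B)).drop k = B := by rw [← hlenL]; simp
    rw [this, hBdef]
    exact List.prefix_append ..
  · rw [sorted_iff]
    intro l hl
    rw [mem_freeLeaves] at hl
    have hcount : (t.map ty).count 1 = (t.filter (ty · = 1)).length := by
      rw [List.count, List.countP_map, List.countP_eq_length_filter]
      congr 1
    rw [hcount] at hl
    obtain ⟨l, rfl⟩ : ∃ y, l = y + 1 := ⟨l - 1, by omega⟩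
    have h1 : l + 1 < L.length := by omega
    rw [row_codeOf hstar hlenL hlen (List.getElem?_eq_getElem (by omega : l < L.length)),
      row_codeOf hstar hlenL hlen (List.getElem?_eq_getElem h1)]
    have h2 : (t.filter (ty · = 1)).length ≤ l := by omega
    have h3 : l + 1 - (t.filter (ty · = 1)).length < RL.length := by
      rw [hLdef, List.length_append] at h1; omega
    simp only [hLdef, List.getElem_append_right h2,
      List.getElem_append_right (show (t.filter (ty · = 1)).length ≤ l + 1 by omega)]
    exact List.pairwise_iff_getElem.1 hsort _ _ _ h3 (by omega)
  · rintro a ⟨u, v, h1, h2, h3⟩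
    rw [h1] at h2
    cases h2
    exact h3.ne rfl

end Order

end TreeUniversal

namespace TreeUniversal

/-! ### The types of the vertices of a path -/

def allWords : ℕ → List (List ℕ)
  | 0 => [[]]
  | k + 1 => (allWords k).flatMap fun w => [0 :: w, 1 :: w, 2 :: w]

theorem mem_allWords {w : List ℕ} (h : ∀ x ∈ w, x < 3) : w ∈ allWords w.length := by
  induction w with
  | nil => simp [allWords]
  | cons x w ih =>
    rw [List.length_cons, allWords, List.mem_flatMap]
    refine ⟨w, ih fun y hy => h y (by simp [hy]), ?_⟩
    have := h x (by simp)
    interval_cases x <;> simp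

/-- Necessary conditions on the types of the vertices of an induced path on `k` vertices with respect to an induced
star on `k` vertices, in a graph on `n` vertices. -/
def consistent (n k : ℕ) (w : List ℕ) : Bool :=
  decide (w.count 0 ≤ 1) && decide (w.count 1 + 1 ≤ k) && decide (w.count 2 + k ≤ n) &&
    (List.range k).all fun j => (List.range j).all fun i =>
      w.getD i 0 == 2 || w.getD j 0 == 2 ||
        (w.getD i 0 == 0 || w.getD j 0 == 0) == (i + 1 == j)

theorem count_map_le {V : Type*} {ty : V → ℕ} {t m : List V} {x : ℕ} (ht : t.Nodup)
    (h : ∀ v ∈ t, ty v = x → v ∈ m) : (t.map ty).count x ≤ m.length := by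
  rw [List.count, List.countP_map, List.countP_eq_length_filter]
  refine (List.subperm_of_subset (ht.filter _) fun v hv => ?_).length_le
  rw [List.mem_filter] at hv
  exact h v hv.1 (by simpa using hv.2)

/-- Two path vertices in the star are adjacent if and only if one of them is the centre, and also if
and only if they are consecutive on the path. The bound on the number of twos holds because the path
vertices outside the star and the star itself are disjoint. -/
theorem consistent_types {V : Type*} [Fintype V] {n k : ℕ} (hn : Fintype.card V = n)
    {G : SimpleGraph V} {c : V} {sl t : List V} (hs : IsStarIn G c sl) (hk : sl.length + 1 = k)
    (ht : IsPathIn G t) (htk : t.length = k) : consistent n k (t.map (vertexType c sl)) = true := by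
  classical
  have hcsl := (List.nodup_cons.1 hs.1).1
  have hone : ∀ {v}, vertexType c sl v = 1 ↔ v ∈ sl := vertexType_eq_one hcsl
  simp only [consistent, Bool.and_eq_true, decide_eq_true_eq, List.all_eq_true, List.mem_range]
  refine ⟨⟨⟨?_, ?_⟩, ?_⟩, fun j hj i hi => ?_⟩
  · exact count_map_le (m := [c]) ht.1 fun v _ hv => by simpa using vertexType_eq_zero.1 hv
  · rw [← hk, add_le_add_iff_right]
    exact count_map_le ht.1 fun v _ hv => hone.1 hv
  · have h1 : (t.map (vertexType c sl)).count 2 ≤ (t.filter (vertexType c sl · = 2)).length :=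
      count_map_le ht.1 fun v hv h => by simp [hv, h]
    have h2 : (t.filter (vertexType c sl · = 2) ++ c :: sl).Nodup := by
      refine (ht.1.filter _).append hs.1 fun v h1 h2 => ?_
      have h1 : vertexType c sl v = 2 := by simpa using (List.mem_filter.1 h1).2
      rcases List.mem_cons.1 h2 with h2 | h2
      · rw [vertexType_eq_zero.2 h2] at h1; omega
      · rw [hone.2 h2] at h1; omega
    have h3 := h2.length_le_card
    rw [List.length_append, List.length_cons] at h3
    omega
  · have hget : ∀ i (hi : i < k), (t.map (vertexType c sl)).getD i 0 =
        vertexType c sl (t[i]'(htk ▸ hi)) := by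
      intro i hi
      rw [← htk] at hi
      simp [List.getD_eq_getElem?_getD, hi]
    rw [hget i (hi.trans hj), hget j hj]
    have hadj := ht.2 i j _ _ (List.getElem?_eq_getElem (htk ▸ hi.trans hj))
      (List.getElem?_eq_getElem (htk ▸ hj))
    have hne : t[i]'(htk ▸ hi.trans hj) ≠ t[j]'(htk ▸ hj) := fun h =>
      hi.ne (ht.1.getElem_inj_iff.1 h)
    generalize t[i]'(htk ▸ hi.trans hj) = u at *
    generalize t[j]'(htk ▸ hj) = v at *
    have hadj' : G.Adj u v ↔ i + 1 = j := hadj.trans (or_iff_left (by omega))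
    have h0 : ∀ v, vertexType c sl v ≠ 2 → v ≠ c → v ∈ sl := by
      intro v h1 h2
      have := vertexType_lt c sl v
      rw [← hone]
      have : vertexType c sl v ≠ 0 := fun h => h2 (vertexType_eq_zero.1 h)
      omega
    by_cases hu2 : vertexType c sl u = 2
    · simp [hu2]
    by_cases hv2 : vertexType c sl v = 2
    · simp [hv2]
    rw [Bool.or_eq_true]
    right
    rw [beq_iff_eq, Bool.eq_iff_iff, Bool.or_eq_true, beq_iff_eq, beq_iff_eq, beq_iff_eq,
      vertexType_eq_zero, vertexType_eq_zero, ← hadj']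
    by_cases huc : u = c
    · subst huc
      exact iff_of_true (.inl rfl) (hs.2.1 v (h0 v hv2 hne.symm))
    · by_cases hvc : v = c
      · subst hvc
        exact iff_of_true (.inr rfl) (hs.2.1 u (h0 u hu2 hne)).symm
      · exact iff_of_false (by tauto) (hs.2.2 u (h0 u hu2 huc) v (h0 v hv2 hvc))

/-- Checks that each consistent word or its reverse is among `ws`. -/
def wordsComplete (n k : ℕ) (ws : List (List ℕ)) : Bool :=
  (allWords k).all fun w => !consistent n k w || (decide (w ∈ ws) || decide (w.reverse ∈ ws))

/-! ### Completeness of the search -/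

theorem universal_congr {V W : Type*} {k : ℕ} {G : SimpleGraph V} {H : SimpleGraph W} (e : G ≃g H)
    (h : IsInducedUniversalForTrees k G) : IsInducedUniversalForTrees k H :=
  fun T hT => (h T hT).trans ⟨e.toEmbedding⟩

/-- Checks that trees are in a list, and that pairs of vertices are interchangeable. -/
def treesChecked (k : ℕ) (ts : List (List ℕ)) (trees : List (List ℕ × List (ℕ × ℕ))) : Bool :=
  trees.all fun t => decide (t.1 ∈ ts) && t.2.all (interchangeable k t.1)

/-- Searches the graphs in which the path has the types `w`. The trees `trees` guide the search; the trees `ex` have to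
be excluded at the end. -/
def searchTable (n k : ℕ) (trees : List (List ℕ × List (ℕ × ℕ))) (ex : List (List ℕ))
    (tbl : List (List ℕ)) (w : List ℕ) : Bool :=
  search n k (trees.map fun t => spec t.1 t.2)
    (leaf n (freeLeaves k w) tbl (ex.map fun p => spec p [])) w

/-- Here the checks are put together. Star and path enter through the numbering of the vertices, the
trees in `trees` through the placements that guide the search, and those in `ex` through the final
test. An empty table or an empty list of words turns the statement into nonexistence. -/
theorem exists_iso_of_universal {n k : ℕ} (hn : n ≤ 16) (hk : 0 < k) {ts : List (List ℕ)}
    (hcl : Classifies k ts) (hstar : List.replicate k 0 ∈ ts) (hpath : 0 :: List.range (k - 1) ∈ ts)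
    {trees : List (List ℕ × List (ℕ × ℕ))} (htrees : treesChecked k ts trees = true)
    {ex : List (List ℕ)} (hex : ∀ p ∈ ex, p ∈ ts) {ws : List (List ℕ)}
    (hws : wordsComplete n k ws = true) {tbl : List (List ℕ)}
    (hsearch : ∀ w ∈ ws, searchTable n k trees ex tbl w = true)
    {V : Type*} [Fintype V] (hV : Fintype.card V = n) {G : SimpleGraph V}
    (hG : IsInducedUniversalForTrees k G) :
    ∃ g ∈ tbl.flatten, Nonempty (graphOfCode n g ≃g G) := by
  have hG' := (hcl.universal_iff hk G).1 hG
  obtain ⟨c, sl, hs, hsl⟩ := exists_isStarIn hk (hG' _ hstar)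
  obtain ⟨t, ht, htk, hw⟩ : ∃ t, IsPathIn G t ∧ t.length = k ∧ t.map (vertexType c sl) ∈ ws := by
    obtain ⟨t, ht, htk⟩ := exists_isPathIn (hG' _ hpath)
    have h1 : t.map (vertexType c sl) ∈ allWords k := by
      have := mem_allWords (w := t.map (vertexType c sl)) (by simp [vertexType_lt])
      rwa [List.length_map, htk] at this
    have h2 := List.all_eq_true.1 hws _ h1
    rw [consistent_types hV hs hsl ht htk] at h2
    simp only [Bool.not_true, Bool.false_or, Bool.or_eq_true, decide_eq_true_eq] at h2
    rcases h2 with h2 | h2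
    · exact ⟨t, ht, htk, h2⟩
    -- The same path traversed backwards has the reversed word.
    · exact ⟨t.reverse, ht.reverse, by simpa using htk, by rwa [List.map_reverse]⟩
  obtain ⟨A, hA, hsort, hirr, ⟨e⟩⟩ := exists_normalForm hV hs hsl ht
  have hA' : Represents A (graphOfCode n (codeOf n A)) := fun a b =>
    (codeAdj_codeOf hA.symm hirr a.2 b.2).symm
  have hU := (hcl.universal_iff hk _).1 (universal_congr e.symm hG)
  have hleaf := search_sound (hsearch _ hw) hA <| by
    intro ks hks
    obtain ⟨⟨p, con⟩, hp, rfl⟩ := List.mem_map.1 hks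
    have := List.all_eq_true.1 htrees _ hp
    rw [Bool.and_eq_true, List.all_eq_true, decide_eq_true_eq] at this
    exact exists_extends_of_isIndContained hA' (hcl.1 p this.1).1 this.2 (hU p this.1)
  obtain ⟨g, hg, ⟨e'⟩⟩ := exists_of_leaf hn hleaf hsort <| by
    intro ks hks
    obtain ⟨p, hp, rfl⟩ := List.mem_map.1 hks
    rw [embedsFrom_iff (by simp) (by simpa using length_of_getElem?_spec)]
    exact exists_extends_of_isIndContained (represents_graphOfCode _ _) (hcl.1 p (hex p hp)).1
      (by simp) (hU p (hex p hp))
  exact ⟨g, hg, ⟨e'.trans e⟩⟩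

/-! ### The invariant -/

open Classical in
/-- One round of colour refinement. -/
noncomputable def refineColour {V : Type*} [Fintype V] (G : SimpleGraph V) (f : V → ℕ) (v : V) : ℕ :=
  f v + ∑ u, if G.Adj v u then f u * f u else 0

theorem refineColour_comp {V W : Type*} [Fintype V] [Fintype W] {G : SimpleGraph V}
    {H : SimpleGraph W} (e : G ≃g H) (f : W → ℕ) (v : V) :
    refineColour G (f ∘ e) v = refineColour H f (e v) := by
  classical
  unfold refineColour
  congr 1
  rw [← Equiv.sum_comp e.toEquiv]
  refine Finset.sum_congr rfl fun u _ => ?_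
  have := e.map_adj_iff (v := v) (w := u)
  simp [← this]

theorem nbrSum_ofFn (n g v : ℕ) {m : ℕ} (f : Fin m → ℕ) (s : ℕ) :
    nbrSum n g v (List.ofFn f) s = ∑ i : Fin m, if adj n g v (s + i) = true then f i * f i else 0 := by
  induction m generalizing s with
  | zero => simp [nbrSum]
  | succ m ih =>
    rw [List.ofFn_succ, Fin.sum_univ_succ]
    have h1 := ih (fun i => f i.succ) (s + 1)
    simp only [Fin.val_succ, Fin.val_zero, add_zero]
    simp only [add_right_comm s 1, ← add_assoc] at h1 ⊢
    rw [← h1]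
    change (Bool.rec _ _ (adj n g v s) : ℕ) = _
    cases adj n g v s
    · exact (zero_add _).symm
    · rfl

theorem hashAux_ofFn (n g : ℕ) (hs : List ℕ) {m : ℕ} (f : Fin m → ℕ) (s : ℕ) :
    hashAux n g hs (List.ofFn f) s = List.ofFn fun i => f i + nbrSum n g (s + i) hs 0 := by
  induction m generalizing s with
  | zero => rfl
  | succ m ih =>
    rw [List.ofFn_succ, List.ofFn_succ]
    change (_ :: hashAux n g hs (List.ofFn fun i : Fin m => f i.succ) (s + 1)) = _
    rw [ih]
    congr 1
    simp only [Fin.val_succ, add_assoc, add_comm 1]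

theorem sqSum_ofFn {m : ℕ} (f : Fin m → ℕ) : sqSum (List.ofFn f) = ∑ i, f i * f i := by
  induction m with
  | zero => rfl
  | succ m ih =>
    rw [List.ofFn_succ, Fin.sum_univ_succ, ← ih]
    rfl

def loopless (n g : ℕ) : Bool := (List.range n).all fun v => !bit g (n * v + v)

/-- `nbrSum` reads the digits of the code, including the diagonal, which `graphOfCode` ignores; the
loop check reconciles the two. -/
theorem hashStep_ofFn {n g : ℕ} (hg : loopless n g = true) (f : Fin n → ℕ) :
    hashStep n g (List.ofFn f) = List.ofFn (refineColour (graphOfCode n g) f) := by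
  rw [hashStep, hashAux_ofFn]
  congr 1
  ext v
  rw [nbrSum_ofFn, refineColour]
  congr 1
  refine Finset.sum_congr rfl fun u _ => ?_
  congr 1
  rw [graphOfCode_adj, CodeAdj, zero_add, zero_add, eq_iff_iff, iff_and_self]
  intro h huv
  have h1 := List.all_eq_true.1 hg v (List.mem_range.2 v.2)
  rw [bit_eq, Bool.not_eq_true'] at h1
  rw [← huv, adj_eq, h1] at h
  exact absurd h (by simp)

theorem invariant_eq {n g : ℕ} (hg : loopless n g = true) :
    invariant n g = ∑ v, refineColour (graphOfCode n g) (refineColour (graphOfCode n g)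
      (refineColour (graphOfCode n g) fun _ => 1)) v ^ 2 := by
  have h1 : List.replicate n 1 = List.ofFn fun _ : Fin n => 1 := (List.ofFn_const n 1).symm
  rw [invariant, h1, hashStep_ofFn hg, hashStep_ofFn hg, hashStep_ofFn hg, sqSum_ofFn]
  simp only [sq]

/-- Refinement commutes with isomorphisms, so `e` can be pulled through the three rounds to the
constant initial colouring, which it does not change. -/
theorem invariant_eq_of_iso {n g h : ℕ} (hg : loopless n g = true) (hh : loopless n h = true)
    (e : graphOfCode n g ≃g graphOfCode n h) : invariant n g = invariant n h := by
  rw [invariant_eq hg, invariant_eq hh]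
  refine Eq.trans ?_ (Equiv.sum_comp e.toEquiv _)
  refine Finset.sum_congr rfl fun v _ => ?_
  have key : ∀ f : Fin n → ℕ, refineColour (graphOfCode n h) f ∘ e =
      refineColour (graphOfCode n g) (f ∘ e) := fun f => funext fun v => (refineColour_comp e f v).symm
  change _ = (refineColour (graphOfCode n h) _ ∘ e) v ^ 2
  rw [key, key, key]
  rfl

theorem nodup_of_distinct {l : List ℕ} (h : distinct l = true) : l.Nodup := by
  induction l with
  | nil => exact .nil
  | cons x l ih =>
    change band (Bool.rec true false (memNat x l)) (distinct l) = true at h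
    rw [band_eq, Bool.and_eq_true] at h
    refine List.nodup_cons.2 ⟨fun hx => ?_, ih h.2⟩
    rw [memNat_iff.2 hx] at h
    exact absurd h.1 (by simp)

/-! ### Counting -/

/-- The list represents every class by `hc` and no class twice, since its entries have distinct
invariants. -/
theorem card_quotient_eq {k n : ℕ} {l : List ℕ}
    (hu : ∀ g ∈ l, IsInducedUniversalForTrees k (graphOfCode n g))
    (hc : ∀ G : SimpleGraph (Fin n), IsInducedUniversalForTrees k G →
      ∃ g ∈ l, Nonempty (graphOfCode n g ≃g G))
    (hl : l.all (loopless n) = true) (hd : distinct (l.map (invariant n)) = true) :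
    Nat.card (Quotient (treeUniversalSetoid k n)) = l.length := by
  let F : Fin l.length → Quotient (treeUniversalSetoid k n) := fun i =>
    Quotient.mk _ ⟨graphOfCode n l[i], hu _ (List.getElem_mem i.2)⟩
  have hF : Function.Bijective F := by
    constructor
    · intro i j hij
      obtain ⟨e⟩ : Nonempty (graphOfCode n l[i] ≃g graphOfCode n l[j]) := Quotient.exact hij
      have hl' := List.all_eq_true.1 hl
      have := invariant_eq_of_iso (hl' _ (List.getElem_mem i.2)) (hl' _ (List.getElem_mem j.2)) e
      have hnd := nodup_of_distinct hd
      refine Fin.ext ((hnd.getElem_inj_iff (hi := by simp) (hj := by simp)).1 ?_)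
      simpa using this
    · intro q
      induction q using Quotient.inductionOn with
      | _ G =>
        obtain ⟨g, hg, e⟩ := hc G.1 G.2
        obtain ⟨i, hi, rfl⟩ := List.mem_iff_getElem.1 hg
        exact ⟨⟨i, hi⟩, Quotient.sound e⟩
  rw [← Nat.card_eq_of_bijective F hF, Nat.card_eq_fintype_card, Fintype.card_fin]

theorem universal_of_certified {n k : ℕ} (hk : 0 < k) {ts : List (List ℕ)} (hcl : Classifies k ts)
    {l cs : List ℕ} (h : certified n k (ts.map fun t => spec t []) l cs = true) {g : ℕ} (hg : g ∈ l) :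
    IsInducedUniversalForTrees k (graphOfCode n g) :=
  (hcl.universal_iff hk _).2 fun t ht => isIndContained_of_extends₀ (represents_graphOfCode n g)
    (hcl.1 t ht).1 (extends_of_certified h hg (List.mem_map.2 ⟨t, ht, rfl⟩) length_of_getElem?_spec)

/-- Adding isolated vertices keeps all induced subgraphs. -/
theorem mem_treeUniversalOrders_of_le {k m n : ℕ} (hmn : m ≤ n) (h : m ∈ treeUniversalOrders k) :
    n ∈ treeUniversalOrders k := by
  obtain ⟨G, hG⟩ := h
  exact ⟨G.map (Fin.castLEEmb hmn), fun T hT =>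
    (hG T hT).trans ⟨SimpleGraph.Embedding.map (Fin.castLEEmb hmn) G⟩⟩

theorem le_of_mem_treeUniversalOrders {k n : ℕ} (hk : 0 < k) (h : n ∈ treeUniversalOrders k) :
    k ≤ n := by
  obtain ⟨G, hG⟩ := h
  have hp : IsParentList k (List.replicate k 0) := ⟨by simp, fun i hi h0 => by
    simp [List.getD_eq_getElem?_getD, hi, h0]⟩
  obtain ⟨e⟩ := hG _ (hp.isTree hk)
  simpa using Fintype.card_le_of_injective e e.injective

theorem order_and_count {k n T : ℕ} {l : List ℕ} (hT : l.length = T) (hpos : 0 < T)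
    (hlow : ∀ m ∈ treeUniversalOrders k, n ≤ m) (hu : ∀ g ∈ l, IsInducedUniversalForTrees k (graphOfCode n g))
    (hc : ∀ G : SimpleGraph (Fin n), IsInducedUniversalForTrees k G →
      ∃ g ∈ l, Nonempty (graphOfCode n g ≃g G))
    (hl : l.all (loopless n) = true) (hd : distinct (l.map (invariant n)) = true) :
    treeUniversalOrder k = n ∧ treeUniversalCount k = T := by
  obtain ⟨g, hg⟩ := List.exists_mem_of_length_pos (hT ▸ hpos)
  have h : treeUniversalOrder k = n := (treeUniversalOrder_isLeast k).unique ⟨⟨_, hu g hg⟩, hlow⟩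
  refine ⟨h, ?_⟩
  rw [treeUniversalCount, h, ← hT]
  exact card_quotient_eq hu hc hl hd

theorem lower_bound {k n : ℕ} (h : ∀ G : SimpleGraph (Fin n), ¬IsInducedUniversalForTrees k G) :
    ∀ m ∈ treeUniversalOrders k, n + 1 ≤ m := by
  intro m hm
  by_contra! hlt
  obtain ⟨G, hG⟩ := mem_treeUniversalOrders_of_le (Nat.lt_succ_iff.1 hlt) hm
  exact h G hG

end TreeUniversal

/-! ### Tables of the universal graphs and of placements of the trees in them -/

namespace TreeUniversal

set_option maxRecDepth 20000

/-- In this and the following tables, the graph codes are distributed over `31` lists by their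
residues modulo `31`, which is where `inTable` looks for them. -/
def table1 : List (List ℕ) :=
  [[0x0], [], [], [], [], [], [], [], [], [], [], [], [], [], [], [], [], [], [], [], [], [], [],
  [], [], [], [], [], [], [], []]

/-- One number for each graph of the flattened table, in the same order. Its hexadecimal digits,
from the lowest upwards, are the images of the vertices `0, 1, …` of the first tree, then of the
second tree, and so on. -/
def placements1 : List ℕ :=
  [0x0]

def table2 : List (List ℕ) :=
  [[], [], [0x2], [], [], [], [], [], [], [], [], [], [], [], [], [], [], [], [], [], [], [], [],
  [], [], [], [], [], [], [], []]

def placements2 : List ℕ :=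
  [0x10]

def table3 : List (List ℕ) :=
  [[], [], [], [], [], [0x24], [], [], [], [], [], [], [], [], [], [], [], [], [], [], [], [], [],
  [], [], [], [], [], [], [], []]

def placements3 : List ℕ :=
  [0x120102]

def table4 : List (List ℕ) :=
  [[], [], [], [], [], [], [], [], [], [0x8018c], [], [], [], [], [], [], [], [], [], [], [], [],
  [], [], [], [], [], [], [], [], [0x6006]]

def placements4 : List ℕ :=
  [0x43024103, 0x32014302]

def table5 : List (List ℕ) :=
  [[], [], [], [], [], [0x60e060816], [], [], [], [0x80e203e], [0x62224, 0x608020408, 0x2040610240a,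
  0x2040810100e], [], [0x20002043850], [], [], [0x20e103050], [], [0x1e2828, 0x2180a0c, 0x80c223a],
  [], [0x2020c083006], [], [], [], [0x6102448], [], [0x6100072], [0xe10100e, 0x20408182238], [],
  [0x60c182c20], [0xe023804], []]

def placements5 : List ℕ :=
  [0x26535320165214, 0x615404236154310, 0x613026120543102, 0x461035463062103, 0x14262643054216,
  0x513204651054326, 0x512045604232104, 0x512065406232106, 0x145321423065432, 0x415025214365102,
  0x615406304254310, 0x14353610243215, 0x605434306254103, 0x264103406265410, 0x432102635165403,
  0x254303052154316, 0x132051625043205, 0x25431432065423]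

def table6 : List (List ℕ) :=
  [[0x1002020103f950], [], [0x603004020100f014, 0x804000000e0200803e], [0x2008040802e11004],
  [0x2010080381f010, 0x201002010282f940, 0x804010060e04222120], [0x6008100286208170,
  0x6028140106230108, 0x800018040980826088, 0x802008120401008048], [0x6030040201003884],
  [0x8020086a089c2, 0x20000000e320fa], [0x60d01209090, 0x181e008042a82c, 0x200008070040a1a6,
  0x8040100803014100cc], [0x18030421e802, 0x1c008600c034, 0x8040883a1d088, 0x10080e0120d058,
  0x4000000205c010f2, 0x4020100482421104, 0x8000001c0d06030160], [0x80200016050281006c,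
  0x8040200c0c04208110], [0x202002000000b9a2, 0x40200a0506022108], [0x6010040206638024,
  0x80002000040202b81c], [0x200e0680407910, 0x600006080082409e], [0x380202070051a0],
  [0x2000000502434190, 0x6030020100822002], [0x802000000c05c00930], [0x8070400e982,
  0x2030180c00c10048, 0x80000808028002b8a2], [0x18080200d87c, 0x180201030248b8, 0x4008100d8080b80c,
  0x40200400000038ec], [0x202004050280011e, 0x80000000000442f0e2], [], [0x6030080201209058],
  [0x10088780600e, 0x201a000441d870, 0x6000020080037864, 0x6018040984822100], [0x200a0e0000780c],
  [0x8000080c0600201028], [0x2028080205011840], [0x8060e01801838, 0x200a010002b88c,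
  0x600006020240c02e], [0x4030180601218080, 0x8040000a04020048e0], [0x280a01002149a0,
  0x3000080200387c, 0x80000000098202e948, 0x8060100603010288c0], [], [0x40201a090200b802,
  0x8000000604840010f6, 0x8000000e0900410918]]

def placements6 : List ℕ :=
  [0x843260085321852640754860754062874321, 0x438751028716307541204531751402874326,
  0x547630834210467210872410786104543210, 0x408132135402016432642813831764754302,
  0x768041046531302541385762625840765431, 0x437061064321370821067435806753864321,
  0x617054417208103654057623236450762108, 0x425163437516142706508732723405875316,
  0x542176715408431756465203467230542108, 0x806253258403240715703614641870763215,
  0x218376452106134506845106548730752106, 0x435076574326305826702431857021874326,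
  0x876452438712764312456870706543875312, 0x768250856430682310324871718523765430,
  0x502164075213560713045213831640875213, 0x327650028764317520812530816503876324,
  0x856410358210843510361820536142875210, 0x328170605417845326178326362471854107,
  0x708321826501083541482653748235654201, 0x526340167304231540150872516472876304,
  0x758431518403876403564803703465842103, 0x825473518203245103751206574062872103,
  0x548360865410732410824710824013765410, 0x326584316508523108731508581372654108,
  0x652180643217156437053217605371432108, 0x863254463217104827846320178450863217,
  0x415286165208013764237604237461765208, 0x753210704321257641854321854167643201,
  0x436285725108201437682437681473652108, 0x435172174302351802057436502361874302,
  0x647581584321605821041758587204864321, 0x527631807614268531085321631580765204,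
  0x743186643210356710764215768152743210, 0x403265264105432715136872136270876415,
  0x846370516207645107537840518042632107, 0x326185674325216745768401675410874325,
  0x613082765412107642678540376240865412, 0x876510354201483501807653537082654201,
  0x826174246317102437067824603842654317, 0x753210508321275641634807870563864201,
  0x658740836520578320483521847215654320, 0x824351816435680712127430812703764315,
  0x746253657403726803841502486520875103, 0x328460465320718520412750586412765320,
  0x417520643210156420672810852764843210, 0x537281785431372401287650507824865431,
  0x215476572106145806740213574031872106, 0x317620486502613852430652625143876502,
  0x738051057321380621847631840613765321, 0x528760675321247650345620760543875321,
  0x742086762108470853143725752814632108, 0x527631517603624703547603547302876103,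
  0x215463462103154703503847874650762103, 0x504176473206384721582731582174753206,
  0x874263218703742103250873731254876103, 0x627541746321605421853720854702864321,
  0x317420248316352716863520867205874316, 0x215486843107028437071826268470543107,
  0x653270124307613750860415687451843207, 0x728651216405672305321407807123643105,
  0x648750836420478320583421857214654320, 0x547081065421673421278543721430865421,
  0x438075538206031857187435357812843206, 0x607541536201075321586201721685643201,
  0x658370826510538210287413543782765210, 0x658174126504631204835624835421765204]

def table7 : List (List ℕ) :=
  [[0x20600381082103c6, 0x60040f8008382018, 0x2003008003e3820c8, 0x1001c04807800600c040,
  0x1c00200c01418c060024, 0x200a0200400f6112086508, 0xe01800400c0d8046010086,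
  0x20040100300200000960fe1aa, 0x200401601200400806012c430, 0x400001401804a03009602c250,
  0x400200a01e030046028050620, 0x600000000c00c00018c04614c, 0x6000006010012024190070182,
  0x600200402001004001010e12c, 0x600a00a00400e010020226190, 0x200000000800004200217a104188,
  0x200000001000c01802010e062284, 0x200000401a01a0300140c0180098, 0x200000a010018028048024100304,
  0x200000e00602600809203208008a, 0x200600c008032044088110216090], [0x3000408200e3ea5c2,
  0x801c000000172102058, 0x1001007a07000c02e070, 0x1200207e0e000411008c, 0x1602000004200c0267ba,
  0x200000804204a0802f210a, 0x201002000806e040204270, 0x80180060520440880906b2,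
  0x20000000200400de0822060dc, 0x200401202002600c024048118, 0x200800802a07a00a044302510,
  0x200e00600c0400401020ca090, 0x400000001000402c106344218, 0x40000040000260820403720e0,
  0x400200a0040080901a01a2330, 0x200000000002e02202414206c228, 0x200000000e0000400800083dc520,
  0x20000000100020000460742007be, 0x200200000400001002010815c146, 0x20020040040220220400b0160318,
  0x2002004006010060008182320028, 0x2002008004022044054140068440, 0x200200800802a006016038012034,
  0x20040000000000020221fa066406, 0x2004000008018028050108142062, 0x20040040100200160800422424e8,
  0x20060040080100200c005c0c4440, 0x2006006008018030040182060402, 0x200600c018020040080182094434],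
  [0x100100f80020620f0, 0x3e0020d60440281e0, 0x1e0020440e00a0092054, 0x1e00800807000e204438,
  0x200c008044002012064068, 0x201a0100700080180300a0, 0x80000000060840c81dc406,
  0xa002004022084108190160, 0xe01401807002004008e062, 0x200400800005008000c1047c6,
  0x400001000800e02c104108110, 0x40060000020120281ae00a044, 0x400800a01e02c0380a20420c4,
  0x6002000016012028082228104, 0x600c0180020280460c4102210, 0x200000000802a002004160050104,
  0x200000200400001208408416e506, 0x20000080040100380fa02a0d4208, 0x200200400600800808000213c006,
  0x200400400200a034080112224248, 0x200400800000000001205c3fe188, 0x200400a00001a0020040280a20d8],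
  [0x800805c09e06000a210, 0x20020140660ac0021040a0, 0x20060020000001ce380198,
  0x600201c004090118248090, 0x800002007e02001a160010, 0x800203403800a122244580,
  0x800e00e00008a0d4028444, 0xe01000e00801a0600c4208, 0x2002014016010012140280738,
  0x200a0140080100a00ce340340, 0x40020040000000de110198688, 0x600200400807009405c020112,
  0x60020080040400561203ba282, 0x600a01400a012010092084528, 0x200000001401800801401c250020,
  0x200200200000400809015e10644c, 0x20020040080080220ec082248014, 0x20040000000020220240280504a0],
  [0xa0140d81fa0020e2, 0x40040060040601dc240004, 0x8010008022082142174102, 0xa0140380500c0100006014,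
  0xc00001804a0801001ae0c0, 0xe0020240300f8126030480, 0xe00800403001002021012c,
  0xe01a00600801602000230a, 0x400800401406e012024308710, 0x400801a0200220600120243ee,
  0x600000003602409004a010480, 0x60000060000100061800246fa, 0x600001802201c00c0120a4440,
  0x60020040000120581c4294504, 0x600800600c022004010082104, 0x20000080100200120fe00a10201c,
  0x200200000002004c0a0198242540, 0x2002002008026014046042102290, 0x200400600201200809a0f4202024,
  0x200400800e00000807010201c068, 0x20040080100220400840c4246018], [0x201c038002018214468,
  0x180320020f2054006082, 0x200403600402000400c6ec, 0x400001001c00217e2440e0,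
  0x40000240400800601bc140, 0x400802803004010200a5ca, 0x200400c0300060c0190148290,
  0x200800001002802011e010086, 0x200a00000002e00218200a068, 0x200a01202c0280460620c0688,
  0x200a0140000120801043f6068, 0x400200c022004008030342218, 0x400600c01001008000c08010c,
  0x400c01801001008610c164420, 0x600000600601003004801c608, 0x2000006002004006000064246098,
  0x200000801000200407807001a1c0, 0x200000a00002a04008000e220362, 0x200000e00202402c0400260a4492,
  0x200200001200200000c00806459c, 0x2004008010000048084110238314], [0x2807c08000e170324,
  0x1a0340180f00200c0006, 0x4018004030060188380104, 0x60120240480101e61c8048,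
  0x80040160420a4048160090, 0x800603201005017e012304, 0x800e00007a0401062281b8,
  0xc016024042030060304092, 0xc018038060006140204044, 0xe00000000a0e0028064104,
  0xe002002012030028382088, 0xe0020040080d20480e86c4, 0xe004020014016020390090,
  0x2004018028048090100002502, 0x20080080300100061f2142084, 0x400400200400007e184004012,
  0x400800800000003418c082084, 0x40080080080060040082087ee, 0x600000003c01c002104108008,
  0x600001201202a0000800201ae, 0x600a00c0080720e00480900e0, 0x600c01400807000e014018030,
  0x200000001000c0420021ee032204, 0x20000020000220580b0120144400, 0x200000200201804404000435e242,
  0x20000040180020700440c80c4622, 0x20000060120100160c00d2030060, 0x200200401400c0500a0006000106,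
  0x200400400400005800611c208230, 0x200400401600201a04801002010e], [0x1803c02010e2081c0,
  0x200000a00804200a3aa448, 0x20140060220080900940d0, 0x400a01c0380381e02602c0,
  0x401801c068008082104388, 0xe012024014034022048214, 0x200001a0240540f0082104018,
  0x200001c03400000c0902fe512, 0x200400803002002204e0e020a, 0x20040160200080101200d00cc,
  0x200a0000180140ac048080292, 0x200a01403000e080002302600, 0x400800401c0180c80c0032300,
  0x60020000140140c00402e2160, 0x600c00803800200c020072120, 0x200000000c00400e066106244018,
  0x20000020100280000de00c0041da, 0x200000800400a0180040081c6012, 0x200200a00a0080200c6104110220,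
  0x200400001002000c004032024736, 0x200400800402400c066012024210, 0x200400800c01402000c104208418],
  [0xc0160a800c0847c4, 0x1a0020180f404e00c022, 0x40120020140060100a0638, 0x6002004030092158240060,
  0x8010008018058042094018, 0xa0140060080580a0202034, 0xc00202801804202a2280a0,
  0x2000014004018030160290320, 0x200001a0200140080502062a8, 0x200200000004004e1f8070116,
  0x200800602005e0d20a4028050, 0x200a00a01405005002420010a, 0x400000e0200400fe002182488,
  0x600001c0080100200e60e04a0, 0x600200000a0140a01401a6390, 0x600200403005806802808e104,
  0x600c0080300300161b0180300, 0x200000000c00c0200400103ee502, 0x200000000c02600c018110310300,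
  0x200000800000000007e1c410a360, 0x200200600c01602804809010e422, 0x200400800200402800c1800c2188,
  0x200600c00a0020100c4088140600], [0x601c06208601c100462, 0xe0240400000e600e446,
  0x1203c01a04c00a0142a0, 0x601200401c0e0018046090, 0x80000000300ec0ba024098,
  0x800803800e062018070410, 0x801002003800000e1107e8, 0xa010002034076082204408,
  0xc00000c0320180180e01d0, 0xe004022048076088224448, 0x400200403e0080060c8200036,
  0x400800801006003a102022028, 0x400e0040020100200c828e1a0, 0x60080100200400c41020980f0,
  0x600c01000204008a1022d8420, 0x20000000080100300500181c0582, 0x200000001400a0200401ae252304,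
  0x20000040080200320d808016a308, 0x2002004008032050040034304206, 0x200200c00000c024058098140312,
  0x200400800a00000a0300440422a4, 0x200400801000203e00202201a0a2, 0x200400a00a0100160c2004008426,
  0x200400a010020016090120002142], [0xe008044020110220230, 0x1602400004a014028708,
  0x201801c0420a40a20b0160, 0xe00201800401410204a210, 0x200200000006808003a0806fa,
  0x200400800004200c0021107e4, 0x40020140280680d0120012780, 0x400c0000300000000160fc1c0,
  0x60000020220000080be2022a0, 0x20000000100200020701e01f4016, 0x200000001002004002003e102112,
  0x200000800e00201c0421140240a2, 0x20040080020300600a0140142700, 0x200400c01001a0100901042084d0,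
  0x200400c0180200400c016c084770], [0x407a0a201403c634, 0x1000201402416234c042,
  0x20080040200500523807f8, 0x201a00a0040c000c09004c, 0x800400802001e19e182284,
  0xa01c0020220c00c01806a0, 0xc01401a0020821f4042084, 0xc01a0060140c00580301c0,
  0x200000c00a02800a18a082084, 0x200001c02001e00c018340140, 0x200400000207c006090202230,
  0x200600e010072054088110680, 0x400000003e0020d80cc2100e0, 0x400201800004a0c4148210684,
  0x40080020300580141b2082104, 0x600000003e01203401c30002c, 0x600401801c03c0c0006102204,
  0x20000000000000000be0e02b4490, 0x200000000800a0020ba002048090, 0x200000400002c02600c14203000c,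
  0x200000800a01004206008012e280, 0x200200000a0140280501083a0120, 0x20020040080100120400322144d4,
  0x200200401002c00204400e032430, 0x20040000040080420720440a6380, 0x2004008010002034058108210058,
  0x20060080040220220c218004a642], [0x604e0c0020020726, 0x80100040801000de284,
  0x20000040540000223b4680, 0x401002001e0c210a208240, 0x600203e00a08a010012724,
  0x60100000000e602219c414, 0x801000803c04000e2ec430, 0x801400600800a0b0192040,
  0x200200801c0020041482300d8, 0x200800000c028078018060380, 0x200c01800a01a042088022212,
  0x40000000300100da00a06e210, 0x400000800807a0220a2264012, 0x400201000800206a1b8180110,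
  0x400201000804005800c17e402, 0x400600800600006218c108210, 0x200200400c00806e09010800a014,
  0x200400801c02204400410200a184], [0x5800e01830078c, 0x60020040f61e0210228, 0x160000600060083ce260,
  0x40080000700a003e082428, 0x60120020400e600802e08c, 0x601200a0500040120a0058,
  0x60140000000081ee1044b0, 0x800600004404c090018660, 0xa0100100700700421800f6,
  0xc00403c03200c098018030, 0x200a0080000020120a42fe688, 0x400001201c042070018210214,
  0x400401003e03201400c018600, 0x6006004008030020186048368, 0x200000200a01803008c114140280,
  0x200000201201a04e048090048140, 0x2002004008008042044034204202, 0x2002004008038064012010114210,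
  0x200200800002a0080280440885d0, 0x200200a00000602c00413006008c, 0x200200a0040100280840901204e0,
  0x200600800800000003e10203e0c0], [0x400e0100201940406d8, 0xe01c00008211c02c440,
  0x1a0000280901602501a0, 0x200402803401c1d2280500, 0x400c02002e0c0180180320,
  0x600000400609a0d820241c, 0x601001a036006024248044, 0xa00a00000a0c20a8150112,
  0xc0100120600a01402100e0, 0xe00400000c0101840940e0, 0x200000202800a02006018275c,
  0x200400000001a0cc042044600, 0x200a00000a0600de112104208, 0x400c00202a024048050002342,
  0x600400400804804c0a0082104, 0x200000a01002800c018038140186, 0x20040040160220440480321201c2],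
  [0x140020c81f42882a2, 0x3e0160060200f0704, 0x201c048006118390062, 0x40200120201b61b4098,
  0x40000160420640483904e4, 0x400c00e06205014a094128, 0xa01a002004028110314254,
  0x200200803200205017e00c0a4, 0x400600c006002008024244498, 0x400800002200403c106104238,
  0x400c0000000200400381321f8, 0x600001800805a02006010c140, 0x60020120080100280a033803a,
  0x600601c00a01003000c0e244c, 0x200000000802c0440000420185ca, 0x200000400000802a0000802844ec,
  0x2000004008024000092124228540, 0x200000400c02200a088114060420, 0x20000040100320700601903204a8,
  0x200000401c01800c070082104600, 0x20000060000040200aa074054228, 0x200000800000003e020006242022,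
  0x200200200000004009c0bc03440e, 0x20020040000000240fc03800c4b2, 0x200200a014022022098106210420,
  0x20040080040000000160303dc04a, 0x200400800801004008816221a450], [0x80020120941040243ae,
  0x100240700660261b2082, 0x100260520441881902e0, 0x1e02004000c08608c060, 0x201800200c00c1c20b01e0,
  0x401401a00e08401825051a, 0x600e0260040861100184c0, 0x601200000808010420236c,
  0x800601202408801c086444, 0x80100180500201800040fc, 0x801c01c03001010c230078,
  0xc00c02c0220200402001de, 0x20000060080660840a000a014, 0x200400800800009c0642ea022,
  0x200801000e02200410800e52a, 0x400801000400401808010013e, 0x400e00c0040080001220dc4c0,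
  0x600000000400401619e092194, 0x6008000020014088110300030, 0x200000001001e0220c400e0121f0,
  0x20000040120000140020201b6028, 0x2002000004008056030060102192, 0x200200000600c02002002020647c,
  0x20040000120000000100280c87fc, 0x20040080080080040080701ee026, 0x200400800e01204400c09000a066],
  [0x20080080101d201a708, 0x1c00400209000206c726, 0x200003a06201404e05804c,
  0x400600c0480a00403be208, 0x400800005e00011003601a, 0x80000020020840643a03fe,
  0x80100080040f800a14e038, 0xe0100100100200403480fc, 0x2002012024002090120086290,
  0x20040100020000c206a10a414, 0x400001a010004046018030310, 0x40040000020040100ec2260c4,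
  0x40040040000240081003581bc, 0x40040060020400400802c03bc, 0x600001201c0680c01a021041a,
  0x600a002016028092032240480, 0x600e00400404004001002013e, 0x20000040120020080300200b80a0,
  0x200000801000804204001a02039e, 0x200000a01200c028054000252284, 0x200200200a00202a04408830c106,
  0x200200201000001005e10000800e, 0x2002004000020020082170114260, 0x200200400801002009810c014710,
  0x200400201601a02c0380300100c2, 0x20040040060240200141de092224, 0x200400c00a03001a080100046602],
  [0x20220000141f204a350, 0x40060040221ec006780, 0x601202204806202a040406, 0x800a014018030046206084,
  0x200200002000004804824c7d6, 0x20020040100020840043ee506, 0x20040000200000880821121f4,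
  0x200600801000802213a2c0014, 0x20080040100460421180c8014, 0x2008014002004030090060530,
  0x200a00802004400001a15e402, 0x400600002000806804420477a, 0x400800801c00003c01c018438,
  0x60020040040100040420aa748, 0x600200802202a082104008202, 0x600a00a00c00200c0a4044280,
  0x600c0020140480900502501a4, 0x200200200400601208000008e3fe, 0x200200a00200000a0560540580b0,
  0x200400000000204401203c1d8442, 0x200400201001404202004037e240, 0x20040020100240480c00b2300548,
  0x200400800c02204400410201a092, 0x20040080100000400060281803f0, 0x200400a0080200400861382a4404,
  0x200600000002002208a1240481d0], [0x201a0000140061940b004c, 0x40000240500820da002012,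
  0xc00401807e032004102210, 0xe00200800a0381141820a8, 0x200201800607c00600c088400,
  0x600601001406005800e120240, 0x600801002000005e042108228, 0x200200a00c000008048090110270,
  0x20040080000180280300f00700c0], [0x1800c0000f201c004012, 0x201002002e04000208a414,
  0x800a0100200c01500800be, 0xe00200403000e130010094, 0x200400002e00c02611a090120,
  0x200801400801001603e302204, 0x200a00a01400002010a048094, 0x400c0100100200e6062064308,
  0x400e00a00a0180700a02400a2, 0x60000000120600d804201001a, 0x600000202a0220841082582a0,
  0x600000a00a04a01406a2120a0, 0x600000a03001800801037e022, 0x600200401004c024002098602,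
  0x600201800a03002a0e808840c, 0x200000000000c0180841042607cc, 0x20000040120180200400061a21a4,
  0x200000800e0220040320f0082044, 0x20020020040100280501481200f8, 0x200200400801000e0401061c4348,
  0x200200a00400805000209a0842c2, 0x200400000800204a010004396042, 0x200400401201a002012008010056],
  [0x803e00207401a028610, 0x60000060480f4130060284, 0x800000005803c0a000a7e2,
  0x800600204200c094124248, 0xe0000000160800840067f2, 0xe00200801401019200c092,
  0x20000120200500c0180088580, 0x200401e01200407218c120402, 0x200800000c000022024336652,
  0x40000000100420040321f03da, 0x400000400202c032192220240, 0x400401003e062084048004320,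
  0x400800e00800405401c038440, 0x400c00000000004001e0fc060, 0x600200003c008004058038448,
  0x6002004008016038046010706, 0x200000000000e0420b804410601c, 0x200000200a01003004008009201c,
  0x200000401202a00800e01c0a0350, 0x200400000002007e0880060e0240, 0x200400001000404007201a024056,
  0x200400e000024008018030012494, 0x200600400000006e01c08400a11a], [0x40080100980b037e700,
  0x1202003a0800180147a6, 0x200403e024004048368498, 0x40040280440dc102384608,
  0x40080040560000000a65cc, 0x600c0020220600c0050602, 0x601202402002c02624030a,
  0x20000020280000481a42dc062, 0x20000040140440040083406cc, 0x400800001406604a04e088110,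
  0x40080100000000401de142132, 0x40080100140000000fe03e200, 0x400c0080000460f200a114208,
  0x600000002002005c1840fa012, 0x600c01801000804003c102420, 0x200000a0140100000e0044090130,
  0x2002002000002064004008166012, 0x20020020020080460141420a0140, 0x2002008008014022050114188310,
  0x200400000000004c07c02812840e, 0x200400a00402406408018034006c], [0x1801004a02c1801081ee,
  0x1c00204201803c070328, 0x600203e0020140c224c050, 0x801c00207200600c086090,
  0xe00400601001004a3240d0, 0x20000000000500801000721ec, 0x2004018030002040080088090,
  0x4002012034030082002300600, 0x400201e020014002012034274, 0x40060000000200521bc130106,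
  0x600201203800a0e2042098160, 0x20000000000060100861c01fe026, 0x20000000040100020a004816e192,
  0x200000200000400806e022222304, 0x200000a00401600c050032080084, 0x200200400001202408008205c780,
  0x200200400800602001c088290114], [0x1000e0180801041fe228, 0x1003601c07804000c40c,
  0x200200a0040d01ee00810e, 0x201800000000605835804a, 0x8004032002034028314710,
  0xa004020074046036028050, 0xc0000080100100383bc05a, 0x20000020040660c0044088380,
  0x20000180000520201fa062184, 0x200001800a02a0c0004140280, 0x200201000000605e070284118,
  0x200c000000054042004018160, 0x200c00a0120160c2060320640, 0x400000002007e06000800e2c4,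
  0x600000800201208e0a2014028, 0x600001a00a0420c010034058c, 0x200000001e01000600801800e5c4,
  0x200000200201a04e00801408c250, 0x200000200800a03000000020e6bc, 0x20000080020180400800e6122044,
  0x200000a01402804805010420e504, 0x200000c01400004a0e4016104208, 0x200200201200405200a14604a210,
  0x20020080000100500a0130230540, 0x20040040040200040400802de5a0], [0xa21241f8070,
  0x201404400612000834e, 0x80220120881001d629a, 0xc0200040861ec240066, 0x800601202400801038010c,
  0x801002003808204004236a, 0xa00c0000000a60121182c8, 0xe00200c046010006160086,
  0xe00e0060060c40e0042084, 0x200001000e04801417e012684, 0x200400000000800e018084672,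
  0x200400200401001014233c210, 0x200a0080020020aa0823120a8, 0x200c0000120220c007010a640,
  0x400000001c0700480041e201a, 0x400000c01405e084066048090, 0x400c0040300200c8104240450,
  0x60040100120400100ec02604c, 0x600c00600400801008824c062, 0x200000000600000200c166112440,
  0x200000201a002034040052212240, 0x20000080000000000680821f8520, 0x200000e0060120480300c0042580,
  0x200200a00800000c018124150084, 0x200200c0080100500c00801863e0, 0x200400001402204a06012a2c0580,
  0x200400800001a044080100086150], [0x20680f604e0c404e, 0x160340480500081c2180,
  0x1e0040140c01e400e034, 0x400202605800008200a74a, 0x4004006070006002018014,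
  0xe008030012024058088060, 0xe01200403a000022072498, 0x400000002a0440780062040c2,
  0x400200c018002014044084484, 0x400c00001a0000fa082104110, 0x600000000000c0dc06e0840a6,
  0x6002010008014028028310220, 0x600c002026018030036042402, 0x600c01000606008010001e01e,
  0x200000000400802804c0e0120220, 0x2002004018014058064084180220, 0x200200800800201e018018220440,
  0x200400000a00002a0020920a8110, 0x200400000e010024042084140626, 0x20040000120020420821c2242488,
  0x200400200a0280080801aa20a114, 0x200600000e014060040080096290, 0x2006006004026018022044088708],
  [0x200000fa0843e0050, 0x60300200020900245d6, 0x1002000a0181de380086, 0x200000a06200205037e04c,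
  0xc00a00c0180181223841c0, 0xe01000200c01802818c004, 0x200c0020040080800040f818c,
  0x4000000006028078002014492, 0x600000002002a0801000fe1c0, 0x200000400000001808e0401c047e,
  0x200200001000c0100100200686fc, 0x200400600200400801012e0e81c8], [0x7e084188264528,
  0x40300060100120d27bc, 0x403c00201c19c014190, 0x802001e068140108214, 0x1000006008008a2401f8,
  0x801401601004809016841c, 0xa00a00600a0b20280d0282, 0x200400802e06000414601001a,
  0x200401002000000607c30222a, 0x400000203401204400803e128, 0x400001000c00005800a30a3fe,
  0x400201000e0340040320642c0, 0x400400603000000e19c020050, 0x400800000002000a0181f0406,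
  0x400800400807e05a024048220, 0x400800c00400808e04222800a, 0x400c00400400805800202a67e,
  0x400c0080000000661102fa042, 0x600001800400002e0580280f0, 0x600200c0100140280500d2484,
  0x200000000802e0000be082188498, 0x200000200400804209e00610410e, 0x200400001e02401c068058028050,
  0x200400600000803404809830c222, 0x200400600800801001a034070090, 0x200400801000004004210a1927c0,
  0x200400e002020044004112244410], [0x800000007013035800a, 0x1002003e08209011218c,
  0x20000320160340383080a2, 0x20100100680900a01604a0, 0x6002020048070120054046,
  0x800c00200a0001de0140c4, 0x800e0220040020ea144404, 0x80100060000e6032018700,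
  0xe004030064088140280048, 0x20000100240220aa0240481d0, 0x200a0000040360a80500a0700,
  0x400401800c00600000a014628, 0x600200400600c0421a0340088, 0x600200400801a020012092628,
  0x60040080200200060003fa0e6, 0x600801000e02208208801002e, 0x200000000003e03808408a122038,
  0x200000000402c006004088386440, 0x200000000802203c0640c01802c0, 0x200000200c0100200be04214a024,
  0x200000800001e05200600c0e01a8, 0x200000c0080020320520e0180300, 0x200400600400802006000208a1f0,
  0x200400600c01002002001017820c, 0x200400a00000e0300680500a0010], [0x700fc01c0e4688,
  0x40000040f60683800c2, 0x80000400881000303ac, 0x1400000200c02218a798, 0x1802403a0000ca202404,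
  0x200800e03209a10c004208, 0x201e01200c06a094282140, 0x40100020040b60122c0132,
  0x401e0120240480022e0184, 0x60180380200121c2042300, 0x200601001a0200c0180128700,
  0x400000203600a034082092340, 0x40020040180300b00c22100c6, 0x40080000120240480f0180280,
  0x200000401001201c028030012340, 0x200000c0100120280080c2144340, 0x200200001000e04003e0821040ce,
  0x200200600000600809a024048290, 0x200400001202007a08c100244486]]

def placements7 : List ℕ :=
  [0x7a546904976210a15687354a187087549104a187608721536a519870453971094a15639876210,
  0x824507356a9803465298142569839845703652a9819876512546a98314587038125640a987603,
  0x540831a817653281a3760503298176a8432062a981a098432762a98108a6542603a1847654312,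
  0x1865a7406872136a4798504a6983984061306a72142198547a06721354086138574a609876213,
  0x832791605984161735a9207359869870516174a9029031724305841630876243716920a985416,
  0x948a7266754103678054a10a2976548620a762540a7154a80612540a489a61296780a49754103,
  0x856130210a98475102a934102a938419302510843280a9624a93840261298579642015a985407,
  0x74a2530a587431a6238703a62879872a5306a5873075642036328759634a905705a6248765431,
  0x3a7094127a54362795a4052794318730519a058719a487905927a4362307519a041972a875436,
  0x10a982385721040958713a958713719a82309287137150932a58721357a96327316095a752104,
  0x13a98674362105a096217a34821721a430534862172130976a486215031a748390a8718632105,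
  0x679183060a95127130a989752630a967102175a9084190875630a95251486309806471a954102,
  0xa3256110a9438a26143502614354302915a294315a6435296019435275a3083592670a964308,
  0x6a4510214a76085a8432165029417651408130a76832a78147485320a6953205a86213a976408,
  0x2584a619653207804632190463213248a6108a63213250416946a32182594165408a12a653207,
  0x71495629687532691387049138708749632913875287a5403103a65204976527034a96a876532,
  0x1a8940761543026a90547374296a4396102a6154078796a4296a54328963102a907483a543102,
  0xa10875635a42196704218603521821065487354218a721865635421810a8635a670481a754219,
  0x43068a7745310936a7508163982051263097205319823197a76a510986254396395872a543109,
  0x2851a031095427865a403965a403a416203862a403408563295a4203916a2039a568109854207,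
  0x8201759048532a07953218079326320894670453263287915879432681094264079512875432a,
  0x79456a032987615246870395a7608745a6023a8760769250a53a8760974530a9524607a987621,
  0xa50931257a631275964309406872879031240387124351906906a87254a92065912304a876312,
  0x7a569136098724052187365218738765913059871387a06316219873a576321a605937a987104,
  0x216973015a872415673208193720a82190356a9803987563a720a983621a9038307651a987524,
  0x7453a1621a98705a6194335218768735a16421a8765487621321a876759632176a52439875410,
  0x67a840345762017854963a8549636094521930a7519675830a54960328a94037854392a765201,
  0x98a7540286541328746509a1372894a28138749650a07285372865132a0841387405a19865413,
  0x719864a817632584a63297810329328a61581063293274a963297410a897215296a4817643215,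
  0x68a942089654135a127601892640769a4205a476207651a04912764086a910289204a59765413,
  0x5187063a59210480362171894a35218a5040896217a387954a359214a8751045a679809652104,
  0x2306a911275304369170a269170a7016324365710a9370a65921750a732a8657a089639753204,
  0x524309739651073981a04432165765439073216507a365821421965753084218932a40a965107,
  0x7480a917165203642a97184239718547103463a9716251940a716503a9486538a240958652103,
  0x73842513a765213a8675087069349203a51286953475a280683a9751480972128a3450a976521,
  0x436a98092854373a29540a61854054a69803a89540546210862985401a06437a3740918654327,
  0x6a893412876405a9037610a236417629431a94763176a09142037641291860582a9416a876405,
  0xa7265802587431250897636712054306751769430a8743a692057431326a850769a0529875431,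
  0x713a4626587410a93487251a6742873a6421a687428795324a568742173a52672439a19875410,
  0x7628531a95430152a94386a20431436a901a207431a5438206207431276a819a2513869754301,
  0xa310645548321971684308716a4521a085630852164321608a45821607a85167165403a843219,
  0x645a02305742194a23876250371687a031650387168742a61203871675a620350361a48754219,
  0x5481973149520a739840623981065072816735840697406359285106381542a4173982975420a,
  0x839762738610589a710239a71021093762896710210a8926a376102813942689a7340a863105,
  0x694a30145876029a83761854360176a430154376017698a108437601a6584139a013459765302,
  0x63875108564319850143767398254308a1973982056543701439820536a7201a850173a654319,
  0x5892730718653a82176509217650652973082376506581203917653092475309705482986531a,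
  0x430168206754390628731a718542540186231865427354218a186542074a2184260a318765439,
  0x4621a780a6543932a0761210a5485412a7832a7548605481720a7548413820a6178a23a765439,
  0x4619520157642a15027693692540760182951876295476902302876964193026981504876542a,
  0x528146059876235048a231a365407689540506a82354a2306106a98318965405048321a987623,
  0x891367024a97650614a932614973a910743607a9438694307214a97321387609342806a987645,
  0x543082115a97064a3852174028519745102a39710270a8329851970234591025183a40a987506,
  0x8214a76a0987236a13542169354098a4213258a976209864710a9876178a54052476a19872103,
  0x18a5403a48210678504239586a3442571038714203a3758467589426a574103a4317859842106,
  0xa17589449732164870215048721621749058492105a8105498073216453860784a6150a973216,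
  0x874a50264873017a359823645802732640164598029873a2043598022a684317a025469874301,
  0x6921a8791732054918a674a258603269105945a8671032a878604325a69210549187a27432105,
  0x6729150057432879503216950321326940179432013275914a943201a296510a7950127654328,
  0xa15928452876105248619631054276342102487619a2619485427610359a8246913a42a876210,
  0x2398104357210438a27140914a366289104380721471a3840a36710439a52149142a837652104,
  0x10768548395102978350639785149168a02063a74850a7863514a73896174389784560a753102,
  0xa4893294a3107a85910248591021084932a83910210a58235493102a148623a856021a543107,
  0x7a2194514973080236a413a169753051a7802976453074529623a7487a25316a145920a974308,
  0x15a3842538710956a8412053481270153246a732043086a478127304a15732456a82408763109,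
  0x6197a208643150271435935a702437961502a4315704352a92a431507986159651720a864315,
  0x25638a0539760153a07682861a5376a540135476086493a80a537621693852468429a39764301,
  0x706985151a64036815a097684509a082549684a50961a0984215a40902698746817a90a642103,
  0x82437a9a36540123a96475741a23542a901201a879a287631a2365418275401479a3209654301,
  0x718340984721068490213158a7092198506a307546217493021a7409938751658490317542106,
  0x593a4820796541a73465209a8542653a84270865425497a28a086542935a2089a734259876541,
  0x391a670a864325a816430a127430431a7609a7643043821068276430a1093259a816039864325,
  0xa29865358761049637812a904528a789653127a65381a6327528a60459231042853690a876104,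
  0x2479813058621319468074076213a297613076a213a980746405821302974364913870a865213,
  0x571093278954326703a926918430a906532765943243a9108718543210695321925670a985432,
  0xa08456226831078526104a462985984a3072a198079831a524269837384a652852a1409863107,
  0x93a2761387650483269711326a04802175432597049753216216a80418a65328325a719876504,
  0x658a4139462107948021a9084213218950708462136450a319846213510983463495a06542107,
  0x871a402419870657a09421a3498298a140275894029873a2031498025a1840257a02419873106,
  0x429801309542172856403a856403649810328164034052831a564103a9861039036582a954217,
  0x913a7653496218375621a973021a2135648730621a9721a56930621a5a3941843756a19764218,
  0x470a932175430806a3542160943254a093260954325461a23109543236721097a609249765438,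
  0x7421a9026975432a095417268541546098126895415420a187689541042761862a0914a976543,
  0x670345210a9728104a7536352904a91520473a9204759043a652a90419365427352610a976508,
  0x520a94334862012a436095a43609605a8392a863096042a985438609456a97869072a48654201,
  0xa942530267410845627131923a507159203450721371645309627103794a526456a7319764108,
  0x4678154283105371a8264a6230530a421547198054396a716423105604a7519a624739832105,
  0x469083798654320a9854716035475409837603854754a19781038547469710360a9874a865412,
  0x76034a154a762971456235204a716501a2371a6523746231a504a76982751047140236a876429,
  0x4a7813594321059a8321579a063564783059a032152198a50a70643597843059a835176432105,
  0x143875046a97128507a934106a93a904812846a97351a9307546a97381943069370584a987612,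
  0x1378521a85402a1758463179402407385217584028491765739a4023a695174683971a985402,
  0x62489012376501458276a482376176843012a695015076a82423760148a96016a345809765301,
  0x6290548937642a1395648695a10276095483957648109852a913764a809632a8593120765432a,
  0x675a8210684321859732a507432198a062107483219832a5475463215a086215812a709864321,
  0x81452a159820715a2984015a9839810a6351698239850a4250a9863014a863842a5169865207,
  0x2a4185069853276948320a0276493214850948532010649576495327104a9276948051a985327,
  0x862513008a5427a65381046538109824310a69831081a560954398106249310a653012a985427,
  0x26985a780532148095327891a3273298a5768a5327321097510a5327692871a68095726532104,
  0x174a983458721045a8213845a21621a497054982132175a3885a921678564397a549319875210,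
  0x2604a980796215649830a14658327184625465830a3084975307961508476254982370a976215,
  0x7593816297541029845134298716a937648534a96851a9834829751023796485316892a975410,
  0x927341874521067481523035a948a937418231a94852948318745206037a418748a5329542106,
  0x65349251976082451763a451763765291302976134061329a519763064a53163154209764108,
  0x329647535961083576102a267435a923508208743510a57261087435724a9089457620a965108,
  0x601495a197650319a5804412576a764195a025976a1076a25425976a618a4256a912049876503,
  0x5487912719530a3806512571a860957061238965125130829406951278542064712980954310a,
  0x425179070a63191287a65a219740a620735123a76581a6523807a635a105423a564821a863109,
  0x4015a633498102056381a456381a8153402059831a6081a59643981a104a7591a876509864102,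
  0x6521a474198203415098626835418254703147980654a68135419823a6421032a741509872103,
  0x7645231049851a65318420653721987041253198429850321731984264751038240356987643a,
  0xa824630309872526039848625a3198167342679834a698403985a6304a6821584760a19872105,
  0x875041269874130124a954012a968409612701864281a9524a96841250298735628370a987413,
  0x9184720139762031469758413a90a948320142a9702197546813a92032985465783142a976320,
  0x8a0163495a863295068349607a318619532597863465a3107905a83285a41079506431a876532,
  0x320765128654316082957072843196a283127564319243a7520854317a096313a572809865431,
  0x1659a325876310a584639623054876258105847639a1769235487630529861069485a2a876310,
  0x637a05445873293a261048a2610410a86543a561041032a45826510487a650470462a38532109,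
  0x691803294a6302983271068327106418302983a602a085974915a63218754323894701a654302,
  0x15809328765314892365082a7654a108932503a9126591203a875314820751478923059765314,
  0x468a20390652176a092184a0921821a49586a592182160a854095218641a8356a032816542107,
  0x539a824429763103a7948205497897403213069748539780652497689a085249842a309765321,
  0x2350a91a5943268719430209185a8510326178543643a2109a789436a70532671a56309854326,
  0x391582096a41089520a181968320a129608596410840769253207618329a6483a86952a764108,
  0x814925968320a84257695843761765480a913820a76824137693205068541348a0591876320a,
  0x492053173a94282513a907413a909217648752a94871a9852713a92869471037514890a964328,
  0x3594a21a9652079a125048a974306538204a126504a3654128126504980a3219a130459865107,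
  0x894a172935420693725418a725415489a06146987354307125469873981a406a938214a543206,
  0x762039a859431a23a98608165432976231a609743a9143205865943a73186256087a32975431a,
  0x652a30132865075a9386145a083186a23015a086318695a109238601582a41081649a59865207,
  0x469582098743201652840916a420845172016a8420845160a513a84095187209802561a874320,
  0x6830541539842a35148207514820986742051498209865104714982027365418026153987321a,
  0x8a139203298764320976183257617603a84325976182761098259761310a864a320916a987624,
  0x429031801654372018a934017a936508327027a9834165983a934217908542759381026543217,
  0xa50789102643197520318075261a43a57196a14308a543820439a502687a502752a1837643219,
  0x510862a039854706a4981506a9829805a3260398429865a1465a9832501a832814a6039865437,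
  0x92087610496325283a10703a79613201645825a1076274a83a04962518094251683a409764325,
  0x143896590a64124809a157486915a183965486a915a140856309a6150138756a739084a643102,
  0x5a628303287514a1685309a23850859a7301a785308521a07923875065a920350861a29875214,
  0x95843014096327286a901586a9019085a31283a901906281365a9301184952754013829653207,
  0x9012385027541a0285413731a80274806592067549809342a802741a61298352069431765421a,
  0x926018302a941752089134027631a960813208a9136350217502a91706584174520831a984217,
  0x963582148962076548a914038921a953821038a921a964512438a92159043186521830a986207,
  0x945126025a96474182a905182a90a951620416a92086a9314852a96035196205209341a986547,
  0x26149076893207915360465182079245a07640a927a930418618320726175436407915a983207,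
  0x5261908964320a1089437673a810651730a973520a4350879810643a817532a8973a21654320a,
  0x90473a55386102435a107a4356191045a820718659a0869715436102746a9354359170a863102,
  0xa170942a86541304296570a24653650a813a246513a4657292048653807a94257924019865413,
  0x136790269541028370942469287a54781023819402948732587a954267891028370296a954102,
  0x672a51441873207a143256a14325326a8457a843253271a5861483259a2651496458a78763210,
  0x25093145763214a5916346034a98639a2145a2631463a9547a98763409a3214a5914308763214,
  0x3a96210a853210298a716a498310214a850295a7167182965a987310a396407a6102948753210,
  0x7319560064321839602157960215217940539421052163954a942105a197650a3960517643218,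
  0x2075a3679321047a6310592681051067924798310510a2653a983105756920497a6350a932104,
  0x30195a4618730209a4715609a53487634159a487158796a54a348715031964a7516a90a873102,
  0x16752a654320a65a2817065a813907652a872950a8150a72813520a186954a8719a56954320a,
  0x2897a6485a3201859a6240876a24326850124a53097453960867a32189274068590642a753201,
  0x764580182763096a487312a4873173a28016a087317364a104287301472a51071356a47643209,
  0x7a5342832741063284105a8291051083945397410610728547294105358a706a328450a742106,
  0x607293a7564308102396a67582104317508579643a21a7908210965871a5308579a3209654308,
  0x67395a26273104350981a16849503196204352981a3081a52709821a659873468a90538732104,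
  0x159438045a32164793210a5482102194830548321021a7903a483210904a51654793018753216,
  0x910a8253297614a238760395876076a3814064a5327692508764a5325a0961460832a19876214,
  0xa75463006984217856a302743a60a95742187492039486532a609423057a421a065874a986421,
  0x7193460928530629458312136740719a645940a8368390415a26741517932062940781a853206,
  0x4a8136a15430761a25483a1654954a6328063542810428633165429130a982482a1605432107,
  0x8a14370a452109a4702131a63870217a6034a621032154730870621383a5419574a6316542109,
  0x951342002865175a649201a64920812a60453861045261438920861439a8604a5320419865217,
  0x159a8457821035a48219546721321457035768219a0219486572103105974675a4891a872103,
  0x34209a592a7431408973520897357320a9540a9735847350a829a735247650a7536804a874321,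
  0x40a1582a576409a528601a325769763a50942876016054218a25760913a6549a5230168765409,
  0x358a927a29431751863208a51407438a217a51940732918068514327539a8069815a209643217,
  0x1265490a39421853a74102095a63916a74025974104132509a63921856a974025364019743218,
  0x42839a5865310a2195764021a8468024519321850976109457685109492630a6459123765310a,
  0x2437651365420847a32090748316a491608475320962a4715a635209710a96347a3921a654208,
  0x2530a613974208395762123a8650a24576193a7621a290517406a721345a76121a3950a974208,
  0x2673a521943052169a0862794054067a35279430531a0869621a40503287693617a80a943105,
  0x18a62468521031a965040683a7120768131a265045091a4298652046a78523869a1759852103,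
  0x192a46085964139a58410842596a712a6405a674104195a068259613647a8259a524019765413,
  0x96450216873201a7483252a91648324a901652970170325486489321a4592019a748529873201,
  0x46075a3248610967a310547a3105104783567831051072a53a438105752640942a7850a864109,
  0x14a75237298510723598a83507649837410726985a2198a357629850837a4168a532749854210,
  0x150a4860485213a9042160a74213210a5435a842162195a68704821306795135a904619854213,
  0x6174503687210a75302146759104105687a75921046521430659210484765036357a14987210a,
  0x915326018976207546a1341369709743a201369720a672538518a96059143064570a31a987620,
  0x290617401a97234105a962105976a904753147a9568195647205a97671862059650148a987513,
  0x51789409754216816a9302976834a587940184a950932160a834a72698375168167903a754216,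
  0xa9045820598317943a652143a6526541a82948a652659342831a8652104a852943a2509865317,
  0x98a4603a69210358409632513a47624510358276039654832a479213a456103a6304859762103,
  0x4316250128543786391029a12540a89053668791024283605912854734a91024021a63a854327,
  0x6953a41849620761482058234a618031a2561a820594a0532814920756983146143250a964207,
  0x769a01550643286a15437190532743a052790543274361a72105432739a710590572a66432108,
  0x7a819305a743268213750784651a75189302897530a39481251a9746180a7464821a50a974326,
  0x97a1453409765278046538a4065165a8943a4076516570839a04965395a8410a439871a976502,
  0x59a8769875104a398106a92710610a98765a7810610329683278106590a6275a398608532104,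
  0x94120731a653271a485390598a2465403271036527a25394841a653751294089301a42a865327,
  0x427108a126540370a8921621840a547180a218540a9240a18618540a427a6184a076919854203,
  0x5362a7005943186a074321327a504306972a697432a5432071079432356210750a6923a954318,
  0x67a02916497328a219740504632132509617096321743210954693210a59621a2164079754328,
  0x6a3512597610863957024631502703a51263175027096321a957102a0643216395274a976108,
  0x5028743a5641092734108562a1081032a4862a4108751083452a4108063852a62734807654109,
  0x27359865743201758643907589264320a69586a4395043986826a4392a765087580a93a874321,
  0x817a32608543260915437208671543a08261a284364392a7510943260a7832680915739854326,
  0x1570a82a7865437a28650a419650651a743419865065a1208a198650a10754312a73509876543,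
  0xa84615005843298750321a75032132a740187432013285714a5043217a64201a014786a854329,
  0x83952719465107294783043578216589407921650765a1830821654738954174921803a654107,
  0x1205a67483210948a3625048a6171054829253870a6280a53617830a451873a48a76528632109,
  0x371692410873254910876a91072672a193534287069370642a108725392a61076019439873205,
  0x356a84257843025760431a3108769815706a5798124387610a109876538a6108675a419874302,
  0xa8143766a421058476213a07621321a096347692132140736a769213a9864078470931a987215,
  0x5943612a685107046a913a046512a924813048a9136598321a269807350a42693126409865107,
  0x541067270985138407652a407652951076284976526580429a07965241a97628407261a985103,
  0x2a3791604982150a7192601749837082634a04921698a173470498251a8630439617a0a984215,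
  0x368a45215876306a5298416a543276219306a798249865a47215876013a972484915a69876530,
  0x802a9646472103294610a50a6984105876a946710a9810a46546710a257986429487a07542103,
  0xa246917259310794523168260a97a96853794032169531640425a31742a87618497362a953107,
  0x42758625841037925106829710a102785647851061094768987510a2a6984347925609854103,
  0x16384201a763253402a6896824106241a35347a62830a6847902a7683a9421068a1043a976305,
  0x791520394872039503a121596873745120395087236572a94916870315a640312a49508764203,
  0x3675a219264308705243190524314357a2107a43214360512952a43173695126507a13a643208,
  0x2480953986542a89356403815760769143a23576406492305918762a26831052398140876542a,
  0x7203541976420a23658710365871873054123487518762314605874193075419715632876420a,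
  0x402753925a4319259a870a25987143025190846539876590a871a65927854398073952a654319,
  0x73895a165743021580439671a3094381a096804312753091a61a4309378961a7158093a754302,
  0x2053461547620954807638a546217685a03a54762142a03168547621581a6032145a30a764209,
  0x3752a01487530931a4762584a30176184023107642a376210a84760251864027265a13a876309,
  0x8a6741052a43194625a178625a17a506317463a51784a3701825a31706a8725a752640a843219,
  0x5368920836410769a841213829504193802690841241a6920a38410298564374509a83a643107,
  0x385a1720198634215698a032786a9820534107986a3186a272019864a2085348a651239876314,
  0x317065976532147695210367a210219783467a5210216390573a5210709831487695018653214,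
  0x3514287069532a12786540548327931452a012953a6532748406932a31574084601273986532a,
  0x918a5403874216850421a7386a0497a381650472169521a0453842160a3981638504a19874216,
  0x8154a3057832165a03214857694321057369087216a821403943a876045871675a0341a873216,
  0x9748a06a397105723a106423a10610a2745729a106731062943a9106490a8234a608729743105,
  0x250847109863170953a1262175098620917041a837a360421509a617245a8678532140a986317,
  0x51a8372816543094a3652418753265a8732947653265a9427847653215a842723a49819765310,
  0x2a946531587620a4517691a456238734a20236871943879514157620431a920a453697a876520,
  0x6319508126430a1580439615a970431682751243076543980658432761983273908512654320a,
  0x8392760958643197064323061a954390651231a907a920651a956431029853195a80628765431,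
  0x380a712895431298a573608a543243a07128a174327381a658094312193a60567098a19754312,
  0x634752a409876145a9873645a872874a60154098728765a3965a8702643a702739a5409876501,
  0x153a8408365412380465a0a91732549831280176528165a049016532a8792019a523807654312,
  0x523a17031875265013824a8475108290734507832451824079138724a08941350139a29875216,
  0x9368721674320a67123082671409548710967154093254980721540948697216719083754320a,
  0x1357804583210a95602147560214217580495821042193740760821431576403795841983210a,
  0x4619872137654a13975427139540541798031865405463927739854076321086931824876543a,
  0x58632a062a985483159207315920a96752083a9520928130a715a920367a5209026138a987214,
  0x9526701539740172354068653971976830172a5406734062a523940129586148271065a974301,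
  0xa547981186543057816492578a915421a3057364198564973a8164395a672185782694a865430,
  0x49135021597406187632073962157431506187940654a9320215a97632897469302587a975406,
  0x51a974370654121907653a907653659a74319476536540981a076543a987543a709185a654102,
  0x375841970432194507218a45621821a5439456721840218567503219341a856a7819456432109,
  0x603749534961023459107643a1071053a8243a9107641075963a9107048763a8543a70a984102,
  0x149872539421064825a970397215a981507480a957a942870215a90738195074825793a942106,
  0xa48710243a510207495184863a02a378102470a5127351849643a1028a764231863470a953102,
  0x7058a911943206917432581743253281a4591a43253290854874a325021875425a1980a943206,
  0x93a51621a76304a12630551268748751a0412673046387950526a8747a59612a129053a876304,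
  0x16a7435a063219a073215a684215217a43568432152160753a843215016a854670a4516432109,
  0xa40269339841050639842128a7637621a93429a763847632981a9763102a963428a3609876415,
  0x7165920746321a690241589024154189325693421584639708024315759861a8709351864310a,
  0x64583024a631025374108795a10810459724809632631087454a6102096875a9537480a963102,
  0x7692803197640519846024198703a972438624a93860a9824703a94817294386203891a976405,
  0x5a7342a35410958a31027a6410210a743257431021086a23764310250a7624758a3208763109,
  0x45217a09a765430728651951a7406520a8140a8651659721890a8651245910a5182704a876543,
  0x87906459687423a965104296310482096439a3510495107631048623905a873a965407a876423,
  0x8196a320387415649a802897560381094350287415a841623603a87526987151649a20a874315,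
  0x278a341456320907a432157a43216285431076432132a0716a54632178564318314a70a653209,
  0xa30786125864391805437316720543016578165437a8437162056437270a861a180573a865439,
  0x63814a045a7639315476081547607681a4031a7640a576213854a760124a8698451326a876539,
  0x476913261873056123879640a7398720a3940a8739418792360a8739069431279a0421a874315,
  0x5691a2470a6528709a52464289709765413073a52462a0913970652806574136124a90a653208,
  0x805317a068721a403721a4736215213487a048721a9721536506987a178543651a8403987621a,
  0x2836401438720a86547213654721726340186074217285610534720137596107129865875320a,
  0x243691039852107461980374a81098672104729810987640a43a821036792107461093a985210,
  0x735a920957432169028315469720530642196473218360915a0285410a67431a3146908754321,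
  0x9342a7009865313278a645327a909524631723a961a652748a90852702496314613270a986531,
  0x829a7140675314790621a2093814712063409385147051a939238614298a4062a147908765314,
  0xa41728021a9845436298013629809813a2043a9820986430a612a980317a8203478021a986415,
  0x4867a206a854236a04851578360a5476a232049851a49870260a9853671a4206a02781a985423,
  0x6095381328760405237619523761769583105876318276a5092387613a5986493250a69876204,
  0x714836438520634759817915306a014326915a30698a4715972830649076159186a74a853206,
  0x3a8176061743252a164309a16430431876028764304392807916743083a910630782a19743215,
  0x1059236254310752634092985a17a486107261a4072140963825a41796a87254985261a543107,
  0x23a4601a683209a6108343a79512531a7046a7830462734106257304708a516347a6128763209,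
  0x6a054218497623095276189046217650421904762164a95128047621a928104a590416a976423,
  0x59863196a73016923a5825836017089631583760197a5823629a504509821358a1692a975304,
  0x6014952637510840879621439a7276419520459762a730425319a75210a96436291804a753108,
  0xa92357887962012587963537840a802364a936840a9740a36758640a023a7589378a429765401,
  0x45a689383621098752104a652104105832478321041076542a523104806a54265783407632109,
  0x638a5237651047985102369a1021083a5273a5102107692a93a510232876043798520a765104,
  0x7516280329874a96531023412870981354620895467254608312987a57431027023564987542a,
  0x7215a34198732091a46539470652875192019065436541a206529870154972091a4352a987320,
  0xa4069721a87403150987242761058701a9251a9872a9546271058746160a972a290564a987543,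
  0x9265a340987321435087697603258754a0605287413287650950a876427965076a4352a987321,
  0x6a801520376412038476980a476276805120a476123176984a837652980651269483057654312,
  0x58471026598403412098754168079826a03416980751987206259843428a756a412078a985103,
  0xa213804975210697852031976430a13970623574182071835987a206439a7269784032a752106,
  0x4169a7013a7542368754096875405496a7036a7540548360a987a54010698424078631a985432,
  0x9a17563147320614a03298a46953a91865015087263274a90a148326712a950a4153928743206,
  0x53a861032654106a735192a73519513a4206a453195176a947235419a8965206a781957654210,
  0x37698463a9105362910476291041067984a79810410326487298104a607429a7948638732105,
  0xa56493003865215430869a43086986a420954286095386942a30862965a97426987345a865321,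
  0x213a94062984156a1530913856024163825938641a9281a04726841a3a072151a673909874215,
  0x167a98409632156a092147a0921421a798437982142160a4870982143a174096a849739863215,
  0xa51043214a653814236507a296506521738149653065a4203749653015a72097142305a765438,
  0xa5286784a6109a24810734261071034867a268107a410726548610704573263a24870a654109,
  0x2197581753206178532981453293281406085a3297032985817a326210984529a4780a753206,
  0x50612a44a76309624a301a35476276158094268309768352441a8769168a5246245310a876309,
  0x7805413268710985136040264713a01263485a6304608154a713a604572a6348513462a876109,
  0x9764318705321865a7214a360214216a9387a5321821536407609218913a640365a7419532108,
  0x68390a2358421789a2516a3024165109426894521651a8964a025416931a6028946530a854107,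
  0x4136a8705842193a7821673502162173549350821621a4768a508216431765053a7861a854219,
  0x480a621967542307a2541970642154a062170654215487a12906542187291068a706148765423,
  0x1289507179643017569421857a90a981730756a942a953824517943028197309248571a976430,
  0x71532a318720613a2875a14287587a410614298758730a52a429875017a5425760a349872106,
  0x209561a9432107805163a4a378503259407496321a85a9607850643798a4107496a1506432107,
  0x704a6539275108463510a973210a1093548462510a7610a35962510a074a93294635a07542108,
  0x728a654a2761092a5061802a57643285419a5076197632a458507329287a4052a546817632109,
  0x617a504309851243a198261a385798a45123459812609874560398577a4861287540a19865102,
  0x3107685029831406a1987a20683583a021420698356321758a069834123a50635602719863214,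
  0x5a830913486217804362963a75016203a1780163298462901a43621928a53048045296a864217,
  0x408521a064321a82a1905182a907745821a051432a9032a51907321a089642a82a4950764321a,
  0x621957013a940724685313297650a961307150a947a980624650a93726193079246051a984307,
  0xa6178455496320674531835a0712631542067295386493872a459328571a960a547219a964320,
  0x2407a1309652138471a6304896136578213482a613a6874358096513078a21384713a0a965213,
  0x7206958854210362a4109765810910a584965841091072a94758410906a9758562a4907542103,
  0x19a3862a54320628a74391a80436431a5065a7430952439808107436a195326397a8217543206,
  0xa7325087965108a47965334791086524a0847951081065329739a108423a508358a472a965108,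
  0x83961209184327910243651024364309a2619a4326814360295a4307596831736a5801a843217,
  0x13a28709185426270854a301954a540398a239854a7154a0854a7319402a3194a807238754316,
  0x764319007a8642639084173908418473a0163a8401a897514970a84113587625018263a987642,
  0x937428027986356172a901348920a974820618a920a976108418a92039741083461720a987635,
  0x83640a143982054760981234a8019864a0134a9801987261042a9801386421a81067439873205,
  0x67a053154976320729851a045961960a53170396517496103a459631580a762815a270a976432,
  0x6348a20a176325391a620491a620a689720397a620763180241a7620489a72093820a47643215,
  0x7a9268a27610594a21086a4910310a69234a2710310749866492103476a832794a2807642105,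
  0x570893183954268319420702a531a580931409a531425310972a9531850721a78319029754326,
  0x681740513a86021370a658139a05a019642314a6056483750839a40564097138731456a864302,
  0xa926430309852724039869427a31981453624598365281a4010398566a4921796540a19852107,
  0x471a9504287513190572a690572a7594213905872a6087a42605872aa9476137a240918762103,
  0x385a179a7654308a79651a127430659a830127843065439276517439a928530a8039128765430,
  0x326794113a520806917545274931a53271406a7514759064a931a754632a7142741960a953208,
  0xa73209127a5438276354032765415432961729a54154a76037369541602a9489276304a975438,
  0xa94723003954189730542a73054254a710297154025493721a30541234a76214256973a954318,
  0x7624815968731096418757230946712963069a87159452860946873095263109641582a876310,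
  0x641932085763207458a31418562065913208137620834291a845632016984053185492a765320,
  0x9284016805321a8061324542a860958410a06953273290641860532a78491065724160953210a,
  0x84a73160583216174230a40a28163270516179320a4130a794058316078a64247163a09853216,
  0x746853083752198305216783021a2180549384521a7321605730421a068741948305617543219,
  0x4103a864652109a64721354682132145873a68721321a46386587213075a84613746a07652109,
  0xa12540971a640350948621627a098659413750a64386a0924817a409952a6136249051a864103,
  0x7853021a786524a1058643642a017630524a128654a0864123129654953a2013849a109876524,
  0x458190a876540289a0651489a65365a870298765036594a1094a76538a17542789a0159765402,
  0x1692a5041a87535264a891264a89a842513527a84965a8927614a879816920789a0526a876513,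
  0x9703524427610a73241059324105109364573641057210536836410583095248732450976210a,
  0x496a0732785401a86054328a7403546a70326095415482630a275403964a3279a860349875401,
  0x5670241518730a60418727632541874631206387127190623541873293054217215960987310a,
  0x7926a13a287510842a7137610a42876a210845a7137182435a4297106a498309613a249875210,
  0x8067a24a598201075a984a075983987a6016a59823985074265a982437a86017016a439865201,
  0x741a96081763254819760281976076984254a231093164a927603219a782109706a4817643215,
  0x20851a44a873062418706576a21497518064238706217064a213a70608952135069241a987306,
  0x945738270a93167053a921478932a957832478a932a910523108a93245972189235074a943106,
  0x3967810a198425971a826371a82682a7435974a826829176431a8426932760497108629843215,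
  0x284730a149820643a09871a3498698a140641598079832a703148206248a715870a3419854206,
  0x517a83012865303a24987174253053176201a398508431a764126530154a70647803a19865320,
  0x89a432194873067a31542094283154a81027a054125473a2083154029a8410294213a78754306,
  0x521a3481365420138462a69208136491320384762aa981320813762091a543092a48317654320,
  0x813a0243098215a730984237a986983a2041a298048071a4272a9806172643084037a19872105,
  0x259a6105463210a7963289a5432032a94105a1632032749869543210192a84528697a17643210,
  0xa7825047695104586710203a4876103765458971021065829876a104328a6043586720a965104,
  0x640257350a76414285a639427a53a259601427a65384a6327805a7636409528a369824a876401,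
  0x3429a809476205498062a398062a7619825980762a4376a12830762a91a863589412a68764325,
  0x5a96130a8432107a6421089107638596310a7342102176a087638210796541091057a68543210,
  0x402638132854070a23541a968431542683106854314390618a685431249a618960a2319854207,
  0x695830470a96125340a987640918a945108351a9086391840740a91896587409815346a963102,
  0x6159084485321a198432697a8604759621a405321a6071a48948532a952860491a2640875321a,
  0x71a2640a387415a3248709124760872a6403a6874076312049248760a719204706a3218764315,
  0x8570634a6853215034a762a91403820a631051a74640a7931a768531470852150346729865321,
  0x5297a04a953208219a65479106546579a04210a6549265410710a65439574104a912739653208,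
  0x3597a219465320894071241a0875a4783202139658a365712a49653871954304985721a654320,
  0x45a287114963209a81327352784163452179a632173298a768416327a4562179a817259864320,
  0x35a0926509743158a94367502436435a701502943643a58624368702a537602369a8509874301,
  0x371a0951098736501487a235974a871594a029874a3074a59529874a713a5297a410539874306,
  0x945783073a981241589306032541a975830158a9309864703541963205796126741580a986312,
  0x2465a7341a9820573a98643759809834520541a986729863a7419820634852086a3754a985210,
  0x967012403a98150371a948602914a970214602a914a983741802a91476984029417306a986315,
  0xa729803036542103a46572758a0365a094730965479432875a036528492a80347903829654321,
  0x8291704268750497453219316a847532604315a87432874159268504239a704974a213a876504,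
  0x9325861a398640427a961327a961a952861428a961876352473a9861295731a91a35429876430,
  0x7865421409872385049710a649219756421852974197805126049721a5961046a712509876203,
  0x6189250a654320a195320a597328329a650a14532032a9104a974320a896520a1950287654320,
  0x684152a9065327409832161279406591207045632a94a1207940632714a8607812a5408653207,
  0x4967a206573102a6529415972a4087465026a087127160a93a40875294675029140a658753102,
  0x41a58908a7421680432153804216a75041680472168421509304721678563043516a80a974216,
  0xa9476313185402973154638a1406543a8728a154065493760a315402874a63197061a89854102,
  0x29613509485320368a751268a75175a63209158320758361482a75419a6732079468a28754320,
  0x216a54017543204a173296a1732032a65401a45320853296761743202a596174a867928754320,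
  0x8320715516432a30156278015627620854730465273162704815642781697046729301864321a,
  0x4506a239863107562310a462310a102983a598310a5410a98423810a069a42395623a08542107,
  0x47691307543210a793210a39821654693107a4321021a9705a985210a694310a7930168543210,
  0x493a861a643207a9748512837a56425830718392078592714a163207a589307a9738159643207,
  0x3a568106187430852697a17a65327365410854976a8297a54216974a194653285239a79874210,
  0x24895a12086437851a409649a5218629317853a409814095361a4309603a52185120948643107,
  0x86a512002a64397653a012780a31a327401674a301a386714820a4317a58210a108765a864329,
  0x18a7230a6754032a6381458732106528403a2075437462a89210765381a76036a984109765403,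
  0x53246906087419627953173496508703a6213a8762764132a53a876225374094315062a874109,
  0x64501a31587649513a840280a6137650a1340a7613846130a20a7613685320a6315240a876549,
  0x2a1904710a43269510327a1584273219406594320720a5974a5842074039815a951072a543206,
  0x348910573a4102186740938674094038a7918a7409614098a637a409436985a6815094a643102,
  0x6241509675320a45903216547201324698a547320132659106473201614982a8459012875320a,
  0x8315460419863237149807a568409815640356984084a3506756984018a7506a537140a986312,
  0x915378064a97124657a906138970a953870138a9709741308638a97003695121346570a985412,
  0x1863a20a4982176a02983510284384056176a49823a198302502984361453025a017839864217,
  0xa89250795a4307957081209578134019537820a65781657208136507189a547957a128a654307,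
  0x4859a3136a742052874316893a41745362025a7431a492817963a741568a7315289314a976420,
  0xa56482059a762154207686598a20762590835976084360859a209768346a82068024539764301,
  0x4931650a5764203a51879a915640649a520a328740a687932a157640349a105a3607918765420,
  0xa8490521765302043865941836526541a0218365023065947843a652149a5024025981a765302,
  0x729084193a6104718650232048716097a5217a6502a083925871530492731047189520a653104,
  0x4279a803854216173854097385405497a8017a8540543170a938a54007942162980a71a854216,
  0x309a6528754301789653248965323068741987540a9270a64869530183a942689625a09754301,
  0x657a91324965102479613a4289637265a3842896139451a787246510546a328a1397429865410,
  0xa916430628710514268739426873874960314087638721430926870364a9715a7362419872105,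
  0x971563057964284123a902753960a951630416a930a942106523a96079152037530614a976428,
  0x6081a458753214096532a7014a653206514098532a6032a98869321480675142a569019753214,
  0x104956342861071358209a317942a19450713682095120936a586209a1284351354290a652107,
  0x96a21058064317205143a962831a435281a82643179043a51908431a365a92862051a39643107,
  0x295a431a376420a3147659568321762a9183a9764832765143219768a2596189a314569764320,
  0x6a0948226a3107a98210469821041069324a93210410a89438623104952a6076289350a863107,
  0x3a682173498501726098a36279819863701524980a7580a243249801a6387518a062739875401,
  0x420897506743210957328654a3283256a7806a7328943285764a7328250864a60957829764321,
  0x6179830238541a93085479062547549082719285476354708632854710497624780391865431a,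
  0x2876051049852a3214986768a312980354623598462098615312987a630872a7046532987542a,
  0x651384a1876540253486a61803258632740527864a32a1850325986013287402534a819876540,
  0x8042361617540a43167029026831703965243576027041325916750274986314318720975410a,
  0x651a7808053214170853a83602179576314063952a1053a72860521493187605a360719532104,
  0x9583706519740651849028534a92a938106184a9029071824851a90679583247815302a974106,
  0x64705127586312a40196274a5612860a3124a5961296a0428a75861270a9312975a4019865312,
  0xa608937126530421956380219a37702851968571096310985a375109a2875196837912a653204,
  0x904328118a64073054a129381a42a695412036a412a680524981a64239564129124503a986407,
  0x208a7650a732141896325a8963259150a2418763253291857a967325028a95618756a0a973214,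
  0x582a36a453109524a10674231061074a36523a106541062384a310684076237524a608543109,
  0xa184231476203419865a0419a286081423198765a1076a98819765325481096a509149765423,
  0x6a175407832109a74032657403263257806a78320632a476854083262716540a786051a832109,
  0x903681551432070615a3893821061089437062a53810a3862651a43740398629583706a432107,
  0x6170542698741310428750624873a905713624871387a9652204987390765426257310a987413,
  0xa8372403965104812065a9874a20652870432076543165a2082196549a8310278120a59765104,
  0xa419862625431018264394810a67548a31082654395472a93a625410a897410493a2817543210,
  0x5a8246315986071536a02615380498253041539804a69842065398042816543a204351a986507,
  0x67293897631057983a624a2310810279386239108a61082394721050a784232647980a763105,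
  0x6703948907654291a75430a19548549a6027a695485471a86109654803a9648437a1907654102,
  0x493627038651076983a02a407938a548302695a302a086925938a107249a6179832041a865107,
  0x2469a0861542036a80549261740954817096175409a254980761540346892174908a61a542103,
  0x821906556432172965a486105438a490538293a548a462983605a43841986052938a10a643207,
  0x485213056a72030159a2868234107618203510a72361a2859410762354862035104a82a976203,
  0x629a0179063215094132a42a16073279815098321a6032a71741832a296a74167098a28632105,
  0xa91627964310598a4307198240730a961589643073081a748126407436a9281a896708643105,
  0x204579689732014769a05805932632459760597326a032659859732640286596748a50a943201,
  0x2634512397618235176460a85237602318351a7647693541523a76802496384a09532a976318,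
  0xa15423003975181430752614970275a490214975027531429a309752a7164297256341a975318,
  0x6834a711698320584291a69a15479645320853921a8793a42761932a145632061a35849876320,
  0x5a3627005a4319a67043256704324356102a61430243a76217504312537862180239a6a754319,
  0x4a39821875406183795aa43710240a185643791028495a373189506a1354265a928349875406,
  0x3a1265061a5439a28643012864304321650a25643043a82058165430351762870619a2a854319,
  0xa85043223876591806524a54210375a062481765248375406a327654a672103a247180a876539,
  0x15a27603197658a7065321a43652651a93243197606574a294139652a0542135234a709765418,
  0x87640217385201069a724869a72483642017429801729064598a7524863a754374a9609853201,
  0x183a46076842159734210a376210213a64097642102193706a764210813a7068a973409864215,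
  0xa213490149872514097236739a408710a654098723a47230910487251a763097326140a987425,
  0x8136a2a485107162a983483a602a860953165a983982163542a9853491a60283902619854217,
  0xa93281421a86502148653a537912654298012786539165327a278653432a95092148359876510,
  0x5079a24a7521067a451039a428368794506a428106a5109429428736793a5247a429038752106,
  0x9a5341231986503a7852493126546523a90a78652465a9748321765073594125487a31a986510,
  0x352864589630758469325148a979615807046a9329380426548a93751286079231485a986307,
  0x1627908145320a670832975a0918547920a180532a9165a80870532a179420a76a2981654320a,
  0x5703a4201875460a2487340a28798702416a018759a587324a42871930275167342a01a875416,
  0x678294042a965175896403724960a62894057a9640a293875324a96086732046098572a965321,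
  0x93a2861a497630a4537623a45761765a8304a897617694523435876152a98604a816239876430,
  0x17930867452106749281a5a16934a97563273251064081a929748516170a9321a834908542106,
  0x2739a08136420513a4709413a208861943a794863a7063a94208643a219843a7908a317643205,
  0x94a175337821060a732158415973219a8350a832152170a589738215a49831541537a09872106,
  0x4709532a765431a79354289712058490531793654220a9751a976541a908531a7932508765431,
  0x3481a600397215478a6302416a30924031530a97281097862641a93583421069874160a973215,
  0x965312015976286451a904732910a953210632a9109176302432a91059743027364510a976528,
  0xa5981291876039124765942176376491039a48765107652894a8763925a603a912856a876103,
  0x5370821765432967843204678521a507629784532971a3984804a65965074187815930a654329,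
  0xa71482580a7326790832591803243219a851807324327095a108a325a2198409742581a732106,
  0x750a6810687524716395a39068719531724718953a7695a183068754031972471609a59876524,
  0x17a54205298413752684a152684a980571360498732198a046529843a0587135738a609874213,
  0x4356a201598307362085a1362a408061537620985a6198a20612984734561028a512639854327,
  0x5a190738a76514921065382106536519703297650365829378107653a258310a921035a765204,
  0xa74289009765417290548a29054854a2608726540897548263265408342a980480a372a976541,
  0x836175431987203a679842315874983621031598749863a45215987443682108476a31a987210,
  0x329847046a73252864a309864a30a398740287a430a362807964a730239810730a1682a976325,
  0x504961846521034681709879142a529640a790542a65709818467203267a981790a5867652103,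
  0xa9178545786320754632195463203294870796832132a54169578320419a7209754812a876320,
  0xa852190547320901563284829a1032a540901763284132856a1043298a47501a0156827643209,
  0x854a9104286517490165a1490653651420394286539865a0191065234a3981794235a19865217,
  0x408697293a740105897423589742a46980105a9742a873650839a742546832942a5063a874301,
  0x842a51946973204a173258a193253241760689732584517608467320158a62064a1752a976320,
  0x673a287a621047a8296356321081037a28632a1089610832532a10806785323957a80a962104,
  0x43a981071654326a715409a71540549a8106a854105476a08971854034a97016a801938654312,
  0x30a965109764328a754319a75431439a6518a654314387a16975643103a97158a615909876432,
  0xa02956464721038a4610967a4215605a7198a7610942709516548703829a6548a451908742103,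
  0x60a4593927650142a57638049653769a54104976537682a35a927601a608439635a2408765201,
  0x34a281947653198a0541240a731931047598a654124180a26a4753193a4920542198a08765319,
  0x12349059362108405976a495076861493089a621081076a595407638a5432186a950427632108,
  0x7a54201876320189463250521a893248701a4073219032546a893201845720178946529763201,
  0x596a72345721082354106a35410610a374623741061092a64a547106930a6549a237609752108,
  0x6870a42265310937a21045804a621067524375210410a3745a62510478652048042a73a653109,
  0x84215934698503527498aa6107529824603520984a9675210764980a865a2102538a419876503,
  0x3479520645321a17863204786320639752017563208542971846532073984065786492854321a,
  0x1823a54a287510836a714236a7147132a54835a714867143562a7514287943583691478765210,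
  0x8a74350429831642739801a458309874530a45983098217032159830a874105a427308a983216,
  0xa80243104a983504139826287a4198106354069837a498213a419867102a8658231406a986435,
  0x9172a5618a95047a6832187a6325957180407a985632a9618325a98667192041256a70a983204,
  0x942036140a95374823a919237640a920631406a931a985213506a93124951069132840a985307,
  0x91a5408486532084a26519a4865065a98204a276506543a1294853209a18530984a2158765320,
  0x167a05407653291407329a29510432a075904563291032945a457329a785104a6981408765329,
  0x27964a3236510a2348657075a423103754967541098610975834510902798346759432865310a,
  0x2718540519742678a592018a59209281540784952092a7804a159420791830478a5132a974216,
  0x5a3890134a6502378065148796516583901a80965165a78107496501831a5425108734a765402,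
  0x20164a341a9208067492316749239216a4306a9423927063a714a923721653a7605932a972108,
  0x9645802a9764014820765a843605762430584376059863520a437605980a54392843569876301,
  0x7935840a3764219a387402a38740605a3219a3620894638527406328a75320870459a39764321,
  0x6497a21a965423a9025470472a615410863a128543a654712a096543496710247809a19865423,
  0xa496321854307a93284641863028409526a95842684a396530285461098526a932681a854307,
  0x482037164a87296417a8020a354154207318075431a854107a237541026743180a3146a875429,
  0xa43058118764294081765a08176576a021540276158476502a817625103a629351a940a876429,
  0x927a53003876212475930647593087a09212a687058763a42930876549a76059056a249876321,
  0x2451a30209761320a67149413a2071a2863028761481a9547a209713524910395648209876103,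
  0x869431010a97526410a938410a93a916502467a9039054637614a98254983109308564a975402,
  0x9238071879540178254033825a91a938701825940154a9630325a97163897416287143a975401,
  0x42678a083a94252738940127a8409467a8027a9840943270a638a94069287134091372a964325,
  0x90a65235a82104a532106706295310578345328106951063275a9104a90763235a7860a982104,
  0x698743025a943184039276852937a950327403a92764a9703652a93798076529725840a965431,
  0x5038a140965214a39065737092146583a14075a21465218703095214387a51470814a3a965214,
  0x5760a844593102716a8543708a5493754081694308a130869a549308675940854a6170a953102,
  0x2a0675424631093a657240a3952410a2439a3975248610754524310957a83093a654708643109,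
  0x57a860426951035462918a72650450a27136a197086571840a269503170a426781a6459765103,
  0x63195807a63214a7986500798214625931479362146573908908a21475294087934150a863214,
  0x502a8342753109284310a3284106103274682751068510a438347106385a62754827a08753109,
  0x6a359202198764a83962053127607653920839762076813095129760a6351026025a839876514,
  0xa0259488462103298410578921031078423296410510a98549724103a7586297298450a642103,
  0x2415780718432a45673201567320321587045873203264508617832012495084569302864321a,
  0x7391a2052a8736459a87053128708719a20312a8708743102512a870973510231459a09874326,
  0x2a1930631752043185a0929048317293104a90732671a0985831a204a219865a906781a752104,
  0x72615486574320658432195843213286970584a3213275814865a320618972078569a1a754320,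
  0xa08651958431028591706561943a4365802859743a1043a67519743a56a8302859a7608743102,
  0x9528173396540a31206584937508652370813765089150837437650859284379312085976510a,
  0x7648537a521036247109674210310468537428103521094776a5103058964a8624790a852103,
  0x3597a12638510409a651739a65175196304098651751a0978a36851703597285712a90a853104,
  0x2358106514320a5160438783a651436590815943082143860651743a78521063895162943210a,
  0x526987064753216807329568a329326054168a7329853290785a7329096542146807928754321,
  0x8a0257134976513a2765137246509802751a34765165a7204324965130287513a271509876541,
  0x8a5491053862109576a14a5728109847210953a614a197543a728310485a7029572a419863210,
  0x728a43045973212a5497062a374097a84302a397409752a0385497306a4982170965a29875321,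
  0x7836a0134987023a1098657108469813402a349806a784610510984687365108643a17a987402,
  0xa240981a75432649183200a18546540a7261a7432632a91081087546704a981a1946208754326,
  0x972a8307186530821753a24716506524310217653a9865a43721653042a95105a348219865310,
  0x4976a2314a8203870954179685435467a23190a82354826199705423761a4237a32691a854203,
  0x3951402469830785469016854302a608524916a52490a5416302a65413865249102458a965307,
  0xa042593459810735681026a391021043a67539810210a5329435810740a6329a356820a985107,
  0x149a865906431290a6315490761531a986509863153140a564078615638a9704a098518643102,
  0x492851325a94107981653a790325658741097465133287950879a65028754107981352a965410,
  0xa54783204a65314823657028465165204314096537a8657238046531207a5415732840a965431,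
  0x28475a1128640387a1645a8914056471203870641564a8750a216405795a423a705692a864203,
  0x85a471260873193a068125a0681287406123a786128130a2750687124a8520654127a08753109,
  0x35a7410a876201a8596035639a24723a801759a2046087539a586201543762175840369876201,
  0x390678295a2104968210736821071039624695210710a687293581046a0973568a3570a652104,
  0x2856904938210a17938063179204756243986375498075963204753916274398604971853210a,
  0x5743a06a475102a897103498a1068463752795a106108796584a5106439a5064a897308754102,
  0x693215025a6437298a30162504314358a0198a4301439681a650a43183265103106892a965437,
  0x40961320a743120672951753290a8750a121538706417065390a7432956a74260a9154a874312,
  0x5798a21327540651234093482a513081a4951a4309a574812312740675983125128490a754206,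
  0x5273a8029765417a08623729a85074036512367541a562308a2965412a4310823617a09876541,
  0x143a89256431074a9263854a981230256174a063286394a8052943075a162084a956839643107,
  0x301294663a8107519a4028519436805631702a8619408192a9514307253a6195196420a843107,
  0x52a1780486532913a7650421865065a187021876506543a074187650a524108507a3128765329,
  0x9405823326410a45231085932107109563893241074210856923610809675329380745964210a,
  0x9241685587432a46583215408321971042a564732a3296518508732a942510812a9560987432a,
  0x854670160a98736017a948602974a951724602a97461a9402974850219685429471065a987503,
  0x2a3698121643074a689213a478214382507a47982160539819216407a8943074a521806543107,
  0x873510450a98125041a931504a96a915746057a986a980431104a97665381021396750a987102,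
  0x87251a05698310a5793126297a849345610579831093a8421967a81442586305748032a986310,
  0x962501479831047568a042753a849825104751a804a076541523a98472698047568402a983104,
  0xa16803579432050697318a697318a361405182a9059031862a973218761a405605a781a943205,
  0xa182430309865712309848154a30983150421598046280415a309854625a430840a6129865207,
  0x9a0472356972135a42973524671098042135a197239754a31546971350482135a423709876213,
  0xa14327095a72189537a206318402a6342180a89435a251307945a7186129435a024531a765218,
  0x641098556742134085219a40896521056430857219a0219855087213746a508408a7918764213,
  0x594871046a95134701a985642918a904613642a91875a9801542a91880496539810746a976513,
  0x9762a5105a743836a1205763810543209786382105954361a438210506297387251a63a975438,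
  0x690813201954375a01432510a4384305612a56431261a982350a9438508631298a5621a964317,
  0x2869541568432a579432069753213296541894532132879047654321905862a98a6510876432a,
  0x640752882431094728305a7296534256109861a40965a4982872310917065287491685a432109,
  0x201587442631090538a241538a24a251874057a824a230547318a724651a8746a483507632109,
  0x802a5748432106254710a30a785432a8406547910a8510a478742106923875425489a09432106,
  0x5a28304a953104329a1086a815347582304a80753472a0861a295104a528641a8047629753104,
  0x5374120865321986425108176324a57421068a521051634028765329874a2103468a01a653219,
  0x8647312549810a65438120543812987431254398129860721403981257842038217654986410a,
  0x36a7146753102674153a36928405346902769531a7053a41708931a64895123a967409753102,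
  0x20a785175843294075321a768321327a8514a853213260715a685321427a618a407512a653209,
  0x160537456932185a0321496572142105734657321421a65479573214016954765a0341a763218,
  0x7450a615a98761240687175a3204870296142987612051a43204a873502a9615a19240a987643,
  0x75391205a74210a5927163594870873921059287107154962934a870a635429a592613a874210,
  0x8357a0170986526370981645a8019875a0145a9801984371065a9801516430781a5473a984302,
  0x970835487a96318203a946785934a908531265a9349372845865a93479086459430287a975321,
  0x9428306195420723605489231408546a10823154089354860408a931246a981a236084a954307,
  0x16857202984372563981a1375029806327025a43698a56135028437601a8278136520a984327,
  0x25a13803096547a3085419518320652984130865413265108657832094a8320a302415a965407,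
  0xa695410a87621340a86235231a40925a8134018623a4623015019823859a4105638a049876213,
  0x624a7809865321074532a92a87603290641608532a9732a4590853210a9642160745a28765321,
  0x57892a09165420918465389746506589a2097465206521834871a650259873453a9182a654210,
  0x69287411495320a9852176841327328165098532173294875814a32028a7641a9841729654320,
  0x4690a32a865437618a532918a532a501432614a532865420398a5432901a4329a241609865437,
  0x832196435987649253761280a76176029843089764857610a325876421098642946130a987654,
  0x936741518a94303264a958321945a961740321a94563a9521618a93069387519546237a987420,
  0x893274068974153704a928136942a903642136a94287a9204836a94209183269240731a987415,
  0x8159a0236751045a203193a28714879a504a207614a86192032875143a794205a283918765104,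
  0x6912730176543071a395291a4850642173092387609561a23a948750189a20392506a18765430,
  0xa58942041a5326571432087143203287a4057a4320325170a814a320798a4208402957a853216,
  0x5a9308196a42179018a4389014256203415a346215a862534801642539285018345690a864207,
  0xa1908324a763152401765a694310760281542376153176904a048769209a6156982301a876315,
  0x70a364234876126a50879a30187287a341230187628765a91a01874293a7642a6279038765412,
  0x28706316794205a80362198036216298431a84632162a081490364217986431a803167a974205,
  0x4783a21a697420758a941658a9419456a21752a941948751286a9421846531241a85739876420,
  0xa03954890a52169485213a9467312198506490521721a4835a482107893a1061358490a542106,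
  0xa074935a273106a597106a7923048149706a537106a910653a923106807a942a5976048732106,
  0x54a306149765013491a20243687195a360143675016587a20326987142a97517a026349876501,
  0x951876305a3214586321798632172198a3758a3217216587a963a21708197631736850a965214,
  0x58764196542035741986928640120796437539816546287a986540371852035741682a654203,
  0x25876418695420861495728635475428a3768a95476295714623a547a49831657a8612a965420,
  0x40a6893975420162a8543706954354a698306985435472a387698543a407639438a2608754201,
  0x8471562709321670439284753a96a945216752a9161092843740a92691785439825041a932106,
  0x37509260a943185962a701a0243643059267029436a74360210294363a561023695170a974328,
  0x872094114a7623075621980416296280a19418a765746290a841a62920598412918570a876423,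
  0x2a598109a765039a4560829106587614508a457608a276845210765869482106854a91a765213,
  0x95378457981069a5710435281041053874938710410a25473287104059432839a5740a732106,
  0x286a3150a7439631a7580625a78a760548250a43132a7864205a74870286147852631a743209,
  0x956824a832107a851326a158204325a91615832048091642a583204a54921696158409832107,
  0x4650293528764a32187603519760763184a23987607642309532876a46531096081234987642a,
  0x7503426628510a04625132046817983461704698175298731426981783074265317640985210a,
  0x4823a016975401a26980336275415432a016275401a680327639a54184632178301a26a975401,
  0x759a2302687534a5128706512730871a3205a387208765a0361287301a09764915a3079876534,
  0x936740183a92056270a918264901a976401264a9019432710864a90130286149146273a943205,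
  0x869a20761432073a0521956a082732561073a452192130a949618307698a7506a372958432107,
  0x68a3210a298617a2019835831620980a417a51986762983015019847a68530183102a49864217,
  0x6a371451398402a74598643158069871302315980698a476041598068376415a706513a984302,
  0x904a3714387502431750a8a0241398a43020a598469350a1741385026a1830213465a09875302,
  0x2401a5614a9823156a980814376298614230837615985260a7629843061842380a6514a985423,
  0x519846035421a594621809462182109768597621821549874067218980431a95a1860754321a,
  0x168a954a392104a3802178a60214218a504a609214219387086052149a18760983a5719532104,
  0x9a17654543210890a32161a3695421a543675432162170a639543216071965416457a07432108,
  0x893614564721054690213a79021387364056a072152176930a904215817a930a6975138742105,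
  0xa635971308521756432190647a91213650756832195421968a91540763a51071a864308542107,
  0x964253023a97586215a901745930a924530745a930a961203415a93079241057450326a964318,
  0x28395603487621a534769a435620763a84943576205284906a357620824a30589435028765421,
  0x169a2303476215920376a46a32107639805298763a2176a039347615619a4036a892018764215,
  0xa71420312a87051230874a61970487319046198704a287430a198704367a4197403216a876205,
  0x79614350a74325460a321960a7357396425468a321324061890a743509765189135460a874325,
  0x7a1586453421090653218756421821574380643218a6218537643218578a109a538470a432109,
  0x740926802a76438205a497021a69a610543286a5497254986721a65965481027820594a765423,
  0x2691a84a786325617a324917a3243219a84618a324763241897a8324936a10761703429876325,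
  0x8a6753456321096543a27573410810754286542108a31087253421080768534a728456a632109,
  0xa1027394176538321465092146506529718214765065a39044217658a5291045079321a765318,
  0xa2107383076549302654180265415428709026754154a38163207549a4082164178302a765409,
  0x14795360453218049321676189042197536a75321621a49639045218760a4397563940a543218,
  0x850276125a98732617a908094652a951824718a924a986107652a98405198245248170a987653,
  0x659217007985435270a917460a91a962543528a901a975218207a94329476102534601a987543,
  0x741a5201587320516342a64a375087a152016387209142a63a638750471a6034a209619875320,
  0x4a7628123a9840a6329417632941a751830a68942194a3618523a9806528740a635419a987430,
  0x364a80269531020a698746749102107695274831029810a456493102a37642974820a69853102,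
  0x12950732476103852a1039856a13a195703856a10310825368246103298a703903a258a764103,
  0xa509821127530659217084592a8170a931859371087052983a2173085a794125924780a753206,
  0x2967a19785423971a426a971540a20974371a5426874261a917542306987239710462a875423,
  0x482137907a54362397a810a17439542173902354168254907107543942a91074932081a875436,
  0x1a4538712654096a583170a58317a140832a6983177465a323126509640a8326a587347654209,
  0xa74815665432094165708541620a328160a416320a7532a80516320a248a516780a6147532109,
  0x941786006a43154760a188923647a420615473a1089164723960a31827a98604760921a964315,
  0x693571015764284951760349261076a921049276107654902a517620369a5014951073a765428,
  0x1a6730981543098a7043980724364378109072543643a0762872543613087628a709365432109,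
  0x189376212a43061274308a8067124391206380a75943a5980712a306918a3265127480a543206,
  0x648721331a540947135062713506a58130647a5306504176a213a50657862134713280a542109,
  0x8740a19a487213756a219a8562102154a894a67210762195864a8219418a5064a985708764213,
  0x68194a3a35210789a3214a5631042196304563210421a8940a632104915a64389043658532107,
  0x6240513719852a01359846207854983075420798546198435607985432864078453102986521a]

end TreeUniversal

namespace TreeUniversal

/-! ### The trees with up to seven vertices -/

set_option maxRecDepth 20000

def trees1 : List (List ℕ) :=
  [[0]]

theorem classifies_trees1 : Classifies 1 trees1 := classifies_one

def trees2 : List (List ℕ) :=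
  [[0, 0]]

theorem classifies_trees2 : Classifies 2 trees2 :=
  classifies_trees1.succ (by norm_num) (by decide +kernel)

def trees3 : List (List ℕ) :=
  [[0, 0, 0], [0, 0, 1]]

theorem classifies_trees3 : Classifies 3 trees3 :=
  classifies_trees2.succ (by norm_num) (by decide +kernel)

def trees4 : List (List ℕ) :=
  [[0, 0, 0, 0], [0, 0, 1, 2]]

theorem classifies_trees4 : Classifies 4 trees4 :=
  classifies_trees3.succ (by norm_num) (by decide +kernel)

def trees5 : List (List ℕ) :=
  [[0, 0, 0, 0, 0], [0, 0, 1, 2, 3], [0, 0, 0, 0, 3]]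

theorem classifies_trees5 : Classifies 5 trees5 :=
  classifies_trees4.succ (by norm_num) (by decide +kernel)

def trees6 : List (List ℕ) :=
  [[0, 0, 0, 0, 0, 0], [0, 0, 1, 2, 3, 4], [0, 0, 0, 0, 3, 4], [0, 0, 0, 2, 1, 0],
   [0, 0, 0, 0, 0, 4], [0, 0, 1, 1, 0, 0]]

theorem classifies_trees6 : Classifies 6 trees6 :=
  classifies_trees5.succ (by norm_num) (by decide +kernel)

def trees7 : List (List ℕ) :=
  [[0, 0, 0, 0, 0, 0, 0], [0, 0, 1, 2, 3, 4, 5], [0, 0, 0, 0, 2, 1, 3], [0, 0, 0, 0, 0, 4, 4],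
   [0, 0, 0, 2, 2, 1, 1], [0, 0, 0, 0, 0, 4, 5], [0, 0, 0, 2, 1, 0, 0], [0, 0, 0, 0, 3, 4, 3],
   [0, 0, 0, 0, 3, 4, 5], [0, 0, 0, 0, 0, 0, 5], [0, 0, 0, 1, 2, 3, 0]]

theorem classifies_trees7 : Classifies 7 trees7 :=
  classifies_trees6.succ (by norm_num) (by decide +kernel)

/-! The trees used by the search, with interchangeable vertices -/

def branchTrees5 : List (List ℕ × List (ℕ × ℕ)) :=
  [([0, 0, 0, 0, 3], [(1, 2)])]

def branchTrees6 : List (List ℕ × List (ℕ × ℕ)) :=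
  [([0, 0, 0, 0, 3, 4], [(1, 2)]), ([0, 0, 0, 2, 1, 0], [(1, 2)]),
   ([0, 0, 0, 0, 0, 4], [(1, 2), (2, 3)]), ([0, 0, 1, 1, 0, 0], [(2, 3), (4, 5)])]

/-- Besides the star and the path, the spider with legs of lengths `1`, `2`, `3` is missing. It has
no nontrivial automorphism, so no order constraint could thin out its placements; it is tested at
the leaves of the search instead. -/
def branchTrees7 : List (List ℕ × List (ℕ × ℕ)) :=
  [([0, 0, 0, 0, 2, 1, 3], [(1, 2), (2, 3)]), ([0, 0, 0, 0, 0, 4, 4], [(1, 2), (2, 3), (5, 6)]),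
   ([0, 0, 0, 2, 2, 1, 1], [(1, 2), (3, 4), (5, 6)]), ([0, 0, 0, 0, 0, 4, 5], [(1, 2), (2, 3)]),
   ([0, 0, 0, 2, 1, 0, 0], [(1, 2), (5, 6)]), ([0, 0, 0, 0, 3, 4, 3], [(1, 2)]),
   ([0, 0, 0, 0, 3, 4, 5], [(1, 2)]), ([0, 0, 0, 0, 0, 0, 5], [(1, 2), (2, 3), (3, 4)])]

/-! ### The search -/

theorem search1_1_0 :
    searchTable 1 1 [] [] table1 [0] = true := by
  decide +kernel

theorem exists_mem_table1 (G : SimpleGraph (Fin 1)) (hG : IsInducedUniversalForTrees 1 G) :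
    ∃ g ∈ table1.flatten, Nonempty (graphOfCode 1 g ≃g G) :=
  exists_iso_of_universal (ts := trees1) (trees := []) (ex := [])
    (ws := [[0]])
    (by norm_num) (by norm_num) classifies_trees1 (by decide) (by decide) (by decide +kernel)
    (by decide) (by decide +kernel) (by
      simp only [List.forall_mem_cons, List.not_mem_nil, false_imp_iff, implies_true, and_true]
      exact search1_1_0) (Fintype.card_fin _) hG

theorem search2_2_01 :
    searchTable 2 2 [] [] table2 [0, 1] = true := by
  decide +kernel

theorem exists_mem_table2 (G : SimpleGraph (Fin 2)) (hG : IsInducedUniversalForTrees 2 G) :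
    ∃ g ∈ table2.flatten, Nonempty (graphOfCode 2 g ≃g G) :=
  exists_iso_of_universal (ts := trees2) (trees := []) (ex := [])
    (ws := [[0, 1]])
    (by norm_num) (by norm_num) classifies_trees2 (by decide) (by decide) (by decide +kernel)
    (by decide) (by decide +kernel) (by
      simp only [List.forall_mem_cons, List.not_mem_nil, false_imp_iff, implies_true, and_true]
      exact search2_2_01) (Fintype.card_fin _) hG

theorem search3_3_101 :
    searchTable 3 3 [] [] table3 [1, 0, 1] = true := by
  decide +kernel

theorem exists_mem_table3 (G : SimpleGraph (Fin 3)) (hG : IsInducedUniversalForTrees 3 G) :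
    ∃ g ∈ table3.flatten, Nonempty (graphOfCode 3 g ≃g G) :=
  exists_iso_of_universal (ts := trees3) (trees := []) (ex := [])
    (ws := [[1, 0, 1]])
    (by norm_num) (by norm_num) classifies_trees3 (by decide) (by decide) (by decide +kernel)
    (by decide) (by decide +kernel) (by
      simp only [List.forall_mem_cons, List.not_mem_nil, false_imp_iff, implies_true, and_true]
      exact search3_3_101) (Fintype.card_fin _) hG

/-- Counting suffices: an induced path and an induced star with four vertices each share at most
three vertices, so their union has at least five, and the list of words is empty. The same argument
applies to `not_universal_6_5` and `not_universal_8_6`. -/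
theorem not_universal_4_4 (G : SimpleGraph (Fin 4)) :
    ¬IsInducedUniversalForTrees 4 G := by
  intro hG
  obtain ⟨g, hg, -⟩ := exists_iso_of_universal (ts := trees4) (trees := []) (ex := [])
    (ws := [])
    (by norm_num) (by norm_num) classifies_trees4 (by decide) (by decide) (by decide +kernel)
    (by decide) (by decide +kernel) (by simp) (Fintype.card_fin _) hG (tbl := [])
  simp at hg

/-- The star and the path are the only trees on four vertices, so nothing is pruned and all
completions of the undetermined pairs are tested. -/
theorem search5_4_1012 :
    searchTable 5 4 [] [] table4 [1, 0, 1, 2] = true := by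
  decide +kernel

theorem exists_mem_table4 (G : SimpleGraph (Fin 5)) (hG : IsInducedUniversalForTrees 4 G) :
    ∃ g ∈ table4.flatten, Nonempty (graphOfCode 5 g ≃g G) :=
  exists_iso_of_universal (ts := trees4) (trees := []) (ex := [])
    (ws := [[1, 0, 1, 2]])
    (by norm_num) (by norm_num) classifies_trees4 (by decide) (by decide) (by decide +kernel)
    (by decide) (by decide +kernel) (by
      simp only [List.forall_mem_cons, List.not_mem_nil, false_imp_iff, implies_true, and_true]
      exact search5_4_1012) (Fintype.card_fin _) hG

theorem not_universal_6_5 (G : SimpleGraph (Fin 6)) :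
    ¬IsInducedUniversalForTrees 5 G := by
  intro hG
  obtain ⟨g, hg, -⟩ := exists_iso_of_universal (ts := trees5) (trees := branchTrees5) (ex := [])
    (ws := [])
    (by norm_num) (by norm_num) classifies_trees5 (by decide) (by decide) (by decide +kernel)
    (by decide) (by decide +kernel) (by simp) (Fintype.card_fin _) hG (tbl := [])
  simp at hg

theorem search7_5_10122 :
    searchTable 7 5 branchTrees5 [] table5 [1, 0, 1, 2, 2] = true := by
  decide +kernel

theorem search7_5_12121 :
    searchTable 7 5 branchTrees5 [] table5 [1, 2, 1, 2, 1] = true := by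
  decide +kernel

theorem search7_5_21012 :
    searchTable 7 5 branchTrees5 [] table5 [2, 1, 0, 1, 2] = true := by
  decide +kernel

theorem exists_mem_table5 (G : SimpleGraph (Fin 7)) (hG : IsInducedUniversalForTrees 5 G) :
    ∃ g ∈ table5.flatten, Nonempty (graphOfCode 7 g ≃g G) :=
  exists_iso_of_universal (ts := trees5) (trees := branchTrees5) (ex := [])
    (ws := [[1, 0, 1, 2, 2], [1, 2, 1, 2, 1], [2, 1, 0, 1, 2]])
    (by norm_num) (by norm_num) classifies_trees5 (by decide) (by decide) (by decide +kernel)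
    (by decide) (by decide +kernel) (by
      simp only [List.forall_mem_cons, List.not_mem_nil, false_imp_iff, implies_true, and_true]
      exact ⟨search7_5_10122, search7_5_12121, search7_5_21012⟩) (Fintype.card_fin _) hG

theorem not_universal_8_6 (G : SimpleGraph (Fin 8)) :
    ¬IsInducedUniversalForTrees 6 G := by
  intro hG
  obtain ⟨g, hg, -⟩ := exists_iso_of_universal (ts := trees6) (trees := branchTrees6) (ex := [])
    (ws := [])
    (by norm_num) (by norm_num) classifies_trees6 (by decide) (by decide) (by decide +kernel)
    (by decide) (by decide +kernel) (by simp) (Fintype.card_fin _) hG (tbl := [])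
  simp at hg

theorem search9_6_101222 :
    searchTable 9 6 branchTrees6 [] table6 [1, 0, 1, 2, 2, 2] = true := by
  decide +kernel

theorem search9_6_121212 :
    searchTable 9 6 branchTrees6 [] table6 [1, 2, 1, 2, 1, 2] = true := by
  decide +kernel

theorem search9_6_121221 :
    searchTable 9 6 branchTrees6 [] table6 [1, 2, 1, 2, 2, 1] = true := by
  decide +kernel

theorem search9_6_210122 :
    searchTable 9 6 branchTrees6 [] table6 [2, 1, 0, 1, 2, 2] = true := by
  decide +kernel

theorem exists_mem_table6 (G : SimpleGraph (Fin 9)) (hG : IsInducedUniversalForTrees 6 G) :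
    ∃ g ∈ table6.flatten, Nonempty (graphOfCode 9 g ≃g G) :=
  exists_iso_of_universal (ts := trees6) (trees := branchTrees6) (ex := [])
    (ws := [[1, 0, 1, 2, 2, 2], [1, 2, 1, 2, 1, 2], [1, 2, 1, 2, 2, 1], [2, 1, 0, 1, 2, 2]])
    (by norm_num) (by norm_num) classifies_trees6 (by decide) (by decide) (by decide +kernel)
    (by decide) (by decide +kernel) (by
      simp only [List.forall_mem_cons, List.not_mem_nil, false_imp_iff, implies_true, and_true]
      exact ⟨search9_6_101222, search9_6_121212, search9_6_121221, search9_6_210122⟩) (Fintype.card_fin _) hG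

/-- For seven vertices counting alone does not exclude order `10`: four leaves of the star may be
every second vertex of the path, and `7 + 7 - 4 = 10`. As the table is empty, the search has to
refute every graph with this overlap. -/
theorem search10_7_1212121 :
    searchTable 10 7 branchTrees7 [[0, 0, 0, 1, 2, 3, 0]] [] [1, 2, 1, 2, 1, 2, 1] = true := by
  decide +kernel

theorem not_universal_10_7 (G : SimpleGraph (Fin 10)) :
    ¬IsInducedUniversalForTrees 7 G := by
  intro hG
  obtain ⟨g, hg, -⟩ := exists_iso_of_universal (ts := trees7) (trees := branchTrees7) (ex := [[0, 0, 0, 1, 2, 3, 0]])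
    (ws := [[1, 2, 1, 2, 1, 2, 1]])
    (by norm_num) (by norm_num) classifies_trees7 (by decide) (by decide) (by decide +kernel)
    (by decide) (by decide +kernel) (by
      simp only [List.forall_mem_cons, List.not_mem_nil, false_imp_iff, implies_true, and_true]
      exact search10_7_1212121) (Fintype.card_fin _) hG (tbl := [])
  simp at hg

/-- At order `11` the star and the path share at least `7 + 7 - 11 = 3` vertices. This and the
following nine searches treat the possible overlaps, one word from each pair of mutually reversed
words. -/
theorem search11_7_1012222 :
    searchTable 11 7 branchTrees7 [[0, 0, 0, 1, 2, 3, 0]] table7 [1, 0, 1, 2, 2, 2, 2] = true := by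
  decide +kernel

theorem search11_7_1212121 :
    searchTable 11 7 branchTrees7 [[0, 0, 0, 1, 2, 3, 0]] table7 [1, 2, 1, 2, 1, 2, 1] = true := by
  decide +kernel

theorem search11_7_1212122 :
    searchTable 11 7 branchTrees7 [[0, 0, 0, 1, 2, 3, 0]] table7 [1, 2, 1, 2, 1, 2, 2] = true := by
  decide +kernel

theorem search11_7_1212212 :
    searchTable 11 7 branchTrees7 [[0, 0, 0, 1, 2, 3, 0]] table7 [1, 2, 1, 2, 2, 1, 2] = true := by
  decide +kernel

theorem search11_7_1212221 :
    searchTable 11 7 branchTrees7 [[0, 0, 0, 1, 2, 3, 0]] table7 [1, 2, 1, 2, 2, 2, 1] = true := by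
  decide +kernel

theorem search11_7_1221212 :
    searchTable 11 7 branchTrees7 [[0, 0, 0, 1, 2, 3, 0]] table7 [1, 2, 2, 1, 2, 1, 2] = true := by
  decide +kernel

theorem search11_7_1221221 :
    searchTable 11 7 branchTrees7 [[0, 0, 0, 1, 2, 3, 0]] table7 [1, 2, 2, 1, 2, 2, 1] = true := by
  decide +kernel

theorem search11_7_2101222 :
    searchTable 11 7 branchTrees7 [[0, 0, 0, 1, 2, 3, 0]] table7 [2, 1, 0, 1, 2, 2, 2] = true := by
  decide +kernel

theorem search11_7_2121212 :
    searchTable 11 7 branchTrees7 [[0, 0, 0, 1, 2, 3, 0]] table7 [2, 1, 2, 1, 2, 1, 2] = true := by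
  decide +kernel

theorem search11_7_2210122 :
    searchTable 11 7 branchTrees7 [[0, 0, 0, 1, 2, 3, 0]] table7 [2, 2, 1, 0, 1, 2, 2] = true := by
  decide +kernel

theorem exists_mem_table7 (G : SimpleGraph (Fin 11)) (hG : IsInducedUniversalForTrees 7 G) :
    ∃ g ∈ table7.flatten, Nonempty (graphOfCode 11 g ≃g G) :=
  exists_iso_of_universal (ts := trees7) (trees := branchTrees7) (ex := [[0, 0, 0, 1, 2, 3, 0]])
    (ws := [[1, 0, 1, 2, 2, 2, 2], [1, 2, 1, 2, 1, 2, 1], [1, 2, 1, 2, 1, 2, 2],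
       [1, 2, 1, 2, 2, 1, 2], [1, 2, 1, 2, 2, 2, 1], [1, 2, 2, 1, 2, 1, 2],
       [1, 2, 2, 1, 2, 2, 1], [2, 1, 0, 1, 2, 2, 2], [2, 1, 2, 1, 2, 1, 2],
       [2, 2, 1, 0, 1, 2, 2]])
    (by norm_num) (by norm_num) classifies_trees7 (by decide) (by decide) (by decide +kernel)
    (by decide) (by decide +kernel) (by
      simp only [List.forall_mem_cons, List.not_mem_nil, false_imp_iff, implies_true, and_true]
      exact ⟨search11_7_1012222, search11_7_1212121, search11_7_1212122, search11_7_1212212,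
        search11_7_1212221, search11_7_1221212, search11_7_1221221, search11_7_2101222,
        search11_7_2121212, search11_7_2210122⟩) (Fintype.card_fin _) hG

/-! ### The graphs in the tables -/

theorem certified_table1 :
    certified 1 1 (trees1.map fun t => spec t []) table1.flatten placements1 = true := by
  decide +kernel

theorem distinct_table1 : distinct (table1.flatten.map (invariant 1)) = true := by
  decide +kernel

theorem loopless_table1 : table1.flatten.all (loopless 1) = true := by
  decide +kernel

theorem length_table1 : table1.flatten.length = 1 := by
  decide +kernel

theorem order_and_count_1 : treeUniversalOrder 1 = 1 ∧ treeUniversalCount 1 = 1 :=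
  order_and_count length_table1 (by norm_num)
    (fun _ => le_of_mem_treeUniversalOrders (by norm_num))
    (fun _ => universal_of_certified (by norm_num) classifies_trees1 certified_table1)
    exists_mem_table1 loopless_table1 distinct_table1

theorem certified_table2 :
    certified 2 2 (trees2.map fun t => spec t []) table2.flatten placements2 = true := by
  decide +kernel

theorem distinct_table2 : distinct (table2.flatten.map (invariant 2)) = true := by
  decide +kernel

theorem loopless_table2 : table2.flatten.all (loopless 2) = true := by
  decide +kernel

theorem length_table2 : table2.flatten.length = 1 := by
  decide +kernel

theorem order_and_count_2 : treeUniversalOrder 2 = 2 ∧ treeUniversalCount 2 = 1 :=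
  order_and_count length_table2 (by norm_num)
    (fun _ => le_of_mem_treeUniversalOrders (by norm_num))
    (fun _ => universal_of_certified (by norm_num) classifies_trees2 certified_table2)
    exists_mem_table2 loopless_table2 distinct_table2

theorem certified_table3 :
    certified 3 3 (trees3.map fun t => spec t []) table3.flatten placements3 = true := by
  decide +kernel

theorem distinct_table3 : distinct (table3.flatten.map (invariant 3)) = true := by
  decide +kernel

theorem loopless_table3 : table3.flatten.all (loopless 3) = true := by
  decide +kernel

theorem length_table3 : table3.flatten.length = 1 := by
  decide +kernel

theorem order_and_count_3 : treeUniversalOrder 3 = 3 ∧ treeUniversalCount 3 = 1 :=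
  order_and_count length_table3 (by norm_num)
    (fun _ => le_of_mem_treeUniversalOrders (by norm_num))
    (fun _ => universal_of_certified (by norm_num) classifies_trees3 certified_table3)
    exists_mem_table3 loopless_table3 distinct_table3

theorem certified_table4 :
    certified 5 4 (trees4.map fun t => spec t []) table4.flatten placements4 = true := by
  decide +kernel

theorem distinct_table4 : distinct (table4.flatten.map (invariant 5)) = true := by
  decide +kernel

theorem loopless_table4 : table4.flatten.all (loopless 5) = true := by
  decide +kernel

theorem length_table4 : table4.flatten.length = 2 := by
  decide +kernel

theorem order_and_count_4 : treeUniversalOrder 4 = 5 ∧ treeUniversalCount 4 = 2 :=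
  order_and_count length_table4 (by norm_num)
    (lower_bound not_universal_4_4)
    (fun _ => universal_of_certified (by norm_num) classifies_trees4 certified_table4)
    exists_mem_table4 loopless_table4 distinct_table4

theorem certified_table5 :
    certified 7 5 (trees5.map fun t => spec t []) table5.flatten placements5 = true := by
  decide +kernel

theorem distinct_table5 : distinct (table5.flatten.map (invariant 7)) = true := by
  decide +kernel

theorem loopless_table5 : table5.flatten.all (loopless 7) = true := by
  decide +kernel

theorem length_table5 : table5.flatten.length = 18 := by
  decide +kernel

theorem order_and_count_5 : treeUniversalOrder 5 = 7 ∧ treeUniversalCount 5 = 18 :=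
  order_and_count length_table5 (by norm_num)
    (lower_bound not_universal_6_5)
    (fun _ => universal_of_certified (by norm_num) classifies_trees5 certified_table5)
    exists_mem_table5 loopless_table5 distinct_table5

theorem certified_table6 :
    certified 9 6 (trees6.map fun t => spec t []) table6.flatten placements6 = true := by
  decide +kernel

theorem distinct_table6 : distinct (table6.flatten.map (invariant 9)) = true := by
  decide +kernel

theorem loopless_table6 : table6.flatten.all (loopless 9) = true := by
  decide +kernel

theorem length_table6 : table6.flatten.length = 66 := by
  decide +kernel

theorem order_and_count_6 : treeUniversalOrder 6 = 9 ∧ treeUniversalCount 6 = 66 :=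
  order_and_count length_table6 (by norm_num)
    (lower_bound not_universal_8_6)
    (fun _ => universal_of_certified (by norm_num) classifies_trees6 certified_table6)
    exists_mem_table6 loopless_table6 distinct_table6

theorem certified_table7 :
    certified 11 7 (trees7.map fun t => spec t []) table7.flatten placements7 = true := by
  decide +kernel

theorem distinct_table7 : distinct (table7.flatten.map (invariant 11)) = true := by
  decide +kernel

theorem loopless_table7 : table7.flatten.all (loopless 11) = true := by
  decide +kernel

theorem length_table7 : table7.flatten.length = 687 := by
  decide +kernel

theorem order_and_count_7 : treeUniversalOrder 7 = 11 ∧ treeUniversalCount 7 = 687 :=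
  order_and_count length_table7 (by norm_num)
    (lower_bound not_universal_10_7)
    (fun _ => universal_of_certified (by norm_num) classifies_trees7 certified_table7)
    exists_mem_table7 loopless_table7 distinct_table7

end TreeUniversal

theorem mainTheorem5 :
    (treeUniversalOrder 1 = 1 ∧ treeUniversalCount 1 = 1) ∧
    (treeUniversalOrder 2 = 2 ∧ treeUniversalCount 2 = 1) ∧
    (treeUniversalOrder 3 = 3 ∧ treeUniversalCount 3 = 1) ∧
    (treeUniversalOrder 4 = 5 ∧ treeUniversalCount 4 = 2) ∧
    (treeUniversalOrder 5 = 7 ∧ treeUniversalCount 5 = 18) ∧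
    (treeUniversalOrder 6 = 9 ∧ treeUniversalCount 6 = 66) ∧
    (treeUniversalOrder 7 = 11 ∧ treeUniversalCount 7 = 687) :=
  ⟨TreeUniversal.order_and_count_1, TreeUniversal.order_and_count_2,
    TreeUniversal.order_and_count_3, TreeUniversal.order_and_count_4,
    TreeUniversal.order_and_count_5, TreeUniversal.order_and_count_6,
    TreeUniversal.order_and_count_7⟩
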